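/- All vector spaces are over $\mathbb{Q}$ and $\mathbb{Z}$-graded, with the Koszul sign rule; operads are functors on nonempty finite sets and bijections, with a unit and partial compositions $\circ_\star$. The tensor product $\mathcal P\otimes\mathcal Q$ of operads has $(\mathcal P\otimes\mathcal Q)(I)=\mathcal P(I)\otimes\mathcal Q(I)$ and $(x_1\otimes x_2)\circ_\star(y_1\otimes y_2)=(-1)^{|x_2||y_1|}(x_1\circ_\star y_1)\otimes(x_2\circ_\star y_2)$. Let $\operatorname{Det}$ be the operad with $\operatorname{Det}(I)=\Lambda^{|I|}\mathbb{Q}I$ in degree $|I|-1$, unit $1\in\operatorname{Det}(\{1\})$ and composition $(x\wedge\star)\circ_\star y=x\wedge y$. Let $B$ be the operad of root-oriented forests: $B(I)$ is spanned by the exterior products $T_1\wedge\dots\wedge T_k$ ($k\ge 1$) of (non-planar) rooted binary trees whose leaves are, all together, bijectively labelled by $I$, such a product having degree $k-1$; the composition is $(x\wedge T)\circ_\star y=x\wedge(T\circ_\star y)$ for $\star$ a leaf of the tree $T$, where $\star\circ_\star y=y$ and, if $\star$ is a leaf of $T$ but not of $S$, $(S\vee T)\circ_\star y=D_S(T\circ_\star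 y)$ with $D_S(U_1\wedge\dots\wedge U_k)=\sum_m U_1\wedge\dots\wedge(S\vee U_m)\wedge\dots\wedge U_k$; here $S\vee T$ is the tree obtained by grafting $S$ and $T$ on a new bottom vertex. (This is the operad on $\operatorname{Det}\circ\operatorname{Gri}$ given by the distributive law $\omega_{i,\star}\circ_\star e_{j,k}=e_{j,\star}\circ_\star\omega_{i,k}-e_{k,\star}\circ_\star\omega_{i,j}$, where $e_{i,j}=i\wedge j$, $\omega_{i,j}=i\vee j$ and $\operatorname{Gri}$ is the operad of commutative non-associative algebras.) Let $\operatorname{Bess}=\operatorname{Det}\otimes B$, regraded (with the same parity) by the number of inner vertices of forests, and put $E_{i,j}=(j\wedge i)\otimes e_{i,j}$ (of degree $0$) and $\Omega_{i,j}=(i\wedge j)\otimes\omega_{i,j}$ (of degree $1$) in $\operatorname{Bess}(\{i,j\})$. Then $\operatorname{Bess}$ and $\operatorname{Bess}\otimes\operatorname{Bess}$ are operads, and there is exactly one morphism of operads $\Delta:\operatorname{Bess}\to\operatorname{Bess}\otimes\operatorname{Bess}$ such that $$\Delta(E_{i,j})=E_{i,j}\otimes E_{i,j},\qquad \Delta(\Omega_{i,j})=E_{i,j}\otimes\Omega_{i,j}+\Omega_{i,j}\otimes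 E_{i,j}.$$ It is coassociative, and it is cocommutative, i.e. invariant under $x\otimes y\mapsto(-1)^{|x||y|}y\otimes x$; so $\operatorname{Bess}$ is a Hopf operad. In particular, for each nonempty finite set $I$, the component $\Delta_I$ makes $\operatorname{Bess}(I)$ a (graded) cocommutative coalgebra, with a counit that vanishes in nonzero degrees. -/

import Mathlib

open scoped TensorProduct

noncomputable section

/-! ### Operads in graded vector spaces -/

/-- The data of an operad in `ℤ`-graded rational vector spaces (zero differential), without
operations of arity zero: a functor `obj` on nonempty finite sets and bijections, a grading `gr`,
the sign operator `par` (`x ↦ (-1)^(deg x) x`), a unit and partial compositions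
`x ∘_⋆ y`, where `x` has inputs `I ⊔ {⋆} = Option I` (so `⋆ = none`), `y` has inputs `J` and the
result has inputs `I ⊔ J`. The axioms are in `PreOperad.IsOperad`. -/
structure PreOperad where
  obj : (I : Type) → [Fintype I] → [Nonempty I] → Type
  [grp : ∀ (I : Type) [Fintype I] [Nonempty I], AddCommGroup (obj I)]
  [mod : ∀ (I : Type) [Fintype I] [Nonempty I], Module ℚ (obj I)]
  gr : (I : Type) → [Fintype I] → [Nonempty I] → ℤ → Submodule ℚ (obj I)
  par : (I : Type) → [Fintype I] → [Nonempty I] → obj I →ₗ[ℚ] obj I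
  map : {I J : Type} → [Fintype I] → [Nonempty I] → [Fintype J] → [Nonempty J] →
    I ≃ J → obj I →ₗ[ℚ] obj J
  one : obj Unit
  comp : {I J : Type} → [Fintype I] → [Fintype J] → [Nonempty J] →
    obj (Option I) →ₗ[ℚ] obj J →ₗ[ℚ] obj (I ⊕ J)

attribute [instance] PreOperad.grp PreOperad.mod

/-- `I ⊔ (J ⊔ {⋆}) ≃ (I ⊔ J) ⊔ {⋆}`. -/
def starRight (I J : Type) : I ⊕ Option J ≃ Option (I ⊕ J) where
  toFun
    | .inl i => some (.inl i)
    | .inr none => none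
    | .inr (some j) => some (.inr j)
  invFun
    | none => .inr none
    | some (.inl i) => .inl i
    | some (.inr j) => .inr (some j)
  left_inv := by rintro (i | (_ | j)) <;> rfl
  right_inv := by rintro (_ | (i | j)) <;> rfl

/-- `(I ⊔ {⋆}) ⊔ J ≃ (I ⊔ J) ⊔ {⋆}`. -/
def starLeft (I J : Type) : Option I ⊕ J ≃ Option (I ⊕ J) where
  toFun
    | .inl none => none
    | .inl (some i) => some (.inl i)
    | .inr j => some (.inr j)
  invFun
    | none => .inl none
    | some (.inl i) => .inl (some i)
    | some (.inr j) => .inr j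
  left_inv := by rintro ((_ | i) | j) <;> rfl
  right_inv := by rintro (_ | (i | j)) <;> rfl

/-- Exchange of the two marked points `#` and `⋆` of `(I ⊔ {⋆}) ⊔ {#}`. -/
def starSwap (I : Type) : Option (Option I) ≃ Option (Option I) where
  toFun
    | none => some none
    | some none => none
    | some (some i) => some (some i)
  invFun
    | none => some none
    | some none => none
    | some (some i) => some (some i)
  left_inv := by rintro (_ | _ | i) <;> rfl
  right_inv := by rintro (_ | _ | i) <;> rfl

/-- `(I ⊔ J) ⊔ K ≃ (I ⊔ K) ⊔ J`. -/
def sumExchange (I J K : Type) : (I ⊕ J) ⊕ K ≃ (I ⊕ K) ⊕ J where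
  toFun
    | .inl (.inl i) => .inl (.inl i)
    | .inl (.inr j) => .inr j
    | .inr k => .inl (.inr k)
  invFun
    | .inl (.inl i) => .inl (.inl i)
    | .inl (.inr k) => .inr k
    | .inr j => .inl (.inr j)
  left_inv := by rintro ((i | j) | k) <;> rfl
  right_inv := by rintro ((i | k) | j) <;> rfl

namespace PreOperad

/-- The axioms of an operad in graded vector spaces, with the Koszul sign rule. -/
structure IsOperad (P : PreOperad) : Prop where
  gr_internal : ∀ (I : Type) [Fintype I] [Nonempty I], DirectSum.IsInternal (P.gr I)
  par_apply : ∀ (I : Type) [Fintype I] [Nonempty I] (n : ℤ), ∀ x ∈ P.gr I n,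
    P.par I x = n.negOnePow • x
  map_refl : ∀ (I : Type) [Fintype I] [Nonempty I], P.map (Equiv.refl I) = LinearMap.id
  map_trans : ∀ {I J K : Type} [Fintype I] [Nonempty I] [Fintype J] [Nonempty J] [Fintype K]
    [Nonempty K] (e : I ≃ J) (f : J ≃ K), P.map (e.trans f) = P.map f ∘ₗ P.map e
  map_mem : ∀ {I J : Type} [Fintype I] [Nonempty I] [Fintype J] [Nonempty J] (e : I ≃ J) (n : ℤ),
    ∀ x ∈ P.gr I n, P.map e x ∈ P.gr J n
  one_mem : P.one ∈ P.gr Unit 0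
  comp_mem : ∀ {I J : Type} [Fintype I] [Fintype J] [Nonempty J] (m n : ℤ),
    ∀ x ∈ P.gr (Option I) m, ∀ y ∈ P.gr J n, P.comp x y ∈ P.gr (I ⊕ J) (m + n)
  comp_map : ∀ {I I' J J' : Type} [Fintype I] [Fintype I'] [Fintype J] [Nonempty J]
    [Fintype J'] [Nonempty J'] (e : I ≃ I') (f : J ≃ J') (x : P.obj (Option I)) (y : P.obj J),
    P.comp (P.map e.optionCongr x) (P.map f y) = P.map (e.sumCongr f) (P.comp x y)
  comp_one : ∀ {I : Type} [Fintype I] (x : P.obj (Option I)),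
    P.comp x P.one = P.map (Equiv.optionEquivSumPUnit I) x
  one_comp : ∀ {J : Type} [Fintype J] [Nonempty J] (y : P.obj J),
    P.comp (P.map (Equiv.ofUnique Unit (Option Empty)) P.one) y =
      P.map (Equiv.emptySum Empty J).symm y
  /-- `(x ∘_⋆ y) ∘_# z = x ∘_⋆ (y ∘_# z)` for `#` an input of `y`. -/
  comp_comp : ∀ {I J K : Type} [Fintype I] [Fintype J] [Fintype K] [Nonempty K]
    (x : P.obj (Option I)) (y : P.obj (Option J)) (z : P.obj K),
    P.map (Equiv.sumAssoc I J K) (P.comp (P.map (starRight I J) (P.comp x y)) z) =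
      P.comp x (P.comp y z)
  /-- `(x ∘_# z) ∘_⋆ y = (-1)^(|y| |z|) (x ∘_⋆ y) ∘_# z` for `⋆`, `#` two inputs of `x`. -/
  comp_comm : ∀ {I J K : Type} [Fintype I] [Fintype J] [Nonempty J] [Fintype K] [Nonempty K]
    (m n : ℤ) (x : P.obj (Option (Option I))), ∀ y ∈ P.gr J m, ∀ z ∈ P.gr K n,
    P.comp (P.map (starLeft I K) (P.comp x z)) y =
      (m * n).negOnePow • P.map (sumExchange I J K)
        (P.comp (P.map (starLeft I J) (P.comp (P.map (starSwap I) x) y)) z)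

/-- The tensor product of two operads, with
`(x₁ ⊗ x₂) ∘ (y₁ ⊗ y₂) = (-1)^(|x₂| |y₁|) (x₁ ∘ y₁) ⊗ (x₂ ∘ y₂)`.
The sign is written as `(-1)^(a b) = (1 + (-1)^a + (-1)^b - (-1)^a (-1)^b) / 2`. -/
def tensor (P Q : PreOperad) : PreOperad where
  obj I _ _ := P.obj I ⊗[ℚ] Q.obj I
  gr I _ _ n := ⨆ k : ℤ, LinearMap.range
    (TensorProduct.map (P.gr I k).subtype (Q.gr I (n - k)).subtype)
  par I _ _ := TensorProduct.map (P.par I) (Q.par I)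
  map e := TensorProduct.map (P.map e) (Q.map e)
  one := P.one ⊗ₜ Q.one
  comp {I J} _ _ _ :=
    let c := TensorProduct.map₂ (P.comp (I := I) (J := J)) (Q.comp (I := I) (J := J))
    let s := (Q.par (Option I)).lTensor (P.obj (Option I))
    let t := (P.par J).rTensor (Q.obj J)
    (1 / 2 : ℚ) • (c + c ∘ₗ s + c.compl₂ t - c.compl₁₂ s t)

/-- Morphisms of operads. -/
@[ext]
structure Hom (P Q : PreOperad) where
  app : (I : Type) → [Fintype I] → [Nonempty I] → P.obj I →ₗ[ℚ] Q.obj I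
  app_mem : ∀ (I : Type) [Fintype I] [Nonempty I] (n : ℤ), ∀ x ∈ P.gr I n, app I x ∈ Q.gr I n
  app_map : ∀ {I J : Type} [Fintype I] [Nonempty I] [Fintype J] [Nonempty J] (e : I ≃ J)
    (x : P.obj I), app J (P.map e x) = Q.map e (app I x)
  app_one : app Unit P.one = Q.one
  app_comp : ∀ {I J : Type} [Fintype I] [Fintype J] [Nonempty J] (x : P.obj (Option I))
    (y : P.obj J), app (I ⊕ J) (P.comp x y) = Q.comp (app (Option I) x) (app J y)

/-- The symmetry `x ⊗ y ↦ (-1)^(|x| |y|) y ⊗ x` of `P(I) ⊗ P(I)`. -/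
def koszulSwap (P : PreOperad) (I : Type) [Fintype I] [Nonempty I] :
    P.obj I ⊗[ℚ] P.obj I →ₗ[ℚ] P.obj I ⊗[ℚ] P.obj I :=
  (TensorProduct.comm ℚ (P.obj I) (P.obj I)).toLinearMap ∘ₗ
    ((1 / 2 : ℚ) • (LinearMap.id + (P.par I).rTensor (P.obj I) + (P.par I).lTensor (P.obj I)
      - TensorProduct.map (P.par I) (P.par I)))

/-- The component `P(I) → P(I) ⊗ P(I)` of a morphism `P → P ⊗ P`. -/
def Hom.coprod {P : PreOperad} (Δ : Hom P (P.tensor P)) (I : Type) [Fintype I] [Nonempty I] :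
    P.obj I →ₗ[ℚ] P.obj I ⊗[ℚ] P.obj I :=
  Δ.app I

def Hom.Coassociative {P : PreOperad} (Δ : Hom P (P.tensor P)) : Prop :=
  ∀ (I : Type) [Fintype I] [Nonempty I],
    (TensorProduct.assoc ℚ (P.obj I) (P.obj I) (P.obj I)).toLinearMap ∘ₗ
      (Δ.coprod I).rTensor (P.obj I) ∘ₗ Δ.coprod I = (Δ.coprod I).lTensor (P.obj I) ∘ₗ Δ.coprod I

def Hom.Cocommutative {P : PreOperad} (Δ : Hom P (P.tensor P)) : Prop :=
  ∀ (I : Type) [Fintype I] [Nonempty I], P.koszulSwap I ∘ₗ Δ.coprod I = Δ.coprod I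

end PreOperad

/-! ### Wedge products -/

/-- The wedge product `x₁ ∧ ⋯ ∧ xₖ` of elements of a set `X`, in the exterior algebra of `ℚX`. -/
def wedge {X : Type} (L : List X) : ExteriorAlgebra ℚ (X →₀ ℚ) :=
  (L.map fun x => ExteriorAlgebra.ι ℚ (Finsupp.single x (1 : ℚ))).prod

/-- If every `x : X` has a multiset `lv x` of labels in `I`: the span of the `x₁ ∧ ⋯ ∧ xₖ` whose
labels, taken together, form the multiset `m`. -/
def content {X I : Type} (lv : X → Multiset I) (m : Multiset I) :
    Submodule ℚ (ExteriorAlgebra ℚ (X →₀ ℚ)) :=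
  Submodule.span ℚ {w | ∃ L : List X, (L.map lv).sum = m ∧ w = wedge L}

section Wedge

variable {M N V : Type} [AddCommGroup M] [Module ℚ M] [AddCommGroup N] [Module ℚ N]
  [AddCommGroup V] [Module ℚ V]

/-- The step `(a, b) ↦ (r(x) ∧ a, r(x) ∧ b + (-1)^(deg a) a ∧ f(x))`. -/
def insStep (r : M →ₗ[ℚ] N) (f : M →ₗ[ℚ] V →ₗ[ℚ] ExteriorAlgebra ℚ N) :
    M →ₗ[ℚ] (ExteriorAlgebra ℚ N × (V →ₗ[ℚ] ExteriorAlgebra ℚ N)) →ₗ[ℚ]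
      (ExteriorAlgebra ℚ N × (V →ₗ[ℚ] ExteriorAlgebra ℚ N)) :=
  LinearMap.mk₂ ℚ
    (fun x ab => (ExteriorAlgebra.ι ℚ (r x) * ab.1,
      LinearMap.mulLeft ℚ (ExteriorAlgebra.ι ℚ (r x)) ∘ₗ ab.2 +
        LinearMap.mulLeft ℚ (CliffordAlgebra.involute ab.1) ∘ₗ f x))
    (by intro x x' ab
        refine Prod.ext (by simp [add_mul]) (LinearMap.ext fun v => ?_)
        simp [add_mul, mul_add]; abel)
    (by intro c x ab
        refine Prod.ext (by simp) (LinearMap.ext fun v => ?_)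
        simp)
    (by intro x ab ab'
        refine Prod.ext (by simp [mul_add]) (LinearMap.ext fun v => ?_)
        simp [add_mul, mul_add]; abel)
    (by intro c x ab
        refine Prod.ext (by simp) (LinearMap.ext fun v => ?_)
        simp)

theorem insStep_apply (r : M →ₗ[ℚ] N) (f : M →ₗ[ℚ] V →ₗ[ℚ] ExteriorAlgebra ℚ N) (x : M)
    (ab : ExteriorAlgebra ℚ N × (V →ₗ[ℚ] ExteriorAlgebra ℚ N)) :
    insStep r f x ab = (ExteriorAlgebra.ι ℚ (r x) * ab.1,
      LinearMap.mulLeft ℚ (ExteriorAlgebra.ι ℚ (r x)) ∘ₗ ab.2 +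
        LinearMap.mulLeft ℚ (CliffordAlgebra.involute ab.1) ∘ₗ f x) := rfl

theorem insStep_sq (r : M →ₗ[ℚ] N) (f : M →ₗ[ℚ] V →ₗ[ℚ] ExteriorAlgebra ℚ N) (x : M)
    (ab : ExteriorAlgebra ℚ N × (V →ₗ[ℚ] ExteriorAlgebra ℚ N)) :
    insStep r f x (insStep r f x ab) = (0 : QuadraticForm ℚ M) x • ab := by
  refine Prod.ext ?_ (LinearMap.ext fun v => ?_)
  · simp [insStep, ← mul_assoc]
  · simp [insStep, ← mul_assoc, mul_add]

/-- The insertion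
`x₁ ∧ ⋯ ∧ xₖ ↦ (v ↦ ∑ₘ (-1)^(k - m) r(x₁) ∧ ⋯ (m-th factor omitted) ⋯ ∧ r(xₖ) ∧ f(xₘ)(v))`:
each factor `xₘ` in turn is moved to the last place and replaced by `f(xₘ)(v)`. -/
def insertion (r : M →ₗ[ℚ] N) (f : M →ₗ[ℚ] V →ₗ[ℚ] ExteriorAlgebra ℚ N) :
    ExteriorAlgebra ℚ M →ₗ[ℚ] V →ₗ[ℚ] ExteriorAlgebra ℚ N :=
  LinearMap.snd ℚ _ _ ∘ₗ CliffordAlgebra.foldr 0 (insStep r f) (insStep_sq r f) (1, 0)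

/-- The step `(a, b) ↦ (x ∧ a, d(x) ∧ a + x ∧ b)`. -/
def derStep (d : M →ₗ[ℚ] M) :
    M →ₗ[ℚ] (ExteriorAlgebra ℚ M × ExteriorAlgebra ℚ M) →ₗ[ℚ]
      (ExteriorAlgebra ℚ M × ExteriorAlgebra ℚ M) :=
  LinearMap.mk₂ ℚ
    (fun x ab => (ExteriorAlgebra.ι ℚ x * ab.1,
      ExteriorAlgebra.ι ℚ (d x) * ab.1 + ExteriorAlgebra.ι ℚ x * ab.2))
    (by intro x x' ab
        refine Prod.ext (by simp [add_mul]) ?_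
        simp [add_mul]; abel)
    (by intro c x ab; refine Prod.ext (by simp) (by simp))
    (by intro x ab ab'
        refine Prod.ext (by simp [mul_add]) ?_
        simp [mul_add]; abel)
    (by intro c x ab; refine Prod.ext (by simp) (by simp))

theorem derStep_apply (d : M →ₗ[ℚ] M) (x : M)
    (ab : ExteriorAlgebra ℚ M × ExteriorAlgebra ℚ M) :
    derStep d x ab = (ExteriorAlgebra.ι ℚ x * ab.1,
      ExteriorAlgebra.ι ℚ (d x) * ab.1 + ExteriorAlgebra.ι ℚ x * ab.2) := rfl

theorem derStep_sq (d : M →ₗ[ℚ] M) (x : M) (ab : ExteriorAlgebra ℚ M × ExteriorAlgebra ℚ M) :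
    derStep d x (derStep d x ab) = (0 : QuadraticForm ℚ M) x • ab := by
  refine Prod.ext ?_ ?_
  · simp [derStep, ← mul_assoc]
  · simp only [derStep, LinearMap.mk₂_apply, mul_add, ← mul_assoc, ExteriorAlgebra.ι_sq_zero,
      zero_mul, add_zero, ← add_mul, ExteriorAlgebra.ι_add_mul_swap]
    simp

/-- The even derivation of the exterior algebra that extends `d`:
`x₁ ∧ ⋯ ∧ xₖ ↦ ∑ₘ x₁ ∧ ⋯ ∧ d(xₘ) ∧ ⋯ ∧ xₖ`. -/
def derivation (d : M →ₗ[ℚ] M) : ExteriorAlgebra ℚ M →ₗ[ℚ] ExteriorAlgebra ℚ M :=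
  LinearMap.snd ℚ _ _ ∘ₗ CliffordAlgebra.foldr 0 (derStep d) (derStep_sq d) (1, 0)

end Wedge

section Content

variable {X Y I J : Type}

theorem wedge_mem_content (lv : X → Multiset I) (L : List X) :
    wedge L ∈ content lv (L.map lv).sum :=
  Submodule.subset_span ⟨L, rfl, rfl⟩

theorem ι_mem_content (lv : X → Multiset I) (x : X) :
    ExteriorAlgebra.ι ℚ (Finsupp.single x (1 : ℚ)) ∈ content lv (lv x) :=
  Submodule.subset_span ⟨[x], by simp, by simp [wedge]⟩

theorem mul_mem_content {lv : X → Multiset I} {m m' : Multiset I}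
    {a b : ExteriorAlgebra ℚ (X →₀ ℚ)} (ha : a ∈ content lv m) (hb : b ∈ content lv m') :
    a * b ∈ content lv (m + m') := by
  have h := Submodule.mul_mem_mul ha hb
  rw [content, content, Submodule.span_mul_span] at h
  refine Submodule.span_mono ?_ h
  rintro _ ⟨_, ⟨L, hL, rfl⟩, _, ⟨L', hL', rfl⟩, rfl⟩
  exact ⟨L ++ L', by simp [hL, hL'], by simp [wedge]⟩

theorem one_mem_content (lv : X → Multiset I) :
    (1 : ExteriorAlgebra ℚ (X →₀ ℚ)) ∈ content lv 0 :=
  Submodule.subset_span ⟨[], by simp, by simp [wedge]⟩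

theorem involute_wedge (L : List X) :
    CliffordAlgebra.involute (wedge L) = (-1 : ℚ) ^ L.length • wedge L := by
  have h := CliffordAlgebra.involute_prod_map_ι (Q := (0 : QuadraticForm ℚ (X →₀ ℚ)))
    (L.map fun x => Finsupp.single x (1 : ℚ))
  simpa [wedge, List.map_map, Function.comp_def] using h

theorem involute_mem_content {lv : X → Multiset I} {m : Multiset I}
    {a : ExteriorAlgebra ℚ (X →₀ ℚ)} (ha : a ∈ content lv m) :
    CliffordAlgebra.involute a ∈ content lv m := by
  induction ha using Submodule.span_induction with
  | mem w hw =>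
    obtain ⟨L, hL, rfl⟩ := hw
    rw [involute_wedge]
    exact Submodule.smul_mem _ _ (hL ▸ wedge_mem_content lv L)
  | zero => simp
  | add a b _ _ ha hb => rw [map_add]; exact Submodule.add_mem _ ha hb
  | smul c a _ ha => rw [map_smul]; exact Submodule.smul_mem _ _ ha

theorem map_wedge (g : X → Y) (L : List X) :
    ExteriorAlgebra.map (Finsupp.lmapDomain ℚ ℚ g) (wedge L) = wedge (L.map g) := by
  simp [wedge, map_list_prod, List.map_map, Function.comp_def]

theorem map_mem_content {lv : X → Multiset I} {lv' : Y → Multiset J} (g : X → Y) (e : I → J)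
    (hg : ∀ x, lv' (g x) = (lv x).map e) {m : Multiset I}
    {a : ExteriorAlgebra ℚ (X →₀ ℚ)} (ha : a ∈ content lv m) :
    ExteriorAlgebra.map (Finsupp.lmapDomain ℚ ℚ g) a ∈ content lv' (m.map e) := by
  induction ha using Submodule.span_induction with
  | mem w hw =>
    obtain ⟨L, rfl, rfl⟩ := hw
    rw [map_wedge]
    refine Submodule.subset_span ⟨L.map g, ?_, rfl⟩
    induction L with
    | nil => simp
    | cons x L ih => simp only [List.map_cons, List.sum_cons, hg, ih, Multiset.map_add]
  | zero => simp
  | add a b _ _ ha hb => rw [map_add]; exact Submodule.add_mem _ ha hb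
  | smul c a _ ha => rw [map_smul]; exact Submodule.smul_mem _ _ ha

theorem derivation_mem_content {lv : X → Multiset I} {p : Multiset I}
    (d : (X →₀ ℚ) →ₗ[ℚ] (X →₀ ℚ))
    (hd : ∀ x, ExteriorAlgebra.ι ℚ (d (Finsupp.single x 1)) ∈ content lv (p + lv x))
    {m : Multiset I} {a : ExteriorAlgebra ℚ (X →₀ ℚ)} (ha : a ∈ content lv m) :
    derivation d a ∈ content lv (p + m) := by
  induction ha using Submodule.span_induction with
  | mem w hw =>
    obtain ⟨L, rfl, rfl⟩ := hw
    have key : ∀ L : List X,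
        (CliffordAlgebra.foldr 0 (derStep d) (derStep_sq d) (1, 0) (wedge L)).1 = wedge L ∧
        derivation d (wedge L) ∈ content lv (p + (L.map lv).sum) := by
      intro L
      induction L with
      | nil => simp [wedge, derivation]
      | cons x L ih =>
        obtain ⟨h1, h2⟩ := ih
        have hw : wedge (x :: L) = ExteriorAlgebra.ι ℚ (Finsupp.single x 1) * wedge L := by
          simp [wedge]
        rw [hw]
        refine ⟨by simp [derStep_apply, h1], ?_⟩
        have : derivation d (ExteriorAlgebra.ι ℚ (Finsupp.single x 1) * wedge L) =
            ExteriorAlgebra.ι ℚ (d (Finsupp.single x 1)) * wedge L +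
              ExteriorAlgebra.ι ℚ (Finsupp.single x 1) * derivation d (wedge L) := by
          simp [derivation, derStep_apply, h1]
        rw [this, List.map_cons, List.sum_cons]
        refine Submodule.add_mem _ ?_ ?_
        · rw [← add_assoc]
          exact mul_mem_content (hd x) (wedge_mem_content lv L)
        · rw [add_left_comm]
          exact mul_mem_content (ι_mem_content lv x) h2
    exact (key L).2
  | zero => simp
  | add a b _ _ ha hb => rw [map_add]; exact Submodule.add_mem _ ha hb
  | smul c a _ ha => rw [map_smul]; exact Submodule.smul_mem _ _ ha

/-- A multiset of elements of `I ⊔ {⋆}` has no `⋆`, or one, or more. -/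
theorem star_cases (m : Multiset (Option I)) :
    (∃ k : Multiset I, m = k.map some) ∨ ∃ k, m = none ::ₘ k := by
  by_cases h : none ∈ m
  · exact Or.inr (Multiset.exists_cons_of_mem h)
  · refine Or.inl ?_
    refine ⟨m.attach.map fun a => (a.1.get (by
      obtain ⟨a, ha⟩ := a
      rcases a with _ | a
      · exact absurd ha h
      · rfl)), ?_⟩
    rw [Multiset.map_map]
    conv_lhs => rw [← Multiset.attach_map_val m]
    refine Multiset.map_congr rfl ?_
    rintro a -
    simp

theorem insertion_mem_content {V : Type} [AddCommGroup V] [Module ℚ V]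
    {lv : X → Multiset (Option I)} {lv' : Y → Multiset (I ⊕ J)}
    (r : (X →₀ ℚ) →ₗ[ℚ] (Y →₀ ℚ))
    (f : (X →₀ ℚ) →ₗ[ℚ] V →ₗ[ℚ] ExteriorAlgebra ℚ (Y →₀ ℚ)) (v : V) (q : Multiset J)
    (hr : ∀ (x : X) (k : Multiset I), lv x = k.map some →
      ExteriorAlgebra.ι ℚ (r (Finsupp.single x 1)) ∈ content lv' (k.map Sum.inl))
    (hr0 : ∀ x, none ∈ lv x → r (Finsupp.single x 1) = 0)
    (hf0 : ∀ x, none ∉ lv x → f (Finsupp.single x 1) = 0)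
    (hf : ∀ (x : X) (k : Multiset I), lv x = none ::ₘ k.map some →
      f (Finsupp.single x 1) v ∈ content lv' (k.map Sum.inl + q.map Sum.inr))
    {k : Multiset I} {a : ExteriorAlgebra ℚ (X →₀ ℚ)}
    (ha : a ∈ content lv (none ::ₘ k.map some)) :
    insertion r f a v ∈ content lv' (k.map Sum.inl + q.map Sum.inr) := by
  have split : ∀ (p s : Multiset (Option I)) (k : Multiset I), p + s = k.map some →
      ∃ k₁ k₂ : Multiset I, p = k₁.map some ∧ s = k₂.map some ∧ k₁ + k₂ = k := by
    intro p s k h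
    have hn : none ∉ p + s := by rw [h]; simp
    rw [Multiset.mem_add, not_or] at hn
    rcases star_cases p with ⟨k₁, h₁⟩ | ⟨k₁, h₁⟩
    swap
    · exact absurd (by rw [h₁]; simp) hn.1
    rcases star_cases s with ⟨k₂, h₂⟩ | ⟨k₂, h₂⟩
    swap
    · exact absurd (by rw [h₂]; simp) hn.2
    refine ⟨k₁, k₂, h₁, h₂, ?_⟩
    rw [h₁, h₂, ← Multiset.map_add] at h
    exact Multiset.map_injective (Option.some_injective I) h
  induction ha using Submodule.span_induction with
  | mem w hw =>
    obtain ⟨L, hL, rfl⟩ := hw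
    have key : ∀ L : List X,
        (∀ k : Multiset I, (L.map lv).sum = k.map some →
          (CliffordAlgebra.foldr 0 (insStep r f) (insStep_sq r f) (1, 0) (wedge L)).1 ∈
            content lv' (k.map Sum.inl) ∧ insertion r f (wedge L) = 0) ∧
        (∀ k : Multiset I, (L.map lv).sum = none ::ₘ k.map some →
          (CliffordAlgebra.foldr 0 (insStep r f) (insStep_sq r f) (1, 0) (wedge L)).1 = 0 ∧
          insertion r f (wedge L) v ∈ content lv' (k.map Sum.inl + q.map Sum.inr)) := by
      intro L
      induction L with
      | nil =>
        refine ⟨fun k hk => ?_, fun k hk => ?_⟩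
        · have : k = 0 := by
            simpa [eq_comm] using hk
          subst this
          simpa [wedge, insertion] using one_mem_content lv'
        · simp at hk
      | cons x L ih =>
        have hw : wedge (x :: L) = ExteriorAlgebra.ι ℚ (Finsupp.single x 1) * wedge L := by
          simp [wedge]
        have h1 : (CliffordAlgebra.foldr 0 (insStep r f) (insStep_sq r f) (1, 0)
            (wedge (x :: L))).1 = ExteriorAlgebra.ι ℚ (r (Finsupp.single x 1)) *
            (CliffordAlgebra.foldr 0 (insStep r f) (insStep_sq r f) (1, 0) (wedge L)).1 := by
          rw [hw]; simp [insStep_apply]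
        have h2 : insertion r f (wedge (x :: L)) =
            LinearMap.mulLeft ℚ (ExteriorAlgebra.ι ℚ (r (Finsupp.single x 1))) ∘ₗ
              insertion r f (wedge L) +
            LinearMap.mulLeft ℚ (CliffordAlgebra.involute
              (CliffordAlgebra.foldr 0 (insStep r f) (insStep_sq r f) (1, 0) (wedge L)).1) ∘ₗ
              f (Finsupp.single x 1) := by
          rw [hw]; simp [insStep_apply, insertion]
        rw [h1, h2]
        simp only [List.map_cons, List.sum_cons]
        refine ⟨fun k hk => ?_, fun k hk => ?_⟩
        · obtain ⟨k₁, k₂, e₁, e₂, rfl⟩ := split _ _ _ hk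
          obtain ⟨i1, i2⟩ := ih.1 k₂ e₂
          rw [Multiset.map_add]
          refine ⟨mul_mem_content (hr x k₁ e₁) i1, ?_⟩
          rw [i2, hf0 x (by rw [e₁]; simp)]
          simp
        · have hn : none ∈ lv x + (L.map lv).sum := by rw [hk]; simp
          rcases star_cases (lv x) with ⟨k₁, e₁⟩ | ⟨k₁, e₁⟩
          · rcases Multiset.mem_add.1 hn with hx | hx
            · rw [e₁] at hx; simp at hx
            obtain ⟨s, hs⟩ := Multiset.exists_cons_of_mem hx
            rw [hs, Multiset.add_cons, Multiset.cons_inj_right] at hk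
            obtain ⟨k₁', k₂, e₁', e₂, rfl⟩ := split _ _ _ hk
            obtain ⟨i1, i2⟩ := ih.2 k₂ (by rw [hs, e₂])
            rw [i1, hf0 x (by rw [e₁]; simp)]
            refine ⟨by simp, ?_⟩
            have := mul_mem_content (hr x k₁' e₁') i2
            simpa [add_assoc] using this
          · rw [e₁, Multiset.cons_add, Multiset.cons_inj_right] at hk
            obtain ⟨k₁', k₂, e₁', e₂, rfl⟩ := split _ _ _ hk
            obtain ⟨i1, i2⟩ := ih.1 k₂ e₂
            rw [i2, hr0 x (by rw [e₁]; simp)]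
            refine ⟨by simp, ?_⟩
            have := mul_mem_content (involute_mem_content i1) (hf x k₁' (by rw [e₁, e₁']))
            have e : (k₁' + k₂).map Sum.inl + q.map Sum.inr =
                k₂.map Sum.inl + (k₁'.map Sum.inl + q.map (Sum.inr : J → I ⊕ J)) := by
              rw [Multiset.map_add, ← add_assoc, add_comm (k₁'.map _)]
            rw [e]
            simpa using this
    exact ((key L).2 k hL).2
  | zero => simp
  | add a b _ _ ha hb =>
    rw [map_add, LinearMap.add_apply]; exact Submodule.add_mem _ ha hb
  | smul c a _ ha => rw [map_smul, LinearMap.smul_apply]; exact Submodule.smul_mem _ _ ha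

end Content

/-- Restriction of a bilinear map to submodules. -/
def restrictBilin {A B C : Type} [AddCommGroup A] [Module ℚ A] [AddCommGroup B] [Module ℚ B]
    [AddCommGroup C] [Module ℚ C] (c : A →ₗ[ℚ] B →ₗ[ℚ] C) (p : Submodule ℚ A)
    (q : Submodule ℚ B) (t : Submodule ℚ C) (h : ∀ a ∈ p, ∀ b ∈ q, c a b ∈ t) :
    p →ₗ[ℚ] q →ₗ[ℚ] t :=
  LinearMap.mk₂ ℚ (fun a b => ⟨c a b, h a a.2 b b.2⟩)
    (fun _ _ _ => Subtype.ext (by simp)) (fun _ _ _ => Subtype.ext (by simp))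
    (fun _ _ _ => Subtype.ext (by simp)) (fun _ _ _ => Subtype.ext (by simp))

theorem univ_val_option (I : Type) [Fintype I] :
    (Finset.univ : Finset (Option I)).val = none ::ₘ (Finset.univ : Finset I).val.map some :=
  rfl

theorem univ_val_sum (I J : Type) [Fintype I] [Fintype J] :
    (Finset.univ : Finset (I ⊕ J)).val =
      (Finset.univ : Finset I).val.map Sum.inl + (Finset.univ : Finset J).val.map Sum.inr :=
  rfl

theorem univ_val_equiv {I J : Type} [Fintype I] [Fintype J] (e : I ≃ J) :
    (Finset.univ : Finset I).val.map e = (Finset.univ : Finset J).val := by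
  simp

/-! ### The determinant operad -/

/-- The space spanned by the orientations `i₁ ∧ ⋯ ∧ iₙ` of `I`, i.e. the top exterior power
of `ℚI`. -/
def detSpace (I : Type) [Fintype I] : Submodule ℚ (ExteriorAlgebra ℚ (I →₀ ℚ)) :=
  content (fun i => {i}) (Finset.univ : Finset I).val

/-- The composition `(x ∧ ⋆) ∘_⋆ y = x ∧ y` on exterior algebras. -/
def detComp (I J : Type) : ExteriorAlgebra ℚ (Option I →₀ ℚ) →ₗ[ℚ]
    ExteriorAlgebra ℚ (J →₀ ℚ) →ₗ[ℚ] ExteriorAlgebra ℚ ((I ⊕ J) →₀ ℚ) :=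
  insertion
    (Finsupp.linearCombination ℚ fun o : Option I =>
      o.elim 0 fun i => Finsupp.single (Sum.inl i) (1 : ℚ))
    (Finsupp.linearCombination ℚ fun o : Option I =>
      o.elim (ExteriorAlgebra.map (Finsupp.lmapDomain ℚ ℚ (Sum.inr : J → I ⊕ J))).toLinearMap
        fun _ => 0)

theorem detComp_mem {I J : Type} [Fintype I] [Fintype J] :
    ∀ a ∈ detSpace (Option I), ∀ b ∈ detSpace J, detComp I J a b ∈ detSpace (I ⊕ J) := by
  intro a ha b hb
  rw [detSpace, univ_val_option] at ha
  rw [detSpace, univ_val_sum]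
  refine insertion_mem_content _ _ b _ ?_ ?_ ?_ ?_ ha
  · rintro (_ | i) k hk
    · have : (none : Option I) ∈ k.map some := by rw [← hk]; simp
      simp at this
    · have : k = {i} := by
        apply Multiset.map_injective (Option.some_injective I)
        rw [← hk]; rfl
      subst this
      simpa using ι_mem_content (fun s : I ⊕ J => ({s} : Multiset (I ⊕ J))) (Sum.inl i)
  · rintro (_ | i) h
    · simp
    · simp at h
  · rintro (_ | i) h
    · simp at h
    · simp
  · rintro (_ | i) k hk
    · have : k = 0 := by
        have hk' : ({none} : Multiset (Option I)) = {none} + k.map some := hk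
        simpa using hk'
      subst this
      simpa using map_mem_content (lv' := fun s : I ⊕ J => ({s} : Multiset (I ⊕ J)))
        (Sum.inr : J → I ⊕ J) Sum.inr (fun _ => rfl) hb
    · have : (none : Option I) ∈ ({some i} : Multiset (Option I)) := by rw [hk]; simp
      simp at this

/-- The suspended commutative operad `Det`: `Det(I)` is the top exterior power of `ℚI`, in
degree `|I| - 1`, with `(x ∧ ⋆) ∘_⋆ y = x ∧ y`. -/
def DetOperad : PreOperad where
  obj I _ _ := detSpace I
  gr I _ _ n := if n = (Fintype.card I : ℤ) - 1 then ⊤ else ⊥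
  par I _ _ := ((Fintype.card I : ℤ) - 1).negOnePow • LinearMap.id
  map {I J} _ _ _ _ e := (ExteriorAlgebra.map (Finsupp.lmapDomain ℚ ℚ e)).toLinearMap.restrict
    (p := detSpace I) (q := detSpace J) (fun a ha => by
      have := map_mem_content (lv' := fun j : J => ({j} : Multiset J)) e e (fun _ => rfl) ha
      rwa [univ_val_equiv] at this)
  one := ⟨wedge [()], Submodule.subset_span ⟨[()], rfl, rfl⟩⟩
  comp {I J} _ _ _ := restrictBilin (detComp I J) _ _ _ detComp_mem

/-! ### The operad `B` of root-oriented forests -/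

/-- Planar rooted binary trees with leaves labelled in `I`. -/
inductive PlanarTree (I : Type) : Type
  | leaf : I → PlanarTree I
  | node : PlanarTree I → PlanarTree I → PlanarTree I

namespace PlanarTree

/-- Exchange of the two branches at an inner vertex. -/
inductive Flip {I : Type} : PlanarTree I → PlanarTree I → Prop
  | swap (S T) : Flip (node S T) (node T S)
  | left {S S'} (T) : Flip S S' → Flip (node S T) (node S' T)
  | right (S) {T T'} : Flip T T' → Flip (node S T) (node S T')

def leaves {I : Type} : PlanarTree I → Multiset I
  | leaf i => {i}
  | node S T => S.leaves + T.leaves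

def relabel {I J : Type} (e : I → J) : PlanarTree I → PlanarTree J
  | leaf i => leaf (e i)
  | node S T => node (S.relabel e) (T.relabel e)

theorem leaves_flip {I : Type} {S T : PlanarTree I} (h : Flip S T) : S.leaves = T.leaves := by
  induction h with
  | swap S T => exact add_comm _ _
  | left T _ ih => simp [leaves, ih]
  | right S _ ih => simp [leaves, ih]

theorem leaves_relabel {I J : Type} (e : I → J) (T : PlanarTree I) :
    (T.relabel e).leaves = T.leaves.map e := by
  induction T with
  | leaf i => rfl
  | node S T hS hT => simp [leaves, relabel, hS, hT]

theorem relabel_flip {I J : Type} (e : I → J) {S T : PlanarTree I} (h : Flip S T) :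
    Flip (S.relabel e) (T.relabel e) := by
  induction h with
  | swap S T => exact Flip.swap _ _
  | left T _ ih => exact Flip.left _ ih
  | right S _ ih => exact Flip.right _ ih

end PlanarTree

/-- Rooted binary trees (not planar) with leaves labelled in `I`. -/
def BinTree (I : Type) : Type := Quot (PlanarTree.Flip (I := I))

namespace BinTree

def leaf {I : Type} (i : I) : BinTree I := Quot.mk _ (PlanarTree.leaf i)

/-- The grafting `S ∨ T`. -/
def vee {I : Type} : BinTree I → BinTree I → BinTree I :=
  Quot.map₂ PlanarTree.node (fun S _ _ h => PlanarTree.Flip.right S h)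
    (fun _ _ T h => PlanarTree.Flip.left T h)

theorem vee_comm {I : Type} (S T : BinTree I) : S.vee T = T.vee S := by
  induction S using Quot.ind
  induction T using Quot.ind
  exact Quot.sound (PlanarTree.Flip.swap _ _)

def leaves {I : Type} : BinTree I → Multiset I :=
  Quot.lift PlanarTree.leaves fun _ _ h => PlanarTree.leaves_flip h

theorem leaves_vee {I : Type} (S T : BinTree I) : (S.vee T).leaves = S.leaves + T.leaves := by
  induction S using Quot.ind
  induction T using Quot.ind
  rfl

def relabel {I J : Type} (e : I → J) : BinTree I → BinTree J :=
  Quot.map (PlanarTree.relabel e) fun _ _ h => PlanarTree.relabel_flip e h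

theorem leaves_relabel {I J : Type} (e : I → J) (T : BinTree I) :
    (T.relabel e).leaves = T.leaves.map e := by
  induction T using Quot.ind
  exact PlanarTree.leaves_relabel e _

/-- The bilinear extension of `S ∨ T`. -/
def graft (I : Type) : (BinTree I →₀ ℚ) →ₗ[ℚ] (BinTree I →₀ ℚ) →ₗ[ℚ] (BinTree I →₀ ℚ) :=
  Finsupp.linearCombination ℚ fun S =>
    Finsupp.linearCombination ℚ fun T => Finsupp.single (S.vee T) (1 : ℚ)

theorem graft_comm {I : Type} (s t : BinTree I →₀ ℚ) : graft I s t = graft I t s := by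
  have : graft I = (graft I).flip := by
    ext S T : 4
    simp [graft, vee_comm]
  exact congrArg (fun g => g s t) this

/-- A tree without leaf `⋆`, as a tree on the larger set `I ⊔ J`; zero if `⋆` is a leaf. -/
def keepPlanar (I J : Type) : PlanarTree (Option I) → (BinTree (I ⊕ J) →₀ ℚ)
  | .leaf none => 0
  | .leaf (some i) => Finsupp.single (leaf (.inl i)) 1
  | .node S T => graft _ (keepPlanar I J S) (keepPlanar I J T)

theorem keepPlanar_flip {I : Type} (J : Type) {S T : PlanarTree (Option I)}
    (h : PlanarTree.Flip S T) : keepPlanar I J S = keepPlanar I J T := by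
  induction h with
  | swap S T => exact graft_comm _ _
  | left T _ ih => simp [keepPlanar, ih]
  | right S _ ih => simp [keepPlanar, ih]

def keep (I J : Type) : BinTree (Option I) → (BinTree (I ⊕ J) →₀ ℚ) :=
  Quot.lift (keepPlanar I J) fun _ _ h => keepPlanar_flip J h

/-- The composition `T ∘_⋆ y` of a tree with a root-oriented forest `y = T₁ ∧ ⋯ ∧ Tₖ`, given by
`⋆ ∘_⋆ y = y` and by the distributive law
`(S ∨ T) ∘_⋆ y = ∑ₘ U₁ ∧ ⋯ ∧ (S ∨ Uₘ) ∧ ⋯ ∧ Uₖ` if `⋆` is a leaf of `T` and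
`T ∘_⋆ y = U₁ ∧ ⋯ ∧ Uₖ` (and the same with `S` and `T` exchanged); it is zero if `⋆` is not
a leaf. -/
def substPlanar (I J : Type) : PlanarTree (Option I) →
    (ExteriorAlgebra ℚ (BinTree J →₀ ℚ) →ₗ[ℚ] ExteriorAlgebra ℚ (BinTree (I ⊕ J) →₀ ℚ))
  | .leaf none => (ExteriorAlgebra.map (Finsupp.lmapDomain ℚ ℚ (relabel Sum.inr))).toLinearMap
  | .leaf (some _) => 0
  | .node S T => derivation (graft _ (keepPlanar I J S)) ∘ₗ substPlanar I J T +
      derivation (graft _ (keepPlanar I J T)) ∘ₗ substPlanar I J S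

theorem substPlanar_flip {I : Type} (J : Type) {S T : PlanarTree (Option I)}
    (h : PlanarTree.Flip S T) : substPlanar I J S = substPlanar I J T := by
  induction h with
  | swap S T => exact add_comm _ _
  | left T h ih => simp [substPlanar, ih, keepPlanar_flip J h]
  | right S h ih => simp [substPlanar, ih, keepPlanar_flip J h]

def subst (I J : Type) : BinTree (Option I) →
    (ExteriorAlgebra ℚ (BinTree J →₀ ℚ) →ₗ[ℚ] ExteriorAlgebra ℚ (BinTree (I ⊕ J) →₀ ℚ)) :=
  Quot.lift (substPlanar I J) fun _ _ h => substPlanar_flip J h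

theorem keepPlanar_star {I : Type} (J : Type) (T : PlanarTree (Option I)) (h : none ∈ T.leaves) :
    keepPlanar I J T = 0 := by
  induction T with
  | leaf o => rcases o with _ | i
              · rfl
              · simp [PlanarTree.leaves] at h
  | node S T hS hT =>
    rcases Multiset.mem_add.1 h with h | h
    · simp [keepPlanar, hS h]
    · simp [keepPlanar, hT h]

theorem keepPlanar_eq {I : Type} (J : Type) (T : PlanarTree (Option I)) (h : none ∉ T.leaves) :
    ∃ T' : BinTree (I ⊕ J), keepPlanar I J T = Finsupp.single T' 1 ∧
      ∀ k : Multiset I, T.leaves = k.map some → T'.leaves = k.map Sum.inl := by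
  have aux : ∃ T' : BinTree (I ⊕ J), keepPlanar I J T = Finsupp.single T' 1 ∧
      T'.leaves.map some = T.leaves.map (Option.map Sum.inl) := by
    induction T with
    | leaf o => rcases o with _ | i
                · simp [PlanarTree.leaves] at h
                · exact ⟨leaf (.inl i), rfl, rfl⟩
    | node S T hS hT =>
      simp only [PlanarTree.leaves, Multiset.mem_add, not_or] at h
      obtain ⟨S', hS1, hS2⟩ := hS h.1
      obtain ⟨T', hT1, hT2⟩ := hT h.2
      refine ⟨S'.vee T', by simp [keepPlanar, hS1, hT1, graft], ?_⟩
      simp [leaves_vee, PlanarTree.leaves, hS2, hT2]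
  obtain ⟨T', h1, h2⟩ := aux
  refine ⟨T', h1, fun k hk => ?_⟩
  apply Multiset.map_injective (Option.some_injective (I ⊕ J))
  rw [h2, hk, Multiset.map_map, Multiset.map_map]
  rfl

theorem substPlanar_no_star {I : Type} (J : Type) (T : PlanarTree (Option I))
    (h : none ∉ T.leaves) : substPlanar I J T = 0 := by
  induction T with
  | leaf o => rcases o with _ | i
              · simp [PlanarTree.leaves] at h
              · rfl
  | node S T hS hT =>
    simp only [PlanarTree.leaves, Multiset.mem_add, not_or] at h
    simp [substPlanar, hS h.1, hT h.2]

theorem graft_mem {I : Type} (S T : BinTree I) :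
    ExteriorAlgebra.ι ℚ (graft I (Finsupp.single S 1) (Finsupp.single T 1)) ∈
      content leaves (S.leaves + T.leaves) := by
  have := ι_mem_content leaves (S.vee T)
  rw [leaves_vee] at this
  simpa [graft] using this

theorem substPlanar_mem {I J : Type} {q : Multiset J} {y : ExteriorAlgebra ℚ (BinTree J →₀ ℚ)}
    (hy : y ∈ content leaves q) (T : PlanarTree (Option I)) :
    ∀ k : Multiset I, T.leaves = none ::ₘ k.map some →
      substPlanar I J T y ∈ content leaves (k.map Sum.inl + q.map Sum.inr) := by
  induction T with
  | leaf o =>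
    intro k hk
    rcases o with _ | i
    · have : k = 0 := by
        have hk' : ({none} : Multiset (Option I)) = {none} + k.map some := hk
        simpa using hk'
      subst this
      simpa [substPlanar] using map_mem_content (lv' := leaves) (relabel (Sum.inr : J → I ⊕ J))
        Sum.inr (leaves_relabel Sum.inr) hy
    · have : (none : Option I) ∈ (PlanarTree.leaf (some i)).leaves := by rw [hk]; simp
      simp [PlanarTree.leaves] at this
  | node S T hS hT =>
    have one : ∀ (S T : PlanarTree (Option I)),
        (∀ k : Multiset I, T.leaves = none ::ₘ k.map some →
          substPlanar I J T y ∈ content leaves (k.map Sum.inl + q.map Sum.inr)) →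
        none ∈ T.leaves → ∀ k : Multiset I, S.leaves + T.leaves = none ::ₘ k.map some →
        (derivation (graft _ (keepPlanar I J S)) (substPlanar I J T y) +
          derivation (graft _ (keepPlanar I J T)) (substPlanar I J S y)) ∈
            content leaves (k.map Sum.inl + q.map Sum.inr) := by
      intro S T hT hn k hk
      obtain ⟨s, hs⟩ := Multiset.exists_cons_of_mem hn
      rw [hs, Multiset.add_cons, Multiset.cons_inj_right] at hk
      have hn' : (none : Option I) ∉ S.leaves + s := by rw [hk]; simp
      rw [Multiset.mem_add, not_or] at hn'
      obtain ⟨k₁, h₁⟩ | ⟨k₁, h₁⟩ := star_cases S.leaves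
      swap
      · exact absurd (by rw [h₁]; simp) hn'.1
      obtain ⟨k₂, h₂⟩ | ⟨k₂, h₂⟩ := star_cases s
      swap
      · exact absurd (by rw [h₂]; simp) hn'.2
      have hkk : k = k₁ + k₂ := by
        apply Multiset.map_injective (Option.some_injective I)
        rw [← hk, h₁, h₂, Multiset.map_add]
      obtain ⟨S', hS1, hS2⟩ := keepPlanar_eq J S hn'.1
      rw [substPlanar_no_star J S hn'.1, LinearMap.zero_apply, map_zero, add_zero, hS1, hkk,
        Multiset.map_add, add_assoc]
      refine derivation_mem_content _ (fun x => ?_) (hT k₂ (by rw [hs, h₂]))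
      rw [← hS2 k₁ h₁]
      exact graft_mem S' x
    intro k hk
    have hn : (none : Option I) ∈ (PlanarTree.node S T).leaves := by rw [hk]; simp
    rcases Multiset.mem_add.1 hn with h | h
    · rw [substPlanar, add_comm (_ ∘ₗ _)]
      exact one T S hS h k (by rw [← hk]; exact add_comm _ _)
    · exact one S T hT h k hk

end BinTree

/-- The space of root-oriented forests on `I`: it is spanned by the `T₁ ∧ ⋯ ∧ Tₖ`, where
`T₁, …, Tₖ` are rooted binary trees whose leaves are labelled bijectively, all together, by `I`.
Such a product is the forest `{T₁, …, Tₖ}` with the orientation `T₁ ∧ ⋯ ∧ Tₖ` of its roots. -/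
def forestSpace (I : Type) [Fintype I] : Submodule ℚ (ExteriorAlgebra ℚ (BinTree I →₀ ℚ)) :=
  content BinTree.leaves (Finset.univ : Finset I).val

/-- The composition `(x ∧ T) ∘_⋆ y = x ∧ (T ∘_⋆ y)`, where `⋆` is a leaf of the tree `T`. -/
def forestComp (I J : Type) : ExteriorAlgebra ℚ (BinTree (Option I) →₀ ℚ) →ₗ[ℚ]
    ExteriorAlgebra ℚ (BinTree J →₀ ℚ) →ₗ[ℚ] ExteriorAlgebra ℚ (BinTree (I ⊕ J) →₀ ℚ) :=
  insertion (Finsupp.linearCombination ℚ (BinTree.keep I J))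
    (Finsupp.linearCombination ℚ (BinTree.subst I J))

theorem forestComp_mem {I J : Type} [Fintype I] [Fintype J] :
    ∀ a ∈ forestSpace (Option I), ∀ b ∈ forestSpace J, forestComp I J a b ∈ forestSpace (I ⊕ J) := by
  intro a ha b hb
  rw [forestSpace, univ_val_option] at ha
  rw [forestSpace, univ_val_sum]
  refine insertion_mem_content _ _ b _ ?_ ?_ ?_ ?_ ha
  · intro T k hk
    rw [Finsupp.linearCombination_single, one_smul]
    induction T using Quot.ind with | mk T => ?_
    obtain ⟨T', h1, h2⟩ := BinTree.keepPlanar_eq J T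
      (by intro h; rw [show T.leaves = k.map some from hk] at h; simp at h)
    rw [← h2 k hk]
    change ExteriorAlgebra.ι ℚ (BinTree.keepPlanar I J T) ∈ _
    rw [h1]
    exact ι_mem_content _ _
  · intro T h
    rw [Finsupp.linearCombination_single, one_smul]
    induction T using Quot.ind with | mk T => ?_
    exact BinTree.keepPlanar_star J T h
  · intro T h
    rw [Finsupp.linearCombination_single, one_smul]
    induction T using Quot.ind with | mk T => ?_
    exact BinTree.substPlanar_no_star J T h
  · intro T k hk
    rw [Finsupp.linearCombination_single, one_smul]
    induction T using Quot.ind with | mk T => ?_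
    exact BinTree.substPlanar_mem hb T k hk

/-- The operad `B` on `Det ∘ Gri` given by the distributive law
`ω_{i,⋆} ∘_⋆ e_{j,k} = e_{j,⋆} ∘_⋆ ω_{i,k} - e_{k,⋆} ∘_⋆ ω_{i,j}`, i.e.
`(i ∨ ⋆) ∘_⋆ (j ∧ k) = j ∧ (i ∨ k) + (i ∨ j) ∧ k`. A root-oriented forest has degree its number
of roots minus one. -/
def BOperad : PreOperad where
  obj I _ _ := forestSpace I
  gr I _ _ n := Submodule.span ℚ {x | ∃ L : List (BinTree I), (L.length : ℤ) = n + 1 ∧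
    (L.map BinTree.leaves).sum = (Finset.univ : Finset I).val ∧ x.1 = wedge L}
  par I _ _ := -(CliffordAlgebra.involute (Q := (0 : QuadraticForm ℚ (BinTree I →₀ ℚ)))
    ).toLinearMap.restrict (p := forestSpace I) (q := forestSpace I)
      (fun _ ha => involute_mem_content ha)
  map {I J} _ _ _ _ e :=
    (ExteriorAlgebra.map (Finsupp.lmapDomain ℚ ℚ (BinTree.relabel e))).toLinearMap.restrict
      (p := forestSpace I) (q := forestSpace J) (fun a ha => by
        have := map_mem_content (lv' := BinTree.leaves) (BinTree.relabel e) e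
          (BinTree.leaves_relabel e) ha
        rwa [univ_val_equiv] at this)
  one := ⟨wedge [BinTree.leaf ()], Submodule.subset_span ⟨[BinTree.leaf ()], rfl, rfl⟩⟩
  comp {I J} _ _ _ := restrictBilin (forestComp I J) _ _ _ forestComp_mem

/-! ### The Bessel operad -/

/-- The Bessel operad `Det ⊗ B`, with the degree (of the same parity) that counts the inner
vertices: a forest on `I` with `r` trees has degree `d = (|I| - 1) + (r - 1)` in `Det ⊗ B`,
and `|I| - r = 2|I| - 2 - d` inner vertices. -/
def Bess : PreOperad :=
  { DetOperad.tensor BOperad with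
    gr := fun I _ _ n => (DetOperad.tensor BOperad).gr I (2 * (Fintype.card I : ℤ) - 2 - n) }

namespace Bess

/-- The orientation `i ∧ j` of `{0, 1}`, for the enumeration `i, j` of `{0, 1}`. -/
def orient (i j : Fin 2) (h : ({i} + {j} : Multiset (Fin 2)) = (Finset.univ : Finset (Fin 2)).val) :
    DetOperad.obj (Fin 2) :=
  ⟨wedge [i, j], Submodule.subset_span ⟨[i, j], by simpa using h, rfl⟩⟩

/-- The generator `e = 0 ∧ 1` of `B`: two trees without inner vertices. -/
def e : BOperad.obj (Fin 2) :=
  ⟨wedge [BinTree.leaf 0, BinTree.leaf 1],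
    Submodule.subset_span ⟨[BinTree.leaf 0, BinTree.leaf 1], rfl, rfl⟩⟩

/-- The generator `ω` of `B`: the tree with one inner vertex. -/
def ω : BOperad.obj (Fin 2) :=
  ⟨wedge [(BinTree.leaf 0).vee (BinTree.leaf 1)],
    Submodule.subset_span ⟨[(BinTree.leaf 0).vee (BinTree.leaf 1)], rfl, rfl⟩⟩

/-- The generator `E_{0,1} = (1 ∧ 0) ⊗ e_{0,1}`. -/
def E : Bess.obj (Fin 2) := (orient 1 0 (by decide) ⊗ₜ[ℚ] e :)

/-- The generator `Ω_{0,1} = (0 ∧ 1) ⊗ ω_{0,1}`. -/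
def Ω : Bess.obj (Fin 2) := (orient 0 1 (by decide) ⊗ₜ[ℚ] ω :)

/-- `E_{i,j}` in `Bess({i, j})`, where `i`, `j` are the images of `0`, `1`. -/
def Egen {I : Type} [Fintype I] [Nonempty I] (ij : Fin 2 ≃ I) : Bess.obj I := Bess.map ij E

/-- `Ω_{i,j}` in `Bess({i, j})`, where `i`, `j` are the images of `0`, `1`. -/
def Ωgen {I : Type} [Fintype I] [Nonempty I] (ij : Fin 2 ≃ I) : Bess.obj I := Bess.map ij Ω

/-- `Δ(E_{i,j}) = E_{i,j} ⊗ E_{i,j}` and `Δ(Ω_{i,j}) = E_{i,j} ⊗ Ω_{i,j} + Ω_{i,j} ⊗ E_{i,j}`. -/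
def OnGenerators (Δ : PreOperad.Hom Bess (Bess.tensor Bess)) : Prop :=
  ∀ (I : Type) [Fintype I] [Nonempty I] (ij : Fin 2 ≃ I),
    Δ.coprod I (Egen ij) = Egen ij ⊗ₜ[ℚ] Egen ij ∧
    Δ.coprod I (Ωgen ij) = Egen ij ⊗ₜ[ℚ] Ωgen ij + Ωgen ij ⊗ₜ[ℚ] Egen ij

end Bess

end

/-! Operad axioms. Up to sign, a forest with a marked leaf `⋆` is `x ∧ T` with `⋆` in the tree `T`,
and `T` is obtained from the leaf `⋆` by grafting trees `S` without `⋆`. On such forests the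
composition is given by two rules: `x` stays outside, and `(S ∨ T) ∘ y = D_S (T ∘ y)`. Since `D_S`
passes through compositions at leaves that are not in `S` (`forestComp_graftDer`), the axioms are
inductions along the path from `⋆` to the root. The case with content is the exchange of two marked
leaves. If they lie in different trees, it is supercommutativity of the exterior algebra. If their
paths meet at a vertex, both orders give a value of one odd biderivation `bracket` that extends `∨`,
and the axiom is the graded symmetry of this bracket (`BinTree.TwoStar.subst_comm`). `Det` embeds in
`B` as the forests without inner vertices and inherits its axioms; tensor products and the regrading
are formal.

Uniqueness. `B` is generated by `e` and `ω`, the compositions of `Det` are surjective and `Det(I)`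
is a line, so `Bess` is generated by `E` and `Ω`. Hence two morphisms out of `Bess` that agree on
`E` and `Ω` are equal (`Bess.superHom_ext`). Coassociativity, cocommutativity, the counit axioms and
the compatibility with degrees are all equalities of morphisms, checked on the two generators.

Existence. After a reordering of factors, a coproduct that keeps the first factor `Det` is a
coaction `B → B ⊗ Det ⊗ B`. The exterior algebra of trees ⊕ labels ⊕ trees is the tensor product of
three exterior algebras. A leaf goes to the product of its three copies, `S ∨ T` goes to the bracket
of the images of `S` and `T`, and products go to products. The only relation between planar trees is
the commutativity of `∨`, and the bracket is symmetric on odd elements, so this is well defined. The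
derivation `D_S` becomes the bracket with the image of `S`, which is again an even derivation, so
the induction along `T` shows that compositions are respected (`comp_eval_triple`).

The target is larger than `Bess ⊗ Bess`, but the two generators land in the image of `Bess ⊗ Bess`,
and therefore everything does. Degrees are recovered from operators that act by `2 ^ n` in degree
`n`. The counit comes from discarding all trees with an inner vertex: this sends `Bess` into a copy
of `Com` inside a tensor square of exterior algebras of labels. -/

open scoped TensorProduct

noncomputable section

/-! ### Exterior algebras -/

namespace ExteriorAlgebra

variable {M N V M' N' V' : Type} [AddCommGroup M] [Module ℚ M] [AddCommGroup N] [Module ℚ N]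
  [AddCommGroup M'] [Module ℚ M'] [AddCommGroup N'] [Module ℚ N'] [AddCommGroup V']
  [Module ℚ V'] [AddCommGroup V] [Module ℚ V]

/-- The grading involution `x₁ ∧ ⋯ ∧ xₖ ↦ (-1)^k x₁ ∧ ⋯ ∧ xₖ`. -/
def inv (M : Type) [AddCommGroup M] [Module ℚ M] : ExteriorAlgebra ℚ M →ₐ[ℚ] ExteriorAlgebra ℚ M :=
  CliffordAlgebra.involute

@[simp] theorem inv_ι (x : M) : inv M (ι ℚ x) = -ι ℚ x := CliffordAlgebra.involute_ι x

@[simp] theorem inv_inv (a : ExteriorAlgebra ℚ M) : inv M (inv M a) = a :=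
  CliffordAlgebra.involute_involute a

/-- The identities of this part are linear, so only the unit and a left multiplication by one vector
have to be treated. -/
theorem ι_mul_induction {C : ExteriorAlgebra ℚ M → Prop} (one : C 1)
    (smul : ∀ (c : ℚ) a, C a → C (c • a)) (add : ∀ a b, C a → C b → C (a + b))
    (mul : ∀ x a, C a → C (ι ℚ x * a)) (a : ExteriorAlgebra ℚ M) : C a := by
  induction a using CliffordAlgebra.left_induction with
  | algebraMap r => rw [Algebra.algebraMap_eq_smul_one]; exact smul _ _ one
  | add a b ha hb => exact add _ _ ha hb
  | ι_mul a x ha => exact mul _ _ ha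

theorem map_inv (f : M →ₗ[ℚ] N) (a : ExteriorAlgebra ℚ M) :
    map f (inv M a) = inv N (map f a) := by
  induction a using ι_mul_induction with
  | one => simp
  | smul c a h => simp [h]
  | add a b ha hb => simp [ha, hb]
  | mul x a h => simp [h]

theorem ι_mul_eq (x : M) (a : ExteriorAlgebra ℚ M) : ι ℚ x * a = inv M a * ι ℚ x := by
  induction a using ι_mul_induction with
  | one => simp
  | smul c a h => simp [h]
  | add a b ha hb => simp [mul_add, add_mul, ha, hb]
  | mul y a h =>
    have := ι_add_mul_swap (R := ℚ) x y
    rw [← mul_assoc, eq_neg_of_add_eq_zero_left this, neg_mul, mul_assoc, h]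
    simp [mul_assoc]

theorem ι_mul_ι (x y : M) : ι ℚ x * ι ℚ y = -(ι ℚ y * ι ℚ x) :=
  eq_neg_of_add_eq_zero_left (ι_add_mul_swap x y)

/-- Supercommutativity, written with the involution. -/
theorem two_mul_eq (a b : ExteriorAlgebra ℚ M) :
    (2 : ℚ) • (a * b) = b * a + b * inv M a + inv M b * a - inv M b * inv M a := by
  induction a using ι_mul_induction generalizing b with
  | one => simp [two_smul]
  | smul c a h => simp only [smul_mul_assoc, smul_comm (2 : ℚ) c, h]; simp [smul_add, smul_sub]
  | add a a' ha hb => simp only [add_mul, smul_add, ha, hb, map_add, mul_add]; abel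
  | mul x a h =>
    -- The vector `x` is carried to the right end; the induction hypothesis then applies to `a * b`
    -- in front of it.
    have e : ι ℚ x * a * b = inv M (a * b) * ι ℚ x := by rw [mul_assoc, ι_mul_eq]
    have h' := congrArg (fun t => inv M t * ι ℚ x) (h b)
    simp only [map_smul, map_add, map_sub, map_mul, inv_inv, smul_mul_assoc, add_mul, sub_mul] at h'
    rw [e, map_mul, h', map_mul, inv_ι, ι_mul_eq x a]
    simp only [← mul_assoc, neg_mul, mul_neg]
    have e1 : ∀ c d : ExteriorAlgebra ℚ M, c * ι ℚ x * d = c * inv M d * ι ℚ x := by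
      intro c d; rw [mul_assoc, ι_mul_eq, mul_assoc]
    rw [e1, e1, inv_inv]
    abel

/-- In `two_mul_eq` the four terms add up to `(1 + (-1)^p + (-1)^q - (-1)^(p+q)) ba`, and this
coefficient is `2 (-1)^(pq)`. -/
theorem mul_comm_of_parity {a b : ExteriorAlgebra ℚ M} {p q : ℤ}
    (ha : inv M a = p.negOnePow • a) (hb : inv M b = q.negOnePow • b) :
    a * b = (p * q).negOnePow • (b * a) := by
  have h := two_mul_eq a b
  rw [ha, hb] at h
  apply smul_right_injective _ (two_ne_zero (α := ℚ))
  simp only [h]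
  rcases Int.even_or_odd p with hp | hp <;> rcases Int.even_or_odd q with hq | hq
  · rw [Int.negOnePow_even _ hp, Int.negOnePow_even _ hq, Int.negOnePow_even _ (hp.mul_right q)]
    simp only [one_smul, two_smul]; abel
  · rw [Int.negOnePow_even _ hp, Int.negOnePow_odd _ hq, Int.negOnePow_even _ (hp.mul_right q)]
    simp [two_smul]
  · rw [Int.negOnePow_odd _ hp, Int.negOnePow_even _ hq, Int.negOnePow_even _ (hq.mul_left p)]
    simp [two_smul]
  · rw [Int.negOnePow_odd _ hp, Int.negOnePow_odd _ hq, Int.negOnePow_odd _ (hp.mul hq)]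
    simp only [Units.neg_smul, one_smul, mul_neg, neg_mul, smul_neg, two_smul]; abel

/-- An odd element anticommutes with itself, and `2` is invertible. This is the condition under
which odd images of trees extend to an algebra map on forests. -/
theorem mul_self_of_odd {a : ExteriorAlgebra ℚ M} (ha : inv M a = -a) : a * a = 0 := by
  have h := mul_comm_of_parity (p := 1) (q := 1) (a := a) (b := a) (by simpa using ha)
    (by simpa using ha)
  have h' : (2 : ℚ) • (a * a) = 0 := by
    rw [two_smul]
    nth_rewrite 1 [h]
    simp
  exact (smul_eq_zero.1 h').resolve_left two_ne_zero

/-! ### Derivations and insertions -/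

section Insertion

variable (r : M →ₗ[ℚ] N) (f : M →ₗ[ℚ] V →ₗ[ℚ] ExteriorAlgebra ℚ N)

@[simp] theorem insertion_one : insertion r f 1 = 0 := by simp [insertion]

/-- The first component of the fold is auxiliary; once it is identified, the fold becomes the
recursion `insertion_ι_mul`, through which insertions are handled from there on. -/
theorem foldr_insStep_fst (a : ExteriorAlgebra ℚ M) :
    (CliffordAlgebra.foldr 0 (insStep r f) (insStep_sq r f) (1, 0) a).1 = map r a := by
  induction a using ι_mul_induction with
  | one => simp
  | smul c a h => simp [h]
  | add a b ha hb => simp [ha, hb]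
  | mul x a h => simp [insStep_apply, h]

theorem insertion_ι_mul (x : M) (a : ExteriorAlgebra ℚ M) (v : V) :
    insertion r f (ι ℚ x * a) v =
      ι ℚ (r x) * insertion r f a v + inv N (map r a) * f x v := by
  rw [← foldr_insStep_fst r f]
  simp [insertion, insStep_apply, inv]

theorem insertion_ι (x : M) (v : V) : insertion r f (ι ℚ x) v = f x v := by
  have := insertion_ι_mul r f x 1 v
  simpa using this

/-- An insertion is right-linear over the factors that it does not change. -/
theorem insertion_map_mul (j : M' →ₗ[ℚ] M) (v : V) (hj : ∀ x, f (j x) v = 0)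
    (a : ExteriorAlgebra ℚ M') (b : ExteriorAlgebra ℚ M) :
    insertion r f (map j a * b) v = map (r ∘ₗ j) a * insertion r f b v := by
  induction a using ι_mul_induction with
  | one => simp
  | smul c a h => simp [h]
  | add a b ha hb => simp [add_mul, ha, hb]
  | mul x a h => simp [mul_assoc, insertion_ι_mul, h, hj]

/-- Naturality of insertions. It reduces to a check on vectors the compatibility of compositions
with relabelling, with the embedding of `Det` in `B` and with the projection of trees to labels. -/
theorem map_insertion (r' : M' →ₗ[ℚ] N') (f' : M' →ₗ[ℚ] V' →ₗ[ℚ] ExteriorAlgebra ℚ N')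
    (g : M →ₗ[ℚ] M') (h : N →ₗ[ℚ] N') (v : V) (v' : V') (hr : ∀ x, h (r x) = r' (g x))
    (hf : ∀ x, map h (f x v) = f' (g x) v') (a : ExteriorAlgebra ℚ M) :
    map h (insertion r f a v) = insertion r' f' (map g a) v' := by
  have e : h ∘ₗ r = r' ∘ₗ g := LinearMap.ext hr
  induction a using ι_mul_induction with
  | one => simp
  | smul c a h => simp [h]
  | add a b ha hb => simp [ha, hb]
  | mul x a ih =>
    have e' : map h (map r a) = map r' (map g a) := by
      rw [← AlgHom.comp_apply, map_comp_map, e, ← map_comp_map, AlgHom.comp_apply]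
    simp [insertion_ι_mul, ih, hf, hr, map_inv, e']

/-- One factor is removed, which gives the minus sign; `t` accounts for the parity of what replaces
it. -/
theorem inv_insertion (t : V →ₗ[ℚ] V) (hf : ∀ x v, inv N (f x v) = f x (t v))
    (a : ExteriorAlgebra ℚ M) (v : V) :
    inv N (insertion r f a v) = -insertion r f (inv M a) (t v) := by
  induction a using ι_mul_induction with
  | one => simp
  | smul c a h => simp [h]
  | add a b ha hb => simp [ha, hb]; abel
  | mul x a ih => simp [insertion_ι_mul, ih, hf, map_inv]

end Insertion

section Derivation

variable (d d' : M →ₗ[ℚ] M)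

@[simp] theorem derivation_one : derivation d (1 : ExteriorAlgebra ℚ M) = 0 := by simp [derivation]

theorem foldr_derStep_fst (a : ExteriorAlgebra ℚ M) :
    (CliffordAlgebra.foldr 0 (derStep d) (derStep_sq d) (1, 0) a).1 = a := by
  induction a using ι_mul_induction with
  | one => simp
  | smul c a h => simp [h]
  | add a b ha hb => simp [ha, hb]
  | mul x a h => simp [derStep_apply, h]

theorem derivation_ι_mul (x : M) (a : ExteriorAlgebra ℚ M) :
    derivation d (ι ℚ x * a) = ι ℚ (d x) * a + ι ℚ x * derivation d a := by
  conv_rhs => enter [1, 2]; rw [← foldr_derStep_fst d a]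
  simp [derivation, derStep_apply]

@[simp] theorem derivation_ι (x : M) : derivation d (ι ℚ x) = ι ℚ (d x) := by
  have := derivation_ι_mul d x 1
  simpa using this

theorem derivation_mul (a b : ExteriorAlgebra ℚ M) :
    derivation d (a * b) = derivation d a * b + a * derivation d b := by
  induction a using ι_mul_induction with
  | one => simp
  | smul c a h => simp [h]
  | add a b ha hb => simp [add_mul, ha, hb]; abel
  | mul x a h => simp [mul_assoc, derivation_ι_mul, h, add_mul, mul_add, add_assoc]

theorem derivation_inv (a : ExteriorAlgebra ℚ M) :
    derivation d (inv M a) = inv M (derivation d a) := by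
  induction a using ι_mul_induction with
  | one => simp
  | smul c a h => simp [h]
  | add a b ha hb => simp [ha, hb]
  | mul x a h => simp [derivation_ι_mul, h]; abel

theorem derivation_add_apply (a : ExteriorAlgebra ℚ M) :
    derivation (d + d') a = derivation d a + derivation d' a := by
  induction a using ι_mul_induction with
  | one => simp
  | smul c a h => simp [h]
  | add a b ha hb => simp [ha, hb]; abel
  | mul x a h => simp [derivation_ι_mul, h, add_mul, mul_add]; abel

theorem derivation_smul_apply (c : ℚ) (a : ExteriorAlgebra ℚ M) :
    derivation (c • d) a = c • derivation d a := by
  induction a using ι_mul_induction with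
  | one => simp
  | smul c' a h => simp [h, smul_comm c c']
  | add a b ha hb => simp [ha, hb]
  | mul x a h => simp [derivation_ι_mul, h]

/-- The derivation that extends `d`, as a linear function of `d`. -/
def derivationₗ : (M →ₗ[ℚ] M) →ₗ[ℚ] (ExteriorAlgebra ℚ M →ₗ[ℚ] ExteriorAlgebra ℚ M) where
  toFun := derivation
  map_add' d d' := LinearMap.ext (derivation_add_apply d d')
  map_smul' c d := LinearMap.ext (derivation_smul_apply d c)

@[simp] theorem derivationₗ_apply : derivationₗ d = derivation d := rfl

theorem derivation_zero : derivation (0 : M →ₗ[ℚ] M) = 0 := derivationₗ.map_zero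

theorem map_derivation {d : M →ₗ[ℚ] M} {d' : N →ₗ[ℚ] N} (h : M →ₗ[ℚ] N)
    (hd : ∀ x, h (d x) = d' (h x)) (a : ExteriorAlgebra ℚ M) :
    map h (derivation d a) = derivation d' (map h a) := by
  induction a using ι_mul_induction with
  | one => simp
  | smul c a h => simp [h]
  | add a b ha hb => simp [ha, hb]
  | mul x a ih => simp [derivation_ι_mul, ih, hd]

/-- An even derivation commutes with the sign in the recursion of `insertion`. With `d` and `d'`
grafting the same tree, this becomes the rule that `D_S` passes through a composition. -/
theorem insertion_derivation (r : M →ₗ[ℚ] N) (f : M →ₗ[ℚ] V →ₗ[ℚ] ExteriorAlgebra ℚ N)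
    {d : M →ₗ[ℚ] M} {d' : N →ₗ[ℚ] N} (v : V) (hr : ∀ x, r (d x) = d' (r x))
    (hf : ∀ x, f (d x) v = derivation d' (f x v)) (a : ExteriorAlgebra ℚ M) :
    insertion r f (derivation d a) v = derivation d' (insertion r f a v) := by
  induction a using ι_mul_induction with
  | one => simp
  | smul c a h => simp [h]
  | add a b ha hb => simp [ha, hb]
  | mul x a ih =>
    rw [derivation_ι_mul]
    simp only [map_add, LinearMap.add_apply, insertion_ι_mul, ih, hr, hf,
      derivation_mul, derivation_ι, map_derivation r hr, derivation_inv]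
    abel

end Derivation

/-! ### The bracket of an exterior algebra -/

section Bracket

variable (g : M →ₗ[ℚ] M →ₗ[ℚ] M)

/-- The odd biderivation of the exterior algebra that extends a symmetric bilinear product `g`. -/
def bracket : ExteriorAlgebra ℚ M →ₗ[ℚ] ExteriorAlgebra ℚ M →ₗ[ℚ] ExteriorAlgebra ℚ M :=
  insertion LinearMap.id (derivationₗ ∘ₗ g)

@[simp] theorem bracket_one : bracket g 1 = 0 := insertion_one _ _

theorem bracket_ι_mul (x : M) (a b : ExteriorAlgebra ℚ M) :
    bracket g (ι ℚ x * a) b = ι ℚ x * bracket g a b + inv M a * derivation (g x) b := by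
  simp [bracket, insertion_ι_mul, map_id]

theorem bracket_ι (x : M) (b : ExteriorAlgebra ℚ M) : bracket g (ι ℚ x) b = derivation (g x) b := by
  simp [bracket, insertion_ι]

theorem bracket_apply_one (a : ExteriorAlgebra ℚ M) : bracket g a 1 = 0 := by
  induction a using ι_mul_induction with
  | one => simp
  | smul c a h => simp [h]
  | add a b ha hb => simp [ha, hb]
  | mul x a ih => simp [bracket_ι_mul, ih]

/-- The Leibniz rule in the second variable: `bracket g a` is a derivation whose parity is opposite
to that of `a`, hence the sign and `inv M a`. -/
theorem bracket_apply_ι_mul (a : ExteriorAlgebra ℚ M) (w : M) (c : ExteriorAlgebra ℚ M) :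
    bracket g a (ι ℚ w * c) = bracket g a (ι ℚ w) * c - ι ℚ w * bracket g (inv M a) c := by
  induction a using ι_mul_induction with
  | one => simp
  | smul c a h => simp [h, smul_sub]
  | add a b ha hb => simp [ha, hb, add_mul, mul_add]; abel
  | mul x a ih =>
    have e1 : inv M a * ι ℚ w = ι ℚ w * a := (ι_mul_eq w a).symm
    simp only [bracket_ι_mul, ih, derivation_ι_mul, derivation_ι, map_mul, inv_ι, neg_mul, map_neg,
      LinearMap.neg_apply, mul_neg, mul_add, add_mul, mul_sub, inv_inv, ← mul_assoc, e1,
      ι_mul_ι x w]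
    abel

theorem bracket_apply_ι (hg : ∀ x y, g x y = g y x) (a : ExteriorAlgebra ℚ M) (w : M) :
    bracket g a (ι ℚ w) = derivation (g w) a := by
  induction a using ι_mul_induction with
  | one => simp
  | smul c a h => simp [h]
  | add a b ha hb => simp [ha, hb]
  | mul x a ih =>
    rw [bracket_ι_mul, ih, derivation_ι_mul, derivation_ι, ι_mul_eq (g w x), hg x w, add_comm]

/-- The bracket with an odd element is an even derivation. -/
theorem bracket_mul_of_odd {a : ExteriorAlgebra ℚ M} (ha : inv M a = -a)
    (b c : ExteriorAlgebra ℚ M) : bracket g a (b * c) = bracket g a b * c + b * bracket g a c := by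
  induction b using ι_mul_induction with
  | one => simp [bracket_apply_one]
  | smul c a h => simp [h]
  | add a b ha hb => simp [ha, hb, add_mul]; abel
  | mul x b ih =>
    rw [mul_assoc, bracket_apply_ι_mul, bracket_apply_ι_mul, ha]
    simp only [map_neg, LinearMap.neg_apply, ih, mul_add, add_mul, mul_neg, sub_neg_eq_add,
      mul_assoc]
    abel

theorem inv_bracket (a b : ExteriorAlgebra ℚ M) :
    inv M (bracket g a b) = -bracket g (inv M a) (inv M b) :=
  inv_insertion _ _ (inv M).toLinearMap (fun x v => by simp [derivation_inv]) a b

theorem map_bracket (g' : N →ₗ[ℚ] N →ₗ[ℚ] N) (h : M →ₗ[ℚ] N)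
    (hg : ∀ x y, h (g x y) = g' (h x) (h y)) (a b : ExteriorAlgebra ℚ M) :
    map h (bracket g a b) = bracket g' (map h a) (map h b) :=
  map_insertion _ _ _ _ h h b (map h b) (fun _ => rfl)
    (fun x => map_derivation h (fun y => hg x y) b) a

/-- Graded symmetry of the bracket, written with the involution. -/
theorem two_bracket_eq (hg : ∀ x y, g x y = g y x) (a b : ExteriorAlgebra ℚ M) :
    (2 : ℚ) • bracket g a b = bracket g b a - bracket g b (inv M a) - bracket g (inv M b) a
      - bracket g (inv M b) (inv M a) := by
  induction b using ι_mul_induction generalizing a with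
  | one => simp [bracket_apply_one]
  | smul c b h => simp only [map_smul, smul_comm (2 : ℚ) c, h]; simp [smul_sub]
  | add b b' hb hb' =>
    simp only [map_add, smul_add, hb, hb', LinearMap.add_apply]; abel
  | mul x b ih =>
    -- The Leibniz rule splits off `x` from the second variable: one term is a product, exchanged by
    -- supercommutativity, and the other is covered by the induction hypothesis at `inv M a`.
    have h1 := two_mul_eq (derivation (g x) a) b
    have h2 := congrArg (fun t => ι ℚ x * t) (ih (inv M a))
    simp only [mul_smul_comm, mul_sub, inv_inv] at h2
    rw [bracket_apply_ι_mul, bracket_apply_ι g hg, smul_sub, h1, h2]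
    simp only [map_mul, inv_ι, neg_mul, map_neg, LinearMap.neg_apply, bracket_ι_mul, inv_inv,
      derivation_inv]
    abel

/-- The exponents are shifted by one because a forest of degree `p` in `B` has `p + 1` trees. The
bracket loses one factor, so it is even for the shifted degrees and its symmetry has the sign
`(-1)^(pq)`. -/
theorem bracket_comm_of_parity (hg : ∀ x y, g x y = g y x) {a b : ExteriorAlgebra ℚ M} {p q : ℤ}
    (ha : inv M a = (p + 1).negOnePow • a) (hb : inv M b = (q + 1).negOnePow • b) :
    bracket g a b = (p * q).negOnePow • bracket g b a := by
  have h := two_bracket_eq g hg a b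
  rw [ha, hb] at h
  apply smul_right_injective _ (two_ne_zero (α := ℚ))
  simp only [h, Int.negOnePow_succ]
  rcases Int.even_or_odd p with hp | hp <;> rcases Int.even_or_odd q with hq | hq
  · rw [Int.negOnePow_even _ hp, Int.negOnePow_even _ hq, Int.negOnePow_even _ (hp.mul_right q)]
    simp [two_smul]
  · rw [Int.negOnePow_even _ hp, Int.negOnePow_odd _ hq, Int.negOnePow_even _ (hp.mul_right q)]
    simp [two_smul]
  · rw [Int.negOnePow_odd _ hp, Int.negOnePow_even _ hq, Int.negOnePow_even _ (hq.mul_left p)]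
    simp [two_smul]
  · rw [Int.negOnePow_odd _ hp, Int.negOnePow_odd _ hq, Int.negOnePow_odd _ (hp.mul hq)]
    simp [two_smul]; abel

theorem bracket_comm_of_odd (hg : ∀ x y, g x y = g y x) {a b : ExteriorAlgebra ℚ M}
    (ha : inv M a = -a) (hb : inv M b = -b) : bracket g a b = bracket g b a := by
  have := bracket_comm_of_parity g hg (p := 0) (q := 0) (a := a) (b := b) (by simpa using ha)
    (by simpa using hb)
  simpa using this

end Bracket

end ExteriorAlgebra

/-! ### Trees and the composition of forests -/

open ExteriorAlgebra (inv derivation_ι_mul derivation_inv map_derivation bracket)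

/-- The inclusion of trees in the exterior algebra. -/
def tree {I : Type} (T : BinTree I) : ExteriorAlgebra ℚ (BinTree I →₀ ℚ) :=
  ExteriorAlgebra.ι ℚ (Finsupp.single T 1)

/-- The derivation `D_S` that grafts `S` on every tree in turn. -/
def graftDer {I : Type} (S : BinTree I) :
    ExteriorAlgebra ℚ (BinTree I →₀ ℚ) →ₗ[ℚ] ExteriorAlgebra ℚ (BinTree I →₀ ℚ) :=
  derivation (BinTree.graft I (Finsupp.single S 1))

/-- The relabelling of forests along a map of label sets. -/
def forestMap {I J : Type} (f : I → J) :
    ExteriorAlgebra ℚ (BinTree I →₀ ℚ) →ₐ[ℚ] ExteriorAlgebra ℚ (BinTree J →₀ ℚ) :=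
  ExteriorAlgebra.map (Finsupp.lmapDomain ℚ ℚ (BinTree.relabel f))

/-! ### Trees with one or two marked leaves, and substitution in them -/

namespace BinTree

variable {I J K I' J' : Type}

@[elab_as_elim]
theorem induction {C : BinTree I → Prop} (leaf : ∀ i, C (leaf i))
    (vee : ∀ S T, C S → C T → C (vee S T)) (T : BinTree I) : C T := by
  induction T using Quot.ind with | mk T => ?_
  induction T with
  | leaf i => exact leaf i
  | node S T hS hT => exact vee _ _ hS hT

@[simp] theorem relabel_leaf (f : I → J) (i : I) : relabel f (leaf i) = leaf (f i) := rfl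

@[simp] theorem relabel_vee (f : I → J) (S T : BinTree I) :
    relabel f (S.vee T) = (relabel f S).vee (relabel f T) := by
  induction S using Quot.ind
  induction T using Quot.ind
  rfl

@[simp] theorem leaves_leaf (i : I) : (leaf i).leaves = {i} := rfl

theorem relabel_relabel (f : I → J) (g : J → K) (T : BinTree I) :
    relabel g (relabel f T) = relabel (g ∘ f) T := by
  induction T using induction with
  | leaf i => rfl
  | vee S T hS hT => simp [hS, hT]

theorem relabel_id (T : BinTree I) : relabel id T = T := by
  induction T using induction with
  | leaf i => rfl
  | vee S T hS hT => simp [hS, hT]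

@[simp] theorem graft_single (S T : BinTree I) :
    graft I (Finsupp.single S 1) (Finsupp.single T 1) = Finsupp.single (S.vee T) 1 := by
  simp [graft]

theorem mapDomain_graft (f : I → J) (s t : BinTree I →₀ ℚ) :
    Finsupp.lmapDomain ℚ ℚ (relabel f) (graft I s t) =
      graft J (Finsupp.lmapDomain ℚ ℚ (relabel f) s) (Finsupp.lmapDomain ℚ ℚ (relabel f) t) := by
  have : (graft I).compr₂ (Finsupp.lmapDomain ℚ ℚ (relabel f)) =
      (graft J).compl₁₂ (Finsupp.lmapDomain ℚ ℚ (relabel f))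
        (Finsupp.lmapDomain ℚ ℚ (relabel f)) := by
    ext S T : 4
    simp
  exact congrArg (fun g => g s t) this

@[simp] theorem keep_vee (S T : BinTree (Option I)) :
    keep I J (S.vee T) = graft _ (keep I J S) (keep I J T) := by
  induction S using Quot.ind
  induction T using Quot.ind
  rfl

@[simp] theorem keep_leaf_some (i : I) :
    keep I J (leaf (some i)) = Finsupp.single (leaf (.inl i)) 1 := rfl

@[simp] theorem keep_leaf_none : keep I J (leaf none) = 0 := rfl

theorem subst_vee (S T : BinTree (Option I)) :
    subst I J (S.vee T) = derivation (graft _ (keep I J S)) ∘ₗ subst I J T +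
      derivation (graft _ (keep I J T)) ∘ₗ subst I J S := by
  induction S using Quot.ind
  induction T using Quot.ind
  rfl

theorem subst_leaf_none : subst I J (leaf none) = (forestMap Sum.inr).toLinearMap := rfl

@[simp] theorem subst_leaf_some (i : I) : subst I J (leaf (some i)) = 0 := rfl

@[simp] theorem keep_relabel_some (S : BinTree I) :
    keep I J (relabel some S) = Finsupp.single (relabel Sum.inl S) 1 := by
  induction S using induction with
  | leaf i => rfl
  | vee S T hS hT => simp [hS, hT]

@[simp] theorem subst_relabel_some (S : BinTree I) : subst I J (relabel some S) = 0 := by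
  induction S using induction with
  | leaf i => rfl
  | vee S T hS hT => simp [subst_vee, hS, hT]

/-- One of the two summands of `subst_vee` vanishes when `⋆` is not in `S`; what remains is the
distributive law in the form in which it is used below. -/
theorem subst_vee_some (S : BinTree I) (T : BinTree (Option I))
    (y : ExteriorAlgebra ℚ (BinTree J →₀ ℚ)) :
    subst I J ((relabel some S).vee T) y = graftDer (relabel Sum.inl S) (subst I J T y) := by
  simp [subst_vee, graftDer]

theorem exists_relabel_eq (f : I → J) (T : BinTree J) (h : ∀ j ∈ T.leaves, ∃ i, f i = j) :
    ∃ S, relabel f S = T := by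
  induction T using induction with
  | leaf j =>
    obtain ⟨i, rfl⟩ := h j (by simp)
    exact ⟨leaf i, rfl⟩
  | vee S T hS hT =>
    obtain ⟨S', rfl⟩ := hS fun j hj => h j (by simp [leaves_vee, hj])
    obtain ⟨T', rfl⟩ := hT fun j hj => h j (by simp [leaves_vee, hj])
    exact ⟨S'.vee T', by simp⟩

theorem leaf_injective : Function.Injective (leaf : I → BinTree I) := by
  intro i j h
  simpa using congrArg leaves h

theorem keep_relabel (e : I → I') (f : J → J') (T : BinTree (Option I)) :
    keep I' J' (relabel (Option.map e) T) =
      Finsupp.lmapDomain ℚ ℚ (relabel (Sum.map e f)) (keep I J T) := by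
  induction T using induction with
  | leaf o => rcases o with _ | i <;> simp
  | vee S T hS hT => rw [relabel_vee, keep_vee, hS, hT, keep_vee, mapDomain_graft]

theorem subst_relabel (e : I → I') (f : J → J') (T : BinTree (Option I))
    (y : ExteriorAlgebra ℚ (BinTree J →₀ ℚ)) :
    subst I' J' (relabel (Option.map e) T) (forestMap f y) =
      forestMap (Sum.map e f) (subst I J T y) := by
  induction T using induction with
  | leaf o =>
    rcases o with _ | i
    · simp only [relabel_leaf, Option.map_none, subst_leaf_none, AlgHom.toLinearMap_apply]
      simp only [forestMap, ← AlgHom.comp_apply, ExteriorAlgebra.map_comp_map,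
        ← Finsupp.lmapDomain_comp]
      congr 3
      funext T
      simp only [Function.comp_apply, relabel_relabel]
      rfl
    · simp
  | vee S T hS hT =>
    have key : ∀ S T : BinTree (Option I),
        forestMap (Sum.map e f) (derivation (graft _ (keep I J S)) (subst I J T y)) =
        derivation (graft _ (keep I' J' (relabel (Option.map e) S)))
          (forestMap (Sum.map e f) (subst I J T y)) := by
      intro S T
      rw [keep_relabel e f]
      exact map_derivation _ (fun x => mapDomain_graft _ _ _) _
    simp only [relabel_vee, subst_vee, LinearMap.add_apply, LinearMap.comp_apply, hS, hT, map_add,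
      key]

/-- The trees with exactly one leaf `⋆`, the other leaves forming the multiset `k`. -/
inductive OneStar : BinTree (Option I) → Multiset I → Prop
  | star : OneStar (leaf none) 0
  | vee (S : BinTree I) {T : BinTree (Option I)} {k : Multiset I} :
      OneStar T k → OneStar ((relabel some S).vee T) (S.leaves + k)

theorem exists_relabel_some {T : BinTree (Option I)} (h : none ∉ T.leaves) :
    ∃ S, relabel some S = T := by
  refine exists_relabel_eq some T fun j hj => ?_
  rcases j with _ | i
  · exact absurd hj h
  · exact ⟨i, rfl⟩

theorem map_some_add {p s : Multiset (Option I)} {k : Multiset I} (h : p + s = k.map some) :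
    ∃ k₁ k₂ : Multiset I, p = k₁.map some ∧ s = k₂.map some ∧ k = k₁ + k₂ := by
  have hn : none ∉ p + s := by rw [h]; simp
  rw [Multiset.mem_add, not_or] at hn
  obtain ⟨k₁, h₁⟩ | ⟨k₁, h₁⟩ := star_cases p
  swap
  · exact absurd (by rw [h₁]; simp) hn.1
  obtain ⟨k₂, h₂⟩ | ⟨k₂, h₂⟩ := star_cases s
  swap
  · exact absurd (by rw [h₂]; simp) hn.2
  refine ⟨k₁, k₂, h₁, h₂, Multiset.map_injective (Option.some_injective I) ?_⟩
  rw [← h, h₁, h₂, Multiset.map_add]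

theorem map_some_add_cons {p s : Multiset (Option I)} {k : Multiset I}
    (h : p + s = none ::ₘ k.map some) :
    (∃ k₁ k₂ : Multiset I, p = k₁.map some ∧ s = none ::ₘ k₂.map some ∧ k = k₁ + k₂) ∨
    (∃ k₁ k₂ : Multiset I, p = none ::ₘ k₁.map some ∧ s = k₂.map some ∧ k = k₁ + k₂) := by
  have hn : none ∈ p + s := by rw [h]; simp
  rcases Multiset.mem_add.1 hn with hp | hs
  · obtain ⟨t, rfl⟩ := Multiset.exists_cons_of_mem hp
    rw [Multiset.cons_add, Multiset.cons_inj_right] at h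
    obtain ⟨k₁, k₂, rfl, rfl, rfl⟩ := map_some_add h
    exact Or.inr ⟨k₁, k₂, rfl, rfl, rfl⟩
  · obtain ⟨t, rfl⟩ := Multiset.exists_cons_of_mem hs
    rw [Multiset.add_cons, Multiset.cons_inj_right] at h
    obtain ⟨k₁, k₂, rfl, rfl, rfl⟩ := map_some_add h
    exact Or.inl ⟨k₁, k₂, rfl, rfl, rfl⟩

theorem exists_relabel_some_of_leaves {T : BinTree (Option I)} {k : Multiset I}
    (h : T.leaves = k.map some) : ∃ S, relabel some S = T ∧ S.leaves = k := by
  obtain ⟨S, rfl⟩ := exists_relabel_some (T := T) (by rw [h]; simp)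
  rw [leaves_relabel] at h
  exact ⟨S, rfl, Multiset.map_injective (Option.some_injective I) h⟩

/-- Turns a count of leaves into a shape suited to induction along the path from `⋆` to the root. -/
theorem oneStar_of_leaves {T : BinTree (Option I)} : ∀ {k : Multiset I},
    T.leaves = none ::ₘ k.map some → OneStar T k := by
  induction T using induction with
  | leaf o =>
    intro k h
    have h' : ({o} : Multiset (Option I)) = none ::ₘ k.map some := h
    rcases (Multiset.singleton_eq_cons_iff _).1 h' with ⟨rfl, hk⟩
    rw [Multiset.map_eq_zero] at hk
    rw [hk]
    exact OneStar.star
  | vee S T hS hT =>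
    intro k h
    rw [leaves_vee] at h
    rcases map_some_add_cons h with ⟨k₁, k₂, h₁, h₂, rfl⟩ | ⟨k₁, k₂, h₁, h₂, rfl⟩
    · obtain ⟨S', rfl, rfl⟩ := exists_relabel_some_of_leaves h₁
      exact OneStar.vee S' (hT h₂)
    · obtain ⟨T', rfl, rfl⟩ := exists_relabel_some_of_leaves h₂
      -- Trees are not planar, so the branch that contains `⋆` may be put on the right; `OneStar`
      -- needs only one grafting constructor.
      rw [vee_comm, add_comm]
      exact OneStar.vee T' (hS h₁)

theorem OneStar.leaves {T : BinTree (Option I)} {k : Multiset I} (h : OneStar T k) :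
    T.leaves = none ::ₘ k.map some := by
  induction h with
  | star => rfl
  | vee S _ ih => rw [leaves_vee, ih, leaves_relabel, Multiset.map_add, Multiset.add_cons]

/-- The trees with exactly one leaf `⋆` and one leaf `#`. -/
inductive TwoStar : BinTree (Option (Option I)) → Prop
  -- The vertex where the paths from the two marked leaves to the root meet: `S` carries `some none`
  -- and `U` carries `none`.
  | base {S U : BinTree (Option I)} {k l : Multiset I} : OneStar S k → OneStar U l →
      TwoStar ((relabel some S).vee (relabel (Option.map some) U))
  | step (S : BinTree I) {T : BinTree (Option (Option I))} :
      TwoStar T → TwoStar ((relabel (some ∘ some) S).vee T)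

theorem OneStar.exists_relabel {T : BinTree (Option (Option I))} {k' : Multiset (Option I)}
    (h : OneStar T k') : ∀ {k : Multiset I}, k' = k.map some →
      ∃ U : BinTree (Option I), relabel (Option.map some) U = T ∧ OneStar U k := by
  induction h with
  | star =>
    intro k hk
    have : k = 0 := by simpa [eq_comm] using hk
    subst this
    exact ⟨leaf none, rfl, OneStar.star⟩
  | vee S _ ih =>
    intro k hk
    obtain ⟨k₁, k₂, h₁, h₂, rfl⟩ := map_some_add hk
    obtain ⟨S', rfl, rfl⟩ := exists_relabel_some_of_leaves h₁
    obtain ⟨U, rfl, hU⟩ := ih h₂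
    refine ⟨(relabel some S').vee U, ?_, OneStar.vee S' hU⟩
    simp [relabel_relabel, Function.comp_def]

/-- Follow the path from the root to the outer mark `none`. At each vertex the other mark is either
in the side tree, where the two paths separate, or further along the path. -/
theorem OneStar.twoStar {T : BinTree (Option (Option I))} {k' : Multiset (Option I)}
    (h : OneStar T k') : ∀ {k : Multiset I}, k' = none ::ₘ k.map some → TwoStar T := by
  induction h with
  | star => intro k hk; simp at hk
  | vee S hT ih =>
    intro k hk
    rcases map_some_add_cons hk with ⟨k₁, k₂, h₁, h₂, rfl⟩ | ⟨k₁, k₂, h₁, h₂, rfl⟩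
    · obtain ⟨S', rfl, rfl⟩ := exists_relabel_some_of_leaves h₁
      rw [relabel_relabel]
      exact TwoStar.step S' (ih h₂)
    · obtain ⟨U, rfl, hU⟩ := hT.exists_relabel h₂
      exact TwoStar.base (oneStar_of_leaves h₁) hU

end BinTree

open BinTree

/-! ### Rules for the composition of forests -/

section Forests

variable {I J K I' J' : Type}

@[simp] theorem forestMap_tree (f : I → J) (T : BinTree I) :
    forestMap f (tree T) = tree (relabel f T) := by
  simp [forestMap, tree]

theorem forestMap_forestMap (f : I → J) (g : J → K) (a : ExteriorAlgebra ℚ (BinTree I →₀ ℚ)) :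
    forestMap g (forestMap f a) = forestMap (g ∘ f) a := by
  simp only [forestMap, ← AlgHom.comp_apply, ExteriorAlgebra.map_comp_map,
    ← Finsupp.lmapDomain_comp]
  congr 3
  funext T
  simp [relabel_relabel]

theorem forestMap_id (a : ExteriorAlgebra ℚ (BinTree I →₀ ℚ)) : forestMap id a = a := by
  have : relabel (id : I → I) = id := funext relabel_id
  simp [forestMap, this]

theorem forestMap_wedge (f : I → J) (L : List (BinTree I)) :
    forestMap f (wedge L) = wedge (L.map (relabel f)) := map_wedge _ _

theorem forestMap_inv (f : I → J) (a : ExteriorAlgebra ℚ (BinTree I →₀ ℚ)) :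
    forestMap f (inv _ a) = inv _ (forestMap f a) := ExteriorAlgebra.map_inv _ _

theorem forestMap_graftDer (f : I → J) (S : BinTree I) (a : ExteriorAlgebra ℚ (BinTree I →₀ ℚ)) :
    forestMap f (graftDer S a) = graftDer (relabel f S) (forestMap f a) :=
  map_derivation _ (fun x => by rw [mapDomain_graft]; simp) a

theorem forestMap_bracket (f : I → J) (a b : ExteriorAlgebra ℚ (BinTree I →₀ ℚ)) :
    forestMap f (bracket (graft I) a b) = bracket (graft J) (forestMap f a) (forestMap f b) :=
  ExteriorAlgebra.map_bracket _ _ _ (mapDomain_graft f) a b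

theorem wedge_cons {X : Type} (x : X) (L : List X) :
    wedge (x :: L) = ExteriorAlgebra.ι ℚ (Finsupp.single x 1) * wedge L := by
  simp [wedge]

theorem wedge_append {X : Type} (L L' : List X) : wedge (L ++ L') = wedge L * wedge L' := by
  simp [wedge]

theorem inv_wedge {X : Type} (L : List X) :
    inv _ (wedge L) = (L.length : ℤ).negOnePow • wedge L := by
  refine (involute_wedge L).trans ?_
  rcases Nat.even_or_odd L.length with h | h
  · rw [h.neg_one_pow, Int.negOnePow_even _ (by exact_mod_cast h)]; simp
  · rw [h.neg_one_pow, Int.negOnePow_odd _ (by exact_mod_cast h)]; simp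

theorem forestComp_tree (T : BinTree (Option I)) (y : ExteriorAlgebra ℚ (BinTree J →₀ ℚ)) :
    forestComp I J (tree T) y = subst I J T y := by
  simp [forestComp, tree, ExteriorAlgebra.insertion_ι]

theorem linearCombination_subst_some (x : BinTree I →₀ ℚ) :
    Finsupp.linearCombination ℚ (subst I J) (Finsupp.lmapDomain ℚ ℚ (relabel some) x) = 0 := by
  have : Finsupp.linearCombination ℚ (subst I J) ∘ₗ Finsupp.lmapDomain ℚ ℚ (relabel some) = 0 := by
    ext S : 2
    simp
  exact congrArg (fun g => g x) this

theorem linearCombination_keep_some :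
    Finsupp.linearCombination ℚ (keep I J) ∘ₗ Finsupp.lmapDomain ℚ ℚ (relabel some) =
      Finsupp.lmapDomain ℚ ℚ (relabel Sum.inl) := by
  ext S : 2
  simp

/-- `(x ∧ b) ∘_⋆ y = x ∧ (b ∘_⋆ y)` if `⋆` does not occur in `x`. -/
theorem forestComp_mul (a : ExteriorAlgebra ℚ (BinTree I →₀ ℚ))
    (b : ExteriorAlgebra ℚ (BinTree (Option I) →₀ ℚ)) (y : ExteriorAlgebra ℚ (BinTree J →₀ ℚ)) :
    forestComp I J (forestMap some a * b) y = forestMap Sum.inl a * forestComp I J b y := by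
  rw [forestComp, forestMap, ExteriorAlgebra.insertion_map_mul, linearCombination_keep_some]
  · rfl
  · intro x
    rw [linearCombination_subst_some]
    rfl

theorem forestComp_mul_tree (a : ExteriorAlgebra ℚ (BinTree I →₀ ℚ)) (T : BinTree (Option I))
    (y : ExteriorAlgebra ℚ (BinTree J →₀ ℚ)) :
    forestComp I J (forestMap some a * tree T) y = forestMap Sum.inl a * subst I J T y := by
  rw [forestComp_mul, forestComp_tree]

/-- `D_S (x ∘_⋆ y) = D_S x ∘_⋆ y` if `⋆` is not a leaf of `S`. -/
theorem forestComp_graftDer (S : BinTree I) (b : ExteriorAlgebra ℚ (BinTree (Option I) →₀ ℚ))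
    (y : ExteriorAlgebra ℚ (BinTree J →₀ ℚ)) :
    forestComp I J (graftDer (relabel some S) b) y =
      graftDer (relabel Sum.inl S) (forestComp I J b y) := by
  refine ExteriorAlgebra.insertion_derivation _ _ y (fun x => ?_) (fun x => ?_) b
  · have : Finsupp.linearCombination ℚ (keep I J) ∘ₗ
        graft _ (Finsupp.single (relabel some S) 1) =
        graft _ (Finsupp.single (relabel Sum.inl S) 1) ∘ₗ
          Finsupp.linearCombination ℚ (keep I J) := by
      ext T : 2
      simp
    exact congrArg (fun g => g x) this
  · induction x using Finsupp.induction_linear with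
    | zero => simp
    | add x y hx hy => simp only [map_add, LinearMap.add_apply, hx, hy]
    | single T c =>
      have hc : Finsupp.single T c = c • Finsupp.single T (1 : ℚ) := by simp
      rw [hc]
      simp only [map_smul, graft_single, Finsupp.linearCombination_single, one_smul,
        LinearMap.smul_apply, subst_vee_some]
      rfl

theorem forestComp_forestMap (e : I → I') (f : J → J')
    (a : ExteriorAlgebra ℚ (BinTree (Option I) →₀ ℚ)) (y : ExteriorAlgebra ℚ (BinTree J →₀ ℚ)) :
    forestComp I' J' (forestMap (Option.map e) a) (forestMap f y) =
      forestMap (Sum.map e f) (forestComp I J a y) := by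
  refine (ExteriorAlgebra.map_insertion _ _ _ _ _ _ y _ (fun x => ?_) (fun x => ?_) a).symm
  · induction x using Finsupp.induction_linear with
    | zero => simp
    | add x y hx hy => simp only [map_add, hx, hy]
    | single T c => simp [keep_relabel e f]
  · induction x using Finsupp.induction_linear with
    | zero => simp
    | add x y hx hy => simp only [map_add, LinearMap.add_apply, hx, hy]
    | single T c =>
      have := subst_relabel e f T y
      simp only [forestMap] at this
      simp [forestMap, this]

/-- `(D_S w) ∘_⋆ y = {w, S ∘_⋆ y}` if `⋆` is a leaf of `S` and does not occur in `w`. -/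
theorem forestComp_graftDer_forestMap (S : BinTree (Option I))
    (w : ExteriorAlgebra ℚ (BinTree I →₀ ℚ)) (y : ExteriorAlgebra ℚ (BinTree J →₀ ℚ))
    {k : Multiset I} (hS : OneStar S k) :
    forestComp I J (graftDer S (forestMap some w)) y =
      bracket (graft (I ⊕ J)) (forestMap Sum.inl w) (subst I J S y) := by
  have hk : keep I J S = 0 := by
    cases hS with
    | star => rfl
    | vee S' h =>
      have : ∀ {T : BinTree (Option I)} {k}, OneStar T k → keep I J T = 0 := by
        intro T k h
        induction h with
        | star => rfl
        | vee S _ ih => simp [ih]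
      simp [this h]
  -- The recursion of the left side on `x ∧ a`: the tree grafted on `x` contains `⋆` and is moved to
  -- the last place past `a`, which produces `inv`. This is the recursion `bracket_ι_mul` of the
  -- right side.
  have key : ∀ x a, forestComp I J (graftDer S
        (forestMap some (ExteriorAlgebra.ι ℚ (Finsupp.single x 1) * a))) y =
      forestMap Sum.inl (inv _ a) * graftDer (relabel Sum.inl x) (subst I J S y) +
        tree (relabel Sum.inl x) * forestComp I J (graftDer S (forestMap some a)) y := by
    intro x a
    have h1 : forestMap (some : I → Option I) (ExteriorAlgebra.ι ℚ (Finsupp.single x 1)) =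
      tree (relabel some x) := forestMap_tree some x
    rw [map_mul, h1, graftDer, tree, derivation_ι_mul, graft_single, map_add, LinearMap.add_apply,
      ExteriorAlgebra.ι_mul_eq, ← forestMap_inv]
    refine congrArg₂ (· + ·) ?_ ?_
    · refine (forestComp_mul_tree _ _ y).trans ?_
      rw [vee_comm, subst_vee_some]
    · have h2 := forestComp_mul (J := J) (tree x) (graftDer S (forestMap some a)) y
      rw [forestMap_tree, forestMap_tree] at h2
      exact h2
  induction w using ExteriorAlgebra.ι_mul_induction with
  | one => simp [graftDer]
  | smul c a h => simp only [map_smul, LinearMap.smul_apply, h]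
  | add a b ha hb => simp only [map_add, LinearMap.add_apply, ha, hb]
  | mul x a ih =>
    induction x using Finsupp.induction_linear with
    | zero => simp
    | add x y hx hy => simp only [map_add, add_mul, LinearMap.add_apply, hx, hy]
    | single T c =>
      have hc : Finsupp.single T c = c • Finsupp.single T (1 : ℚ) := by simp
      rw [hc, map_smul, smul_mul_assoc, map_smul, map_smul, map_smul, LinearMap.smul_apply, map_smul,
        map_smul, LinearMap.smul_apply, key, ih]
      congr 1
      have h1 : forestMap (Sum.inl : I → I ⊕ J) (ExteriorAlgebra.ι ℚ (Finsupp.single T 1)) =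
        ExteriorAlgebra.ι ℚ (Finsupp.single (relabel Sum.inl T) 1) := forestMap_tree Sum.inl T
      rw [map_mul, h1, ExteriorAlgebra.bracket_ι_mul, forestMap_inv, add_comm]
      rfl

end Forests

/-! ### Gradings and scaling operators -/

section Scaling

variable {M : Type} [AddCommGroup M] [Module ℚ M]

/-- A family of subspaces that spans is a grading if some operator acts on the `n`-th subspace
by `2 ^ n`. -/
theorem isInternal_of_scaling (A : ℤ → Submodule ℚ M) (θ : M →ₗ[ℚ] M)
    (hθ : ∀ n, ∀ x ∈ A n, θ x = (2 : ℚ) ^ n • x) (top : ∀ x, x ∈ iSup A) :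
    DirectSum.IsInternal A := by
  rw [DirectSum.isInternal_submodule_iff_iSupIndep_and_iSup_eq_top]
  refine ⟨?_, eq_top_iff.2 fun x _ => top x⟩
  have h := (Module.End.eigenspaces_iSupIndep (R := ℚ) (M := M) θ).comp
    (f := fun n : ℤ => (2 : ℚ) ^ n) (zpow_right_injective₀ (by norm_num) (by norm_num))
  exact h.mono fun n x hx => Module.End.mem_eigenspace_iff.2 (hθ n x hx)

/-- Together with `mem_of_scaling`, this replaces homogeneity by an eigenvalue equation for one
linear operator, which can be transported along morphisms. -/
theorem exists_scaling {A : ℤ → Submodule ℚ M} (h : DirectSum.IsInternal A) :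
    ∃ θ : M →ₗ[ℚ] M, ∀ n, ∀ x ∈ A n, θ x = (2 : ℚ) ^ n • x := by
  let _ := h.chooseDecomposition
  refine ⟨DirectSum.toModule ℚ ℤ M (fun n => (2 : ℚ) ^ n • (A n).subtype) ∘ₗ
    (DirectSum.decomposeLinearEquiv A).toLinearMap, fun n x hx => ?_⟩
  have e : DirectSum.decomposeLinearEquiv A x = DirectSum.lof ℚ ℤ (fun n => A n) n ⟨x, hx⟩ :=
    DirectSum.decompose_of_mem A hx
  rw [LinearMap.comp_apply, LinearEquiv.coe_coe, e, DirectSum.toModule_lof]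
  rfl

/-- Comparing components of degree `k` gives `(2 ^ k - 2 ^ n) x_k = 0`, and the powers of `2` are
distinct. -/
theorem mem_of_scaling {A : ℤ → Submodule ℚ M} (h : DirectSum.IsInternal A) {θ : M →ₗ[ℚ] M}
    (hθ : ∀ n, ∀ x ∈ A n, θ x = (2 : ℚ) ^ n • x) {n : ℤ} {x : M} (hx : θ x = (2 : ℚ) ^ n • x) :
    x ∈ A n := by
  classical
  let _ := h.chooseDecomposition
  have hsum := DirectSum.sum_support_decompose A x
  have key : ∀ k, ((2 : ℚ) ^ k - 2 ^ n) • DirectSum.decompose A x k = 0 := by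
    intro k
    have h1 : ∀ x, DirectSum.decompose A (θ x) k = (2 : ℚ) ^ k • DirectSum.decompose A x k := by
      intro x
      induction x using DirectSum.Decomposition.inductionOn A with
      | zero => simp
      | @homogeneous i m =>
        rw [hθ i m m.2, DirectSum.decompose_smul, DirectSum.decompose_coe, DirectSum.smul_apply]
        by_cases hik : i = k
        · subst hik; rfl
        · rw [DirectSum.of_eq_of_ne _ _ _ (Ne.symm hik)]; simp
      | add a b ha hb => simp [ha, hb]
    rw [sub_smul, ← h1, hx, DirectSum.decompose_smul, DirectSum.smul_apply, sub_self]
  rw [← hsum]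
  refine Submodule.sum_mem _ fun k _ => ?_
  by_cases hk : k = n
  · rw [hk]; exact (DirectSum.decompose A x n).2
  · have : DirectSum.decompose A x k = 0 := (smul_eq_zero.1 (key k)).resolve_left
      (sub_ne_zero.2 fun e => hk (zpow_right_injective₀ (by norm_num) (by norm_num) e))
    rw [this]; exact Submodule.zero_mem _

end Scaling

namespace ExteriorAlgebra

variable {M N V : Type} [AddCommGroup M] [Module ℚ M] [AddCommGroup N] [Module ℚ N]
  [AddCommGroup V] [Module ℚ V]

/-- The automorphism `x₁ ∧ ⋯ ∧ xₖ ↦ c^k x₁ ∧ ⋯ ∧ xₖ`. -/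
def scale (M : Type) [AddCommGroup M] [Module ℚ M] (c : ℚ) :
    ExteriorAlgebra ℚ M →ₐ[ℚ] ExteriorAlgebra ℚ M :=
  map (c • LinearMap.id)

@[simp] theorem scale_ι (c : ℚ) (x : M) : scale M c (ι ℚ x) = c • ι ℚ x := by simp [scale]

theorem inv_eq_scale (a : ExteriorAlgebra ℚ M) : inv M a = scale M (-1) a := by
  induction a using ι_mul_induction with
  | one => simp
  | smul c a h => simp [h]
  | add a b ha hb => simp [ha, hb]
  | mul x a h => simp [h]

theorem map_scale (f : M →ₗ[ℚ] N) (c : ℚ) (a : ExteriorAlgebra ℚ M) :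
    map f (scale M c a) = scale N c (map f a) := by
  induction a using ι_mul_induction with
  | one => simp
  | smul c a h => simp [h]
  | add a b ha hb => simp [ha, hb]
  | mul x a h => simp [h]

theorem derivation_scale (d : M →ₗ[ℚ] M) (c : ℚ) (a : ExteriorAlgebra ℚ M) :
    derivation d (scale M c a) = scale M c (derivation d a) :=
  (map_derivation _ (fun x => by simp) a).symm

/-- The extra `c` stands for the factor that is replaced. With `c = 2` this gives the additivity of
degrees under composition, with `c = -1` that of parities. -/
theorem insertion_scale (r : M →ₗ[ℚ] N) (f : M →ₗ[ℚ] V →ₗ[ℚ] ExteriorAlgebra ℚ N) (c : ℚ)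
    (v v' : V) (hf : ∀ x, f x v' = scale N c (f x v)) (a : ExteriorAlgebra ℚ M) :
    insertion r f (scale M c a) v' = c • scale N c (insertion r f a v) := by
  induction a using ι_mul_induction with
  | one => simp
  | smul c' a h =>
    rw [map_smul, map_smul, LinearMap.smul_apply, h, map_smul, LinearMap.smul_apply, map_smul,
      smul_comm]
  | add a b ha hb => simp [ha, hb]
  | mul x a ih =>
    have e : scale N c (inv N (map r a)) = inv N (map r (scale M c a)) := by
      rw [map_scale]; exact map_inv _ _
    rw [map_mul, scale_ι, smul_mul_assoc, map_smul, LinearMap.smul_apply, insertion_ι_mul, ih, hf,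
      insertion_ι_mul, map_add, map_mul, map_mul, e, scale_ι, mul_smul_comm, smul_mul_assoc]

end ExteriorAlgebra

theorem scale_wedge {X : Type} (c : ℚ) (L : List X) :
    ExteriorAlgebra.scale _ c (wedge L) = c ^ L.length • wedge L := by
  induction L with
  | nil => simp [wedge]
  | cons x L ih => simp [wedge_cons, ih, pow_succ', smul_smul, mul_comm]

/-! ### The operad of root-oriented forests -/

section

variable {I J K : Type}

theorem subst_scale (c : ℚ) (T : BinTree (Option I)) (y : ExteriorAlgebra ℚ (BinTree J →₀ ℚ)) :
    subst I J T (ExteriorAlgebra.scale _ c y) = ExteriorAlgebra.scale _ c (subst I J T y) := by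
  induction T using BinTree.induction with
  | leaf o =>
    rcases o with _ | i
    · exact ExteriorAlgebra.map_scale _ _ _
    · simp
  | vee S T hS hT =>
    simp [subst_vee, hS, hT, ExteriorAlgebra.derivation_scale]

theorem subst_inv (T : BinTree (Option I)) (y : ExteriorAlgebra ℚ (BinTree J →₀ ℚ)) :
    subst I J T (inv _ y) = inv _ (subst I J T y) := by
  rw [ExteriorAlgebra.inv_eq_scale, ExteriorAlgebra.inv_eq_scale, subst_scale]

theorem forestComp_scale (c : ℚ) (x : ExteriorAlgebra ℚ (BinTree (Option I) →₀ ℚ))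
    (y : ExteriorAlgebra ℚ (BinTree J →₀ ℚ)) :
    forestComp I J (ExteriorAlgebra.scale _ c x) (ExteriorAlgebra.scale _ c y) =
      c • ExteriorAlgebra.scale _ c (forestComp I J x y) := by
  refine ExteriorAlgebra.insertion_scale _ _ c y _ (fun x => ?_) x
  induction x using Finsupp.induction_linear with
  | zero => simp
  | add x y hx hy => simp only [map_add, LinearMap.add_apply, hx, hy]
  | single T c => simp [subst_scale]

theorem forestComp_inv (x : ExteriorAlgebra ℚ (BinTree (Option I) →₀ ℚ))
    (y : ExteriorAlgebra ℚ (BinTree J →₀ ℚ)) :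
    forestComp I J (inv _ x) (inv _ y) = -inv _ (forestComp I J x y) := by
  simp only [ExteriorAlgebra.inv_eq_scale, forestComp_scale, neg_smul, one_smul]

theorem exists_map_relabel_some : ∀ (L : List (BinTree (Option I))) {k : Multiset I},
    (L.map leaves).sum = k.map some →
      ∃ L' : List (BinTree I), L'.map (relabel some) = L ∧ (L'.map leaves).sum = k
  | [], k, h => ⟨[], rfl, by simpa [eq_comm] using h⟩
  | T :: L, k, h => by
    rw [List.map_cons, List.sum_cons] at h
    obtain ⟨k₁, k₂, h₁, h₂, rfl⟩ := map_some_add h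
    obtain ⟨S, rfl, rfl⟩ := exists_relabel_some_of_leaves h₁
    obtain ⟨L', rfl, rfl⟩ := exists_map_relabel_some L h₂
    exact ⟨S :: L', by simp, by simp⟩

/-- Exactly one tree contains `⋆`; moving it to the last place costs the sign `u`. This brings every
forest to the form on which the composition is given by its defining rule. -/
theorem exists_wedge_eq_mul_tree : ∀ (L : List (BinTree (Option I))) {k : Multiset I},
    (L.map leaves).sum = none ::ₘ k.map some →
      ∃ (u : ℤˣ) (L' : List (BinTree I)) (T : BinTree (Option I)) (l : Multiset I),
        OneStar T l ∧ (L'.map leaves).sum + l = k ∧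
        wedge L = u • (forestMap some (wedge L') * tree T)
  | [], k, h => by simp at h
  | T :: L, k, h => by
    rw [List.map_cons, List.sum_cons] at h
    rcases map_some_add_cons h with ⟨k₁, k₂, h₁, h₂, rfl⟩ | ⟨k₁, k₂, h₁, h₂, rfl⟩
    · obtain ⟨S, rfl, rfl⟩ := exists_relabel_some_of_leaves h₁
      obtain ⟨u, L', U, l, hU, rfl, e⟩ := exists_wedge_eq_mul_tree L h₂
      refine ⟨u, S :: L', U, l, hU, by simp [add_assoc], ?_⟩
      have hS : forestMap (some : I → Option I) (ExteriorAlgebra.ι ℚ (Finsupp.single S 1)) =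
        ExteriorAlgebra.ι ℚ (Finsupp.single (relabel some S) 1) := forestMap_tree some S
      rw [wedge_cons, wedge_cons, e, map_mul, hS, mul_smul_comm, mul_assoc]
    · obtain ⟨L', rfl, rfl⟩ := exists_map_relabel_some L h₂
      refine ⟨(L'.length : ℤ).negOnePow, L', T, k₁, oneStar_of_leaves h₁, add_comm _ _, ?_⟩
      rw [wedge_cons, ExteriorAlgebra.ι_mul_eq, ← forestMap_wedge, ← forestMap_inv, inv_wedge,
        ← smul_mul_assoc]
      simp only [tree, Units.smul_def, map_zsmul]

/-- Linear properties of forests on `I ⊔ {⋆}` can be checked on the `x ∧ T`, where `⋆` is a leaf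
of the tree `T`. -/
@[elab_as_elim]
theorem forest_star_induction {C : ExteriorAlgebra ℚ (BinTree (Option I) →₀ ℚ) → Prop}
    {m : Multiset I} (zero : C 0) (smul : ∀ (c : ℚ) a, C a → C (c • a))
    (add : ∀ a b, C a → C b → C (a + b))
    (mul : ∀ (L : List (BinTree I)) (T : BinTree (Option I)) (l : Multiset I), OneStar T l →
      (L.map leaves).sum + l = m → C (forestMap some (wedge L) * tree T))
    {x : ExteriorAlgebra ℚ (BinTree (Option I) →₀ ℚ)}
    (hx : x ∈ content leaves (none ::ₘ m.map some)) : C x := by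
  induction hx using Submodule.span_induction with
  | mem w hw =>
    obtain ⟨L, hL, rfl⟩ := hw
    obtain ⟨u, L', T, l, hT, hl, e⟩ := exists_wedge_eq_mul_tree L hL
    have hu : u • (forestMap some (wedge L') * tree T) =
        ((u : ℤ) : ℚ) • (forestMap some (wedge L') * tree T) := by
      rw [Int.cast_smul_eq_zsmul, Units.smul_def]
    rw [e, hu]
    exact smul _ _ (mul L' T l hT hl)
  | zero => exact zero
  | add a b _ _ ha hb => exact add _ _ ha hb
  | smul c a _ ha => exact smul _ _ ha

theorem forestComp_one {x : ExteriorAlgebra ℚ (BinTree (Option I) →₀ ℚ)} {m : Multiset I}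
    (hx : x ∈ content leaves (none ::ₘ m.map some)) :
    forestComp I Unit x (tree (leaf ())) = forestMap (Equiv.optionEquivSumPUnit I) x := by
  refine forest_star_induction ?_ ?_ ?_ (fun L T l hT hL => ?_) hx
  · simp
  · intro c a h; simp [h]
  · intro a b ha hb; simp [ha, hb]
  clear hL
  have key : subst I Unit T (tree (leaf ())) = tree (relabel (Equiv.optionEquivSumPUnit I) T) := by
    induction hT with
    | star => simp [subst_leaf_none]
    | vee S _ ih =>
      rw [subst_vee_some, ih, graftDer, tree, ExteriorAlgebra.derivation_ι, graft_single,
        relabel_vee, relabel_relabel]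
      rfl
  rw [forestComp_mul_tree, key, map_mul, forestMap_tree, forestMap_forestMap]
  rfl

/-- Induction along the path from `⋆` to the root of its tree. At the leaf the claim is naturality
under relabelling; each vertex adds the same derivation `D_S` to both sides, by
`forestComp_graftDer`. -/
theorem forestComp_forestComp {x : ExteriorAlgebra ℚ (BinTree (Option I) →₀ ℚ)} {m : Multiset I}
    (hx : x ∈ content leaves (none ::ₘ m.map some))
    (y : ExteriorAlgebra ℚ (BinTree (Option J) →₀ ℚ)) (z : ExteriorAlgebra ℚ (BinTree K →₀ ℚ)) :
    forestMap (Equiv.sumAssoc I J K) (forestComp (I ⊕ J) K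
      (forestMap (starRight I J) (forestComp I (Option J) x y)) z) =
    forestComp I (J ⊕ K) x (forestComp J K y z) := by
  refine forest_star_induction ?_ ?_ ?_ (fun L T l hT hL => ?_) hx
  · simp
  · intro c a h; simp [h]
  · intro a b ha hb; simp [ha, hb]
  clear hL
  have key : forestMap (Equiv.sumAssoc I J K) (forestComp (I ⊕ J) K
      (forestMap (starRight I J) (subst I (Option J) T y)) z) =
      subst I (J ⊕ K) T (forestComp J K y z) := by
    induction hT with
    | star =>
      have h := forestComp_forestMap (Sum.inr : J → I ⊕ J) (id : K → K) y z
      rw [forestMap_id] at h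
      simp only [subst_leaf_none, AlgHom.toLinearMap_apply, forestMap_forestMap]
      have e : (starRight I J) ∘ Sum.inr = Option.map (Sum.inr : J → I ⊕ J) := by
        funext o; rcases o with _ | j <;> rfl
      rw [e, h, forestMap_forestMap]
      congr 2
      funext o; rcases o with _ | j <;> rfl
    | vee S _ ih =>
      rw [subst_vee_some, forestMap_graftDer, relabel_relabel, subst_vee_some, ← ih]
      have e : (starRight I J) ∘ Sum.inl = some ∘ (Sum.inl : I → I ⊕ J) := rfl
      rw [e, ← relabel_relabel, forestComp_graftDer, forestMap_graftDer, relabel_relabel,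
        relabel_relabel]
      rfl
  have e : (starRight I J) ∘ Sum.inl = some ∘ (Sum.inl : I → I ⊕ J) := rfl
  rw [forestComp_mul_tree, forestComp_mul_tree, map_mul, forestMap_forestMap, e,
    ← forestMap_forestMap, forestComp_mul, map_mul, key, forestMap_forestMap, forestMap_forestMap]
  rfl

theorem starLeft_comp_sumMap :
    starLeft I K ∘ Sum.map some id = (some : I ⊕ K → Option (I ⊕ K)) := by
  funext o; rcases o with _ | j <;> rfl

theorem starLeft_comp_inl :
    starLeft I K ∘ Sum.inl = Option.map (Sum.inl : I → I ⊕ K) := by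
  funext o; rcases o with _ | j <;> rfl

theorem starSwap_comp_some : starSwap I ∘ some = Option.map some := by
  funext o; rcases o with _ | j <;> rfl

theorem starSwap_comp_map : starSwap I ∘ Option.map some = some := by
  funext o; rcases o with _ | j <;> rfl

/-- Substitution at `#` in a tree without leaf `⋆`. -/
theorem starLeft_subst_relabel (U : BinTree (Option I)) (z : ExteriorAlgebra ℚ (BinTree K →₀ ℚ)) :
    forestMap (starLeft I K) (subst (Option I) K (relabel (Option.map some) U) z) =
      forestMap some (subst I K U z) := by
  have h := subst_relabel (some : I → Option I) (id : K → K) U z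
  rw [forestMap_id] at h
  rw [h, forestMap_forestMap, starLeft_comp_sumMap]

/-- Substitution at `⋆` in a tree that has been relabelled after a composition at `#`. -/
theorem subst_starLeft_inl (S : BinTree (Option I)) (y : ExteriorAlgebra ℚ (BinTree J →₀ ℚ)) :
    subst (I ⊕ K) J (relabel (starLeft I K ∘ Sum.inl) S) y =
      forestMap (Sum.map Sum.inl id) (subst I J S y) := by
  have h := subst_relabel (Sum.inl : I → I ⊕ K) (id : J → J) S y
  rw [forestMap_id] at h
  rw [starLeft_comp_inl, h]

theorem parity_subst (T : BinTree (Option I)) {y : ExteriorAlgebra ℚ (BinTree J →₀ ℚ)} {m : ℤ}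
    (hy : inv _ y = m.negOnePow • y) : inv _ (subst I J T y) = m.negOnePow • subst I J T y := by
  rw [← subst_inv, hy, Units.smul_def, Units.smul_def, map_zsmul]

theorem parity_forestMap (f : I → J) {y : ExteriorAlgebra ℚ (BinTree I →₀ ℚ)} {m : ℤ}
    (hy : inv _ y = m.negOnePow • y) : inv _ (forestMap f y) = m.negOnePow • forestMap f y := by
  rw [← forestMap_inv, hy, Units.smul_def, Units.smul_def, map_zsmul]

theorem BinTree.OneStar.relabel_map {T : BinTree (Option I)} {k : Multiset I} (h : OneStar T k)
    (f : I → J) : OneStar (relabel (Option.map f) T) (k.map f) := by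
  refine oneStar_of_leaves ?_
  rw [leaves_relabel, h.leaves, Multiset.map_cons, Multiset.map_map, Multiset.map_map]
  rfl

/-- Between the meeting vertex and the root, each `D_S` passes through both compositions. At the
meeting vertex the two orders give the same bracket with its arguments exchanged, so the Koszul sign
is that of the graded symmetry. -/
theorem BinTree.TwoStar.subst_comm {T : BinTree (Option (Option I))} (hT : TwoStar T) {m n : ℤ}
    {y : ExteriorAlgebra ℚ (BinTree J →₀ ℚ)} {z : ExteriorAlgebra ℚ (BinTree K →₀ ℚ)}
    (hy : inv _ y = (m + 1).negOnePow • y) (hz : inv _ z = (n + 1).negOnePow • z) :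
    forestComp (I ⊕ K) J (forestMap (starLeft I K) (subst (Option I) K T z)) y =
      (m * n).negOnePow • forestMap (sumExchange I J K) (forestComp (I ⊕ J) K
        (forestMap (starLeft I J) (subst (Option I) J (relabel (starSwap I) T) y)) z) := by
  induction hT with
  | @base S U k l hS hU =>
    -- Composing at `#` first gives `D_S` applied to `U ∘ z`, in which `⋆` does not occur; composing
    -- at `⋆` in `S` then turns `D_S` into a bracket.
    have main : ∀ {J K : Type} {S U : BinTree (Option I)} {k l : Multiset I}
        (hS : OneStar S k) (hU : OneStar U l) (y : ExteriorAlgebra ℚ (BinTree J →₀ ℚ))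
        (z : ExteriorAlgebra ℚ (BinTree K →₀ ℚ)),
        forestComp (I ⊕ K) J (forestMap (starLeft I K) (subst (Option I) K
          ((relabel some S).vee (relabel (Option.map some) U)) z)) y =
        bracket (graft _) (forestMap Sum.inl (subst I K U z))
          (forestMap (Sum.map Sum.inl id) (subst I J S y)) := by
      intro J K S U k l hS hU y z
      rw [subst_vee_some, forestMap_graftDer, starLeft_subst_relabel, relabel_relabel]
      have hS' := hS.relabel_map (Sum.inl : I → I ⊕ K)
      rw [← starLeft_comp_inl] at hS'
      rw [forestComp_graftDer_forestMap _ _ _ hS', subst_starLeft_inl]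
    rw [main hS hU, relabel_vee, relabel_relabel, relabel_relabel, starSwap_comp_some,
      starSwap_comp_map, vee_comm, main hU hS, forestMap_bracket, forestMap_forestMap,
      forestMap_forestMap, ExteriorAlgebra.bracket_comm_of_parity (graft _) graft_comm (p := n)
      (q := m) (parity_forestMap _ (parity_subst U hz)) (parity_forestMap _ (parity_subst S hy)),
      mul_comm n m]
    congr 3
    · congr 2
      funext o; rcases o with _ | j <;> rfl
    · congr 2
      funext o; rcases o with _ | j <;> rfl
  | step S _ ih =>
    have e1 : ∀ K : Type, relabel (starLeft I K) (relabel Sum.inl (relabel some S)) =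
        relabel some (relabel (Sum.inl : I → I ⊕ K) S) := by
      intro K; simp only [relabel_relabel]; rfl
    have e2 : relabel (starSwap I) (relabel some (relabel some S)) =
        relabel some (relabel some S) := by simp only [relabel_relabel]; rfl
    rw [← relabel_relabel, subst_vee_some, forestMap_graftDer, e1, forestComp_graftDer, ih,
      relabel_vee, e2, subst_vee_some, forestMap_graftDer, e1, forestComp_graftDer,
      forestMap_graftDer, relabel_relabel, relabel_relabel, relabel_relabel]
    simp only [Units.smul_def, map_zsmul]
    rfl

theorem forestComp_starLeft_mul (a : ExteriorAlgebra ℚ (BinTree I →₀ ℚ))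
    (b : ExteriorAlgebra ℚ (BinTree (Option (Option I)) →₀ ℚ))
    (y : ExteriorAlgebra ℚ (BinTree J →₀ ℚ)) (z : ExteriorAlgebra ℚ (BinTree K →₀ ℚ)) :
    forestComp (I ⊕ K) J (forestMap (starLeft I K)
      (forestComp (Option I) K (forestMap (some ∘ some) a * b) z)) y =
    forestMap (Sum.inl ∘ Sum.inl) a *
      forestComp (I ⊕ K) J (forestMap (starLeft I K) (forestComp (Option I) K b z)) y := by
  have e1 : (starLeft I K ∘ Sum.inl) ∘ some = some ∘ (Sum.inl : I → I ⊕ K) := rfl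
  rw [← forestMap_forestMap some some, forestComp_mul, map_mul, forestMap_forestMap,
    forestMap_forestMap, e1, ← forestMap_forestMap Sum.inl some, forestComp_mul,
    forestMap_forestMap]

theorem forestComp_starLeft_tree_mul_tree (S U : BinTree (Option I))
    (y : ExteriorAlgebra ℚ (BinTree J →₀ ℚ)) (z : ExteriorAlgebra ℚ (BinTree K →₀ ℚ)) :
    forestComp (I ⊕ K) J (forestMap (starLeft I K) (forestComp (Option I) K
      (tree (relabel some S) * tree (relabel (Option.map some) U)) z)) y =
    forestMap Sum.inl (inv _ (subst I K U z)) *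
      forestMap (Sum.map Sum.inl id) (subst I J S y) := by
  rw [← forestMap_tree, forestComp_mul_tree, map_mul, starLeft_subst_relabel, forestMap_forestMap,
    forestMap_tree, tree, ExteriorAlgebra.ι_mul_eq, ← forestMap_inv]
  refine (forestComp_mul_tree _ _ y).trans ?_
  rw [subst_starLeft_inl]

/-- If both marks are in one tree, this is `TwoStar.subst_comm`. If they are in two trees, each
composition replaces one factor of a wedge product, and the sign is the supercommutativity of that
product. -/
theorem forestComp_comm {x : ExteriorAlgebra ℚ (BinTree (Option (Option I)) →₀ ℚ)}
    {k : Multiset I} (hx : x ∈ content leaves (none ::ₘ (none ::ₘ k.map some).map some)) {m n : ℤ}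
    {y : ExteriorAlgebra ℚ (BinTree J →₀ ℚ)} {z : ExteriorAlgebra ℚ (BinTree K →₀ ℚ)}
    (hy : inv _ y = (m + 1).negOnePow • y) (hz : inv _ z = (n + 1).negOnePow • z) :
    forestComp (I ⊕ K) J (forestMap (starLeft I K) (forestComp (Option I) K x z)) y =
      (m * n).negOnePow • forestMap (sumExchange I J K) (forestComp (I ⊕ J) K
        (forestMap (starLeft I J) (forestComp (Option I) J (forestMap (starSwap I) x) y)) z) := by
  refine forest_star_induction ?_ ?_ ?_ (fun L T l hT hL => ?_) hx
  · simp
  · intro c a h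
    simp only [map_smul, LinearMap.smul_apply, h]
    exact smul_comm _ _ _
  · intro a b ha hb; simp [ha, hb]
  have e2 : starSwap I ∘ some ∘ some = some ∘ some := rfl
  have e3 : sumExchange I J K ∘ Sum.inl ∘ Sum.inl = Sum.inl ∘ Sum.inl := rfl
  rcases map_some_add_cons hL with ⟨k₁, k₂, h₁, h₂, rfl⟩ | ⟨k₁, k₂, h₁, h₂, rfl⟩
  · obtain ⟨L', rfl, rfl⟩ := exists_map_relabel_some L h₁
    rw [← forestMap_wedge, forestMap_forestMap, forestComp_starLeft_mul, map_mul,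
      forestMap_forestMap, e2, forestComp_starLeft_mul, map_mul, forestMap_forestMap, e3,
      forestComp_tree, forestMap_tree, forestComp_tree, (hT.twoStar h₂).subst_comm hy hz]
    simp only [Units.smul_def, mul_smul_comm]
  · obtain ⟨U, rfl, hU⟩ := hT.exists_relabel h₂
    obtain ⟨u, L', S, l', hS, rfl, e⟩ := exists_wedge_eq_mul_tree L h₁
    -- Exchanging the marks exchanges the roles of the two trees; restoring the order, with the tree
    -- of `#` last, costs `-1`.
    have swap : forestMap (starSwap I) (tree (relabel some S) * tree (relabel (Option.map some) U))
        = (-1 : ℚ) • (tree (relabel some U) * tree (relabel (Option.map some) S)) := by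
      simp only [map_mul, forestMap_tree, relabel_relabel, starSwap_comp_some, starSwap_comp_map]
      rw [tree, tree, ExteriorAlgebra.ι_mul_ι, neg_smul, one_smul]
    have hu : u • (forestMap some (wedge L') * tree S) =
        ((u : ℤ) : ℚ) • (forestMap some (wedge L') * tree S) := by
      rw [Int.cast_smul_eq_zsmul, Units.smul_def]
    rw [e, hu, map_smul, smul_mul_assoc, map_mul, forestMap_tree, forestMap_forestMap, mul_assoc]
    simp only [map_smul, LinearMap.smul_apply]
    rw [smul_comm]
    refine congrArg _ ?_
    rw [forestComp_starLeft_mul, map_mul (forestMap (starSwap I)), forestMap_forestMap, e2,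
      forestComp_starLeft_mul, map_mul (forestMap (sumExchange I J K)), forestMap_forestMap, e3,
      swap]
    simp only [map_smul, LinearMap.smul_apply]
    rw [forestComp_starLeft_tree_mul_tree, forestComp_starLeft_tree_mul_tree, map_mul,
      forestMap_forestMap, forestMap_forestMap]
    have e4 : sumExchange I J K ∘ Sum.map Sum.inl id = Sum.inl := by
      funext o; rcases o with _ | j <;> rfl
    have e5 : sumExchange I J K ∘ Sum.inl = Sum.map Sum.inl id := by
      funext o; rcases o with _ | j <;> rfl
    have hw := parity_forestMap (Sum.inl : I ⊕ K → (I ⊕ K) ⊕ J) (parity_subst U hz)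
    have hv := parity_forestMap (Sum.map Sum.inl id : I ⊕ J → (I ⊕ K) ⊕ J) (parity_subst S hy)
    have hc := ExteriorAlgebra.mul_comm_of_parity hv hw
    rw [e4, e5, forestMap_inv, forestMap_inv, hw, hv, smul_mul_assoc, smul_mul_assoc, hc]
    rw [neg_smul, one_smul, mul_neg, smul_smul, mul_smul_comm, mul_smul_comm, ← Units.neg_smul,
      smul_smul, ← Int.negOnePow_add, ← Int.negOnePow_succ, ← Int.negOnePow_add]
    congr 1
    rw [Int.negOnePow_eq_iff]
    -- The left exponent is `n + 1`, from `inv`. On the right are collected `m * n`, the sign of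
    -- `swap`, `m + 1` from `inv` and `(m + 1) * (n + 1)` from the exchange of the two factors.
    refine ⟨-(m * n + m + 1), ?_⟩
    ring

end

/-! ### The axioms for `B` -/

namespace BOperad

variable {I J K : Type} [Fintype I] [Fintype J] [Fintype K]

/-- The inclusion of the forests on `I` in the exterior algebra of trees. -/
def val (I : Type) [Fintype I] [Nonempty I] :
    BOperad.obj I →ₗ[ℚ] ExteriorAlgebra ℚ (BinTree I →₀ ℚ) :=
  (forestSpace I).subtype

theorem val_injective [Nonempty I] : Function.Injective (val I) := Subtype.val_injective

theorem val_mem [Nonempty I] (x : BOperad.obj I) : val I x ∈ forestSpace I := x.2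

theorem val_map [Nonempty I] [Nonempty J] (e : I ≃ J) (x : BOperad.obj I) :
    val J (BOperad.map e x) = forestMap e (val I x) := rfl

theorem val_comp [Nonempty J] (x : BOperad.obj (Option I)) (y : BOperad.obj J) :
    val (I ⊕ J) (BOperad.comp x y) = forestComp I J (val _ x) (val _ y) := rfl

theorem val_one : val Unit BOperad.one = tree (leaf ()) := by
  change wedge [leaf ()] = _
  simp [wedge, tree]

theorem val_par [Nonempty I] (x : BOperad.obj I) :
    val I (BOperad.par I x) = -inv _ (val I x) := rfl

theorem scale_mem_content {X I : Type} {lv : X → Multiset I} {m : Multiset I} (c : ℚ)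
    {a : ExteriorAlgebra ℚ (X →₀ ℚ)} (ha : a ∈ content lv m) :
    ExteriorAlgebra.scale _ c a ∈ content lv m := by
  induction ha using Submodule.span_induction with
  | mem w hw =>
    obtain ⟨L, rfl, rfl⟩ := hw
    rw [scale_wedge]
    exact Submodule.smul_mem _ _ (wedge_mem_content lv L)
  | zero => simp
  | add a b _ _ ha hb => rw [map_add]; exact Submodule.add_mem _ ha hb
  | smul c a _ ha => rw [map_smul]; exact Submodule.smul_mem _ _ ha

/-- The operator that multiplies the elements of degree `n` by `2 ^ n`. -/
def scaling (I : Type) [Fintype I] [Nonempty I] : BOperad.obj I →ₗ[ℚ] BOperad.obj I :=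
  -- `scale` counts trees, and the degree is the number of trees minus one; hence the `1 / 2`.
  (1 / 2 : ℚ) • (ExteriorAlgebra.scale (BinTree I →₀ ℚ) 2).toLinearMap.restrict
    (p := forestSpace I) (q := forestSpace I) (fun _ ha => scale_mem_content 2 ha)

theorem val_scaling [Nonempty I] (x : BOperad.obj I) :
    val I (scaling I x) = (1 / 2 : ℚ) • ExteriorAlgebra.scale _ 2 (val I x) := rfl

@[elab_as_elim]
theorem gr_induction [Nonempty I] {n : ℤ} {C : BOperad.obj I → Prop} {x : BOperad.obj I}
    (zero : C 0) (smul : ∀ (c : ℚ) a, C a → C (c • a)) (add : ∀ a b, C a → C b → C (a + b))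
    (wedge : ∀ (L : List (BinTree I)) (x : BOperad.obj I), (L.length : ℤ) = n + 1 →
      (L.map BinTree.leaves).sum = (Finset.univ : Finset I).val → val I x = wedge L → C x)
    (hx : x ∈ BOperad.gr I n) : C x := by
  refine Submodule.span_induction (p := fun x _ => C x) ?_ zero (fun a b _ _ => add a b)
    (fun c a _ => smul c a) hx
  rintro x ⟨L, h1, h2, h3⟩
  exact wedge L x h1 h2 h3

theorem scaling_apply [Nonempty I] (n : ℤ) (x : BOperad.obj I) (hx : x ∈ BOperad.gr I n) :
    scaling I x = (2 : ℚ) ^ n • x := by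
  refine gr_induction ?_ ?_ ?_ (fun L x hL hL' e => ?_) hx
  · simp
  · intro c a h; rw [map_smul, h, smul_comm]
  · intro a b ha hb; rw [map_add, ha, hb, smul_add]
  · apply val_injective
    rw [val_scaling, map_smul, e, scale_wedge, smul_smul]
    congr 1
    have h2 : (2 : ℚ) ^ L.length = 2 ^ (n + 1) := by rw [← hL, zpow_natCast]
    rw [h2, zpow_add_one₀ two_ne_zero]
    ring

theorem parity_val [Nonempty I] (n : ℤ) (x : BOperad.obj I) (hx : x ∈ BOperad.gr I n) :
    inv _ (val I x) = (n + 1).negOnePow • val I x := by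
  refine gr_induction ?_ ?_ ?_ (fun L x hL hL' e => ?_) hx
  · simp
  · intro c a h; rw [map_smul, map_smul, h, smul_comm]
  · intro a b ha hb; rw [map_add, map_add, ha, hb, smul_add]
  · rw [e, inv_wedge, hL]

theorem mem_gr_of_wedge [Nonempty I] {n : ℤ} {x : BOperad.obj I} (L : List (BinTree I))
    (hL : (L.length : ℤ) = n + 1) (hL' : (L.map BinTree.leaves).sum = (Finset.univ : Finset I).val)
    (hx : val I x = wedge L) : x ∈ BOperad.gr I n :=
  Submodule.subset_span (R := ℚ) (M := forestSpace I) ⟨L, hL, hL', hx⟩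

theorem mem_iSup_gr [Nonempty I] (x : BOperad.obj I) : x ∈ iSup (BOperad.gr I) := by
  obtain ⟨a, ha⟩ := x
  induction ha using Submodule.span_induction with
  | mem w hw =>
    obtain ⟨L, h1, rfl⟩ := hw
    exact Submodule.mem_iSup_of_mem ((L.length : ℤ) - 1) (mem_gr_of_wedge L (by simp) h1 rfl)
  | zero => exact Submodule.zero_mem _
  | add a b _ _ ha hb => exact Submodule.add_mem _ ha hb
  | smul c a _ ha => exact Submodule.smul_mem (iSup (BOperad.gr I)) c ha

theorem gr_internal [Nonempty I] : DirectSum.IsInternal (BOperad.gr I) :=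
  isInternal_of_scaling _ (scaling I) scaling_apply mem_iSup_gr

/-- In this form the degree axioms for `map` and `comp` follow from the identities for `scale`, with
no choice of a spanning set. -/
theorem mem_gr_iff [Nonempty I] {n : ℤ} {x : BOperad.obj I} :
    x ∈ BOperad.gr I n ↔ ExteriorAlgebra.scale _ 2 (val I x) = (2 : ℚ) ^ (n + 1) • val I x := by
  constructor
  · intro h
    have := congrArg (val I) (scaling_apply n x h)
    rw [val_scaling, map_smul] at this
    rw [zpow_add_one₀ two_ne_zero, mul_comm, ← smul_smul, ← this, smul_smul]
    simp
  · intro h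
    refine mem_of_scaling gr_internal scaling_apply (val_injective ?_)
    rw [val_scaling, h, map_smul, smul_smul, zpow_add_one₀ two_ne_zero]
    congr 1
    ring

theorem isOperad : BOperad.IsOperad where
  gr_internal I _ _ := gr_internal
  par_apply I _ _ n x hx := by
    apply val_injective
    rw [val_par, parity_val n x hx, Int.negOnePow_succ]
    simp only [Units.smul_def, map_zsmul, Units.val_neg, neg_smul, neg_neg]
  map_refl I _ _ := by
    refine LinearMap.ext fun x => val_injective ?_
    rw [val_map]
    exact forestMap_id _
  map_trans e f := by
    refine LinearMap.ext fun x => val_injective ?_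
    rw [LinearMap.comp_apply, val_map, val_map, val_map, forestMap_forestMap]
    rfl
  map_mem e n x hx := by
    rw [mem_gr_iff] at hx ⊢
    have h := ExteriorAlgebra.map_scale (Finsupp.lmapDomain ℚ ℚ (relabel e)) 2 (val _ x)
    rw [val_map]
    refine h.symm.trans ?_
    rw [hx, map_smul]
    rfl
  one_mem := by
    rw [mem_gr_iff, val_one]
    simp [tree]
  comp_mem m n x hx y hy := by
    rw [mem_gr_iff] at hx hy ⊢
    have h := forestComp_scale 2 (val _ x) (val _ y)
    rw [hx, hy, map_smul, map_smul, LinearMap.smul_apply, smul_smul] at h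
    rw [val_comp]
    apply smul_right_injective _ (two_ne_zero (α := ℚ))
    simp only [← h, smul_smul]
    congr 1
    simp only [zpow_add₀ (two_ne_zero (α := ℚ)), zpow_one]
    ring
  comp_map e f x y := by
    apply val_injective
    rw [val_comp, val_map, val_map, val_map, val_comp]
    exact forestComp_forestMap e f _ _
  comp_one x := by
    apply val_injective
    rw [val_comp, val_one, val_map]
    exact forestComp_one (val_mem x)
  one_comp y := by
    apply val_injective
    rw [val_comp, val_map, val_one, val_map, forestMap_tree, forestComp_tree]
    rfl
  comp_comp x y z := by
    apply val_injective
    rw [val_map, val_comp, val_map, val_comp, val_comp, val_comp]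
    exact forestComp_forestComp (val_mem x) _ _
  comp_comm m n x y hy z hz := by
    apply val_injective
    rw [val_comp, val_map, val_comp]
    simp only [Units.smul_def, map_zsmul]
    rw [val_map, val_comp, val_map, val_comp, val_map]
    have := forestComp_comm (val_mem x) (parity_val m y hy) (parity_val n z hz)
    rw [Units.smul_def] at this
    exact this

end BOperad

/-! ### The determinant operad -/

namespace DetOperad

variable {I J K : Type} [Fintype I] [Fintype J] [Fintype K]

/-- The inclusion of the orientations of `I` in the exterior algebra. -/
def val (I : Type) [Fintype I] [Nonempty I] :
    DetOperad.obj I →ₗ[ℚ] ExteriorAlgebra ℚ (I →₀ ℚ) :=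
  (detSpace I).subtype

theorem val_injective [Nonempty I] : Function.Injective (val I) := Subtype.val_injective

theorem val_mem [Nonempty I] (x : DetOperad.obj I) : val I x ∈ detSpace I := x.2

theorem val_comp [Nonempty J] (x : DetOperad.obj (Option I)) (y : DetOperad.obj J) :
    val (I ⊕ J) (DetOperad.comp x y) = detComp I J (val _ x) (val _ y) := rfl

theorem par_eq [Nonempty I] (x : DetOperad.obj I) :
    DetOperad.par I x = ((Fintype.card I : ℤ) - 1).negOnePow • x := rfl

theorem gr_eq [Nonempty I] (n : ℤ) :
    DetOperad.gr I n = if n = (Fintype.card I : ℤ) - 1 then ⊤ else ⊥ := rfl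

/-- Orientations, as forests without inner vertices. -/
def toForests (I : Type) :
    ExteriorAlgebra ℚ (I →₀ ℚ) →ₐ[ℚ] ExteriorAlgebra ℚ (BinTree I →₀ ℚ) :=
  ExteriorAlgebra.map (Finsupp.lmapDomain ℚ ℚ BinTree.leaf)

theorem toForests_injective (I : Type) : Function.Injective (toForests I) :=
  ExteriorAlgebra.map_injective_field
    (LinearMap.ker_eq_bot.2 (Finsupp.mapDomain_injective BinTree.leaf_injective))

theorem toForests_wedge {I : Type} (L : List I) :
    toForests I (wedge L) = wedge (L.map BinTree.leaf) := map_wedge _ _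

theorem toForests_map {I J : Type} (f : I → J) (a : ExteriorAlgebra ℚ (I →₀ ℚ)) :
    toForests J (ExteriorAlgebra.map (Finsupp.lmapDomain ℚ ℚ f) a) =
      forestMap f (toForests I a) := by
  simp only [toForests, forestMap, ← AlgHom.comp_apply, ExteriorAlgebra.map_comp_map,
    ← Finsupp.lmapDomain_comp]
  rfl

/-- Orientations compose like forests without inner vertices, so the axioms of `Det` are those of
`B` pulled back along an injective map. -/
theorem toForests_detComp {I J : Type} (a : ExteriorAlgebra ℚ (Option I →₀ ℚ))
    (b : ExteriorAlgebra ℚ (J →₀ ℚ)) :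
    toForests (I ⊕ J) (detComp I J a b) = forestComp I J (toForests _ a) (toForests _ b) := by
  refine ExteriorAlgebra.map_insertion _ _ _ _ _ _ b _ (fun x => ?_) (fun x => ?_) a
  · induction x using Finsupp.induction_linear with
    | zero => simp
    | add x y hx hy => simp only [map_add, hx, hy]
    | single o c => rcases o with _ | i <;> simp
  · induction x using Finsupp.induction_linear with
    | zero => simp
    | add x y hx hy => simp only [map_add, LinearMap.add_apply, hx, hy]
    | single o c =>
      rcases o with _ | i
      · have := toForests_map (Sum.inr : J → I ⊕ J) b
        simp only [toForests] at this
        simp [this, subst_leaf_none, toForests]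
      · simp

/-- The embedding of the operad `Det` in the operad `B`. -/
def toB (I : Type) [Fintype I] [Nonempty I] : DetOperad.obj I →ₗ[ℚ] BOperad.obj I :=
  (toForests I).toLinearMap.restrict (p := detSpace I) (q := forestSpace I) (fun a ha => by
    have := map_mem_content (lv' := BinTree.leaves) BinTree.leaf id (fun i => by simp) ha
    rwa [Multiset.map_id] at this)

theorem val_toB [Nonempty I] (x : DetOperad.obj I) :
    BOperad.val I (toB I x) = toForests I (val I x) := rfl

theorem toB_injective [Nonempty I] : Function.Injective (toB I) := by
  intro x y h
  apply val_injective
  apply toForests_injective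
  rw [← val_toB, h, val_toB]

theorem length_eq_card {L : List I} (h : (L.map fun i => ({i} : Multiset I)).sum =
    (Finset.univ : Finset I).val) : L.length = Fintype.card I := by
  have h2 : Multiset.card (L.map fun i => ({i} : Multiset I)).sum = Fintype.card I := by
    rw [h]; rfl
  have h3 : ∀ L : List I, Multiset.card (L.map fun i => ({i} : Multiset I)).sum = L.length := by
    intro L
    induction L with
    | nil => rfl
    | cons i L ih => simp [ih, add_comm]
  rw [← h3 L, h2]

theorem scale_detSpace (c : ℚ) {a : ExteriorAlgebra ℚ (I →₀ ℚ)} (ha : a ∈ detSpace I) :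
    ExteriorAlgebra.scale _ c a = c ^ Fintype.card I • a := by
  induction ha using Submodule.span_induction with
  | mem w hw =>
    obtain ⟨L, h1, rfl⟩ := hw
    rw [scale_wedge, length_eq_card h1]
  | zero => simp
  | add a b _ _ ha hb => rw [map_add, ha, hb, smul_add]
  | smul c a _ ha => rw [map_smul, ha, smul_comm]

theorem toB_mem [Nonempty I] (x : DetOperad.obj I) :
    toB I x ∈ BOperad.gr I ((Fintype.card I : ℤ) - 1) := by
  rw [BOperad.mem_gr_iff, val_toB]
  refine (ExteriorAlgebra.map_scale _ _ _).symm.trans ?_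
  rw [scale_detSpace 2 (val_mem x), map_smul, sub_add_cancel, zpow_natCast]
  rfl

theorem toB_mem_of_mem [Nonempty I] {n : ℤ} {x : DetOperad.obj I} (hx : x ∈ DetOperad.gr I n) :
    toB I x ∈ BOperad.gr I n := by
  rw [gr_eq] at hx
  split_ifs at hx with h
  · rw [h]; exact toB_mem x
  · rw [(Submodule.mem_bot ℚ).1 hx, map_zero]
    exact Submodule.zero_mem _

/-- The image of `Det(I)` is concentrated in degree `|I| - 1`; an element that also has another
degree satisfies two eigenvalue equations and is zero. -/
theorem mem_of_toB_mem [Nonempty I] {n : ℤ} {x : DetOperad.obj I} (hx : toB I x ∈ BOperad.gr I n) :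
    x ∈ DetOperad.gr I n := by
  rw [gr_eq]
  split_ifs with h
  · trivial
  · have h1 := BOperad.scaling_apply n _ hx
    have h2 := BOperad.scaling_apply _ _ (toB_mem x)
    rw [h1, ← sub_eq_zero, ← sub_smul] at h2
    have h3 := (smul_eq_zero.1 h2).resolve_left
      (sub_ne_zero.2 fun e => h (zpow_right_injective₀ (by norm_num) (by norm_num) e))
    rw [Submodule.mem_bot]
    exact toB_injective (h3.trans (map_zero _).symm)

theorem toB_map [Nonempty I] [Nonempty J] (e : I ≃ J) (x : DetOperad.obj I) :
    toB J (DetOperad.map e x) = BOperad.map e (toB I x) :=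
  BOperad.val_injective (toForests_map e _)

theorem toB_comp [Nonempty J] (x : DetOperad.obj (Option I)) (y : DetOperad.obj J) :
    toB (I ⊕ J) (DetOperad.comp x y) = BOperad.comp (toB _ x) (toB _ y) :=
  BOperad.val_injective (toForests_detComp _ _)

theorem toB_one : toB Unit DetOperad.one = BOperad.one :=
  BOperad.val_injective (toForests_wedge [()])

theorem isOperad : DetOperad.IsOperad where
  gr_internal I _ _ := by
    refine isInternal_of_scaling _ ((2 : ℚ) ^ ((Fintype.card I : ℤ) - 1) • LinearMap.id)
      (fun n x hx => ?_) (fun x => Submodule.mem_iSup_of_mem ((Fintype.card I : ℤ) - 1) ?_)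
    · rw [gr_eq] at hx
      split_ifs at hx with h
      · rw [h]; rfl
      · rw [(Submodule.mem_bot ℚ).1 hx]; simp
    · rw [gr_eq, if_pos rfl]; trivial
  par_apply I _ _ n x hx := by
    rw [gr_eq] at hx
    split_ifs at hx with h
    · rw [h]; rfl
    · rw [(Submodule.mem_bot ℚ).1 hx]; simp
  map_refl I _ _ := by
    refine LinearMap.ext fun x => toB_injective ?_
    rw [toB_map, BOperad.isOperad.map_refl]; rfl
  map_trans e f := by
    refine LinearMap.ext fun x => toB_injective ?_
    rw [LinearMap.comp_apply, toB_map, toB_map, toB_map, BOperad.isOperad.map_trans]; rfl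
  map_mem e n x hx := by
    apply mem_of_toB_mem
    rw [toB_map]
    exact BOperad.isOperad.map_mem e n _ (toB_mem_of_mem hx)
  one_mem := by
    apply mem_of_toB_mem
    rw [toB_one]
    exact BOperad.isOperad.one_mem
  comp_mem m n x hx y hy := by
    apply mem_of_toB_mem
    rw [toB_comp]
    exact BOperad.isOperad.comp_mem m n _ (toB_mem_of_mem hx) _ (toB_mem_of_mem hy)
  comp_map e f x y := by
    apply toB_injective
    rw [toB_comp, toB_map, toB_map, toB_map, toB_comp, BOperad.isOperad.comp_map]
  comp_one x := by
    apply toB_injective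
    rw [toB_comp, toB_map, toB_one, BOperad.isOperad.comp_one]
  one_comp y := by
    apply toB_injective
    rw [toB_comp, toB_map, toB_map, toB_one, BOperad.isOperad.one_comp]
  comp_comp x y z := by
    apply toB_injective
    rw [toB_map, toB_comp, toB_map, toB_comp, toB_comp, toB_comp, BOperad.isOperad.comp_comp]
  comp_comm m n x y hy z hz := by
    apply toB_injective
    rw [Units.smul_def, map_zsmul, toB_map, toB_comp, toB_map, toB_comp, toB_comp, toB_map,
      toB_comp, toB_map, BOperad.isOperad.comp_comm m n _ _ (toB_mem_of_mem hy) _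
      (toB_mem_of_mem hz), Units.smul_def]

end DetOperad

/-! ### Tensor products of operads -/

namespace PreOperad

variable {P Q R S : PreOperad} {I J K : Type} [Fintype I] [Fintype J] [Fintype K]

/-- The pure tensors of the tensor product of two operads. -/
def tm (P Q : PreOperad) (I : Type) [Fintype I] [Nonempty I] :
    P.obj I →ₗ[ℚ] Q.obj I →ₗ[ℚ] (P.tensor Q).obj I :=
  TensorProduct.mk ℚ (P.obj I) (Q.obj I)

@[elab_as_elim]
theorem tm_induction [Nonempty I] {C : (P.tensor Q).obj I → Prop} (x : (P.tensor Q).obj I)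
    (zero : C 0) (add : ∀ x y, C x → C y → C (x + y)) (tm : ∀ x y, C (tm P Q I x y)) : C x :=
  TensorProduct.induction_on (motive := C) x zero tm add

theorem tensor_par [Nonempty I] (x : P.obj I) (y : Q.obj I) :
    (P.tensor Q).par I (tm P Q I x y) = tm P Q I (P.par I x) (Q.par I y) := rfl

theorem tensor_map [Nonempty I] [Nonempty J] (e : I ≃ J) (x : P.obj I) (y : Q.obj I) :
    (P.tensor Q).map e (tm P Q I x y) = tm P Q J (P.map e x) (Q.map e y) := rfl

theorem tensor_one : (P.tensor Q).one = tm P Q Unit P.one Q.one := rfl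

theorem tensor_comp [Nonempty J] (x₁ : P.obj (Option I)) (x₂ : Q.obj (Option I)) (y₁ : P.obj J)
    (y₂ : Q.obj J) :
    (P.tensor Q).comp (tm P Q _ x₁ x₂) (tm P Q _ y₁ y₂) = (1 / 2 : ℚ) •
      (tm P Q _ (P.comp x₁ y₁) (Q.comp x₂ y₂) + tm P Q _ (P.comp x₁ y₁) (Q.comp (Q.par _ x₂) y₂) +
        tm P Q _ (P.comp x₁ (P.par _ y₁)) (Q.comp x₂ y₂) -
        tm P Q _ (P.comp x₁ (P.par _ y₁)) (Q.comp (Q.par _ x₂) y₂)) := rfl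

/-- For elements of definite parity, the half-sum of four terms collapses to the usual Koszul sign.
-/
theorem tensor_comp_of_sign [Nonempty J] {x₁ : P.obj (Option I)} {x₂ : Q.obj (Option I)}
    {y₁ : P.obj J} {y₂ : Q.obj J} {a b : ℤ} (hx : Q.par _ x₂ = a.negOnePow • x₂)
    (hy : P.par _ y₁ = b.negOnePow • y₁) :
    (P.tensor Q).comp (tm P Q _ x₁ x₂) (tm P Q _ y₁ y₂) =
      (a * b).negOnePow • tm P Q _ (P.comp x₁ y₁) (Q.comp x₂ y₂) := by
  rw [tensor_comp, hx, hy]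
  rcases Int.even_or_odd a with ha | ha <;> rcases Int.even_or_odd b with hb | hb
  · rw [Int.negOnePow_even _ ha, Int.negOnePow_even _ hb, Int.negOnePow_even _ (ha.mul_right b)]
    simp only [one_smul]
    module
  · rw [Int.negOnePow_even _ ha, Int.negOnePow_odd _ hb, Int.negOnePow_even _ (ha.mul_right b)]
    simp only [one_smul, Units.neg_smul, map_neg, LinearMap.neg_apply]
    module
  · rw [Int.negOnePow_odd _ ha, Int.negOnePow_even _ hb, Int.negOnePow_even _ (hb.mul_left a)]
    simp only [one_smul, Units.neg_smul, map_neg, LinearMap.neg_apply]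
    module
  · rw [Int.negOnePow_odd _ ha, Int.negOnePow_odd _ hb, Int.negOnePow_odd _ (ha.mul hb)]
    simp only [one_smul, Units.neg_smul, map_neg, LinearMap.neg_apply]
    module

/-- The tensor product of two linear maps between components of operads. -/
def tensorLin [Nonempty I] [Nonempty J] (f : P.obj I →ₗ[ℚ] R.obj J) (g : Q.obj I →ₗ[ℚ] S.obj J) :
    (P.tensor Q).obj I →ₗ[ℚ] (R.tensor S).obj J :=
  TensorProduct.map f g

@[simp] theorem tensorLin_tm [Nonempty I] [Nonempty J] (f : P.obj I →ₗ[ℚ] R.obj J)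
    (g : Q.obj I →ₗ[ℚ] S.obj J) (x : P.obj I) (y : Q.obj I) :
    tensorLin f g (tm P Q I x y) = tm R S J (f x) (g y) := rfl

theorem tm_mem [Nonempty I] {m n : ℤ} {x : P.obj I} {y : Q.obj I} (hx : x ∈ P.gr I m)
    (hy : y ∈ Q.gr I n) : tm P Q I x y ∈ (P.tensor Q).gr I (m + n) := by
  have hy' : y ∈ Q.gr I (m + n - m) := by rwa [add_sub_cancel_left]
  exact Submodule.mem_iSup_of_mem (p := fun k : ℤ => LinearMap.range
    (TensorProduct.map (P.gr I k).subtype (Q.gr I (m + n - k)).subtype)) m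
    ⟨⟨x, hx⟩ ⊗ₜ ⟨y, hy'⟩, rfl⟩

@[elab_as_elim]
theorem tensor_gr_induction [Nonempty I] {n : ℤ} {C : (P.tensor Q).obj I → Prop}
    {x : (P.tensor Q).obj I} (zero : C 0) (add : ∀ x y, C x → C y → C (x + y))
    (tm : ∀ k l, k + l = n → ∀ x ∈ P.gr I k, ∀ y ∈ Q.gr I l, C (tm P Q I x y))
    (hx : x ∈ (P.tensor Q).gr I n) : C x := by
  refine Submodule.iSup_induction (motive := C) (fun k : ℤ => LinearMap.range
    (TensorProduct.map (P.gr I k).subtype (Q.gr I (n - k)).subtype)) hx ?_ zero add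
  rintro k _ ⟨t, rfl⟩
  induction t using TensorProduct.induction_on with
  | zero => rw [map_zero]; exact zero
  | tmul a b => exact tm k (n - k) (by ring) a a.2 b b.2
  | add a b ha hb => rw [map_add]; exact add _ _ ha hb

/-! ### The axioms for a tensor product of operads -/

namespace IsOperad

@[elab_as_elim]
theorem gr_induction (hP : P.IsOperad) [Nonempty I] {C : P.obj I → Prop} (x : P.obj I)
    (add : ∀ x y, C x → C y → C (x + y)) (mem : ∀ n, ∀ x ∈ P.gr I n, C x) : C x := by
  have h := ((DirectSum.isInternal_submodule_iff_iSupIndep_and_iSup_eq_top _).1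
    (hP.gr_internal I)).2
  exact Submodule.iSup_induction (motive := C) (P.gr I) (h ▸ Submodule.mem_top) mem
    (mem 0 0 (Submodule.zero_mem _)) add

@[elab_as_elim]
theorem tm_gr_induction (hP : P.IsOperad) (hQ : Q.IsOperad) [Nonempty I]
    {C : (P.tensor Q).obj I → Prop} (x : (P.tensor Q).obj I) (zero : C 0)
    (add : ∀ x y, C x → C y → C (x + y))
    (tm : ∀ m n, ∀ x ∈ P.gr I m, ∀ y ∈ Q.gr I n, C (tm P Q I x y)) : C x := by
  induction x using tm_induction with
  | zero => exact zero
  | add x y hx hy => exact add _ _ hx hy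
  | tm x y =>
    induction x using hP.gr_induction with
    | add x x' hx hx' => rw [map_add, LinearMap.add_apply]; exact add _ _ hx hx'
    | mem m x hx =>
      induction y using hQ.gr_induction with
      | add y y' hy hy' => rw [map_add]; exact add _ _ hy hy'
      | mem n y hy => exact tm m n x hx y hy

/-- The operator of `P(I)` that acts by `2 ^ n` in degree `n`. -/
def scaling (hP : P.IsOperad) (I : Type) [Fintype I] [Nonempty I] : P.obj I →ₗ[ℚ] P.obj I :=
  (exists_scaling (hP.gr_internal I)).choose

theorem scaling_apply (hP : P.IsOperad) [Nonempty I] (n : ℤ) (x : P.obj I) (hx : x ∈ P.gr I n) :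
    hP.scaling I x = (2 : ℚ) ^ n • x :=
  (exists_scaling (hP.gr_internal I)).choose_spec n x hx

theorem tensor_scaling (hP : P.IsOperad) (hQ : Q.IsOperad) [Nonempty I] (n : ℤ)
    (x : (P.tensor Q).obj I) (hx : x ∈ (P.tensor Q).gr I n) :
    tensorLin (hP.scaling I) (hQ.scaling I) x = (2 : ℚ) ^ n • x := by
  refine tensor_gr_induction ?_ ?_ (fun k l hkl x hx y hy => ?_) hx
  · simp
  · intro x y hx hy; rw [map_add, hx, hy, smul_add]
  · rw [tensorLin_tm, hP.scaling_apply k x hx, hQ.scaling_apply l y hy, map_smul, map_smul,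
      LinearMap.smul_apply,
      smul_smul, ← hkl, zpow_add₀ two_ne_zero, mul_comm]

theorem tensor_par_apply (hP : P.IsOperad) (hQ : Q.IsOperad) [Nonempty I] (n : ℤ)
    (x : (P.tensor Q).obj I) (hx : x ∈ (P.tensor Q).gr I n) :
    (P.tensor Q).par I x = n.negOnePow • x := by
  refine tensor_gr_induction ?_ ?_ (fun k l hkl x hx y hy => ?_) hx
  · simp
  · intro x y hx hy; rw [map_add, hx, hy, smul_add]
  · rw [tensor_par, hP.par_apply I k x hx, hQ.par_apply I l y hy, ← hkl, Int.negOnePow_add]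
    simp only [Units.smul_def, map_zsmul, LinearMap.smul_apply, smul_smul, Units.val_mul]
    rw [mul_comm]

theorem tensor_comp_of_mem (hP : P.IsOperad) (hQ : Q.IsOperad) [Nonempty J] {a b : ℤ}
    (x₁ : P.obj (Option I)) {x₂ : Q.obj (Option I)} {y₁ : P.obj J} (y₂ : Q.obj J)
    (hx : x₂ ∈ Q.gr _ a) (hy : y₁ ∈ P.gr _ b) :
    (P.tensor Q).comp (tm P Q _ x₁ x₂) (tm P Q _ y₁ y₂) =
      (a * b).negOnePow • tm P Q _ (P.comp x₁ y₁) (Q.comp x₂ y₂) :=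
  tensor_comp_of_sign (hQ.par_apply _ _ _ hx) (hP.par_apply _ _ _ hy)

theorem map_units_smul {M N : Type} [AddCommGroup M] [Module ℚ M] [AddCommGroup N] [Module ℚ N]
    (f : M →ₗ[ℚ] N) (u : ℤˣ) (x : M) : f (u • x) = u • f x := by
  rw [Units.smul_def, Units.smul_def, map_zsmul]

theorem map₂_units_smul {L M N : Type} [AddCommGroup M] [Module ℚ M] [AddCommGroup N] [Module ℚ N]
    [AddCommGroup L] [Module ℚ L] (f : M →ₗ[ℚ] N →ₗ[ℚ] L) (u : ℤˣ) (x : M) (y : N) :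
    f (u • x) y = u • f x y := by
  rw [Units.smul_def, Units.smul_def, map_zsmul, LinearMap.smul_apply]

theorem tensor_comp_comm (hP : P.IsOperad) (hQ : Q.IsOperad) {I J K : Type} [Fintype I] [Fintype J]
    [Nonempty J] [Fintype K] [Nonempty K] (m n : ℤ) (x : (P.tensor Q).obj (Option (Option I)))
    (y : (P.tensor Q).obj J) (hy : y ∈ (P.tensor Q).gr J m) (z : (P.tensor Q).obj K)
    (hz : z ∈ (P.tensor Q).gr K n) :
    (P.tensor Q).comp ((P.tensor Q).map (starLeft I K) ((P.tensor Q).comp x z)) y =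
      (m * n).negOnePow • (P.tensor Q).map (sumExchange I J K) ((P.tensor Q).comp
        ((P.tensor Q).map (starLeft I J)
          ((P.tensor Q).comp ((P.tensor Q).map (starSwap I) x) y)) z) := by
  induction x using hP.tm_gr_induction hQ with
  | zero => simp
  | add x x' hx hx' => simp only [map_add, LinearMap.add_apply, hx, hx', smul_add]
  | tm a₁ a₂ x₁ hx₁ x₂ hx₂ =>
  refine tensor_gr_induction ?_ ?_ (fun b₁ b₂ hb y₁ hy₁ y₂ hy₂ => ?_) hy
  · simp
  · intro x x' hx hx'; simp only [map_add, LinearMap.add_apply, hx, hx', smul_add]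
  refine tensor_gr_induction ?_ ?_ (fun c₁ c₂ hc z₁ hz₁ z₂ hz₂ => ?_) hz
  · simp
  · intro x x' hx hx'; simp only [map_add, LinearMap.add_apply, hx, hx', smul_add]
  rw [hP.tensor_comp_of_mem hQ _ _ hx₂ hz₁, map_units_smul, tensor_map, map₂_units_smul,
    hP.tensor_comp_of_mem hQ _ _ (hQ.map_mem _ _ _ (hQ.comp_mem _ _ _ hx₂ _ hz₂)) hy₁,
    tensor_map, hP.tensor_comp_of_mem hQ _ _ (hQ.map_mem _ _ _ hx₂) hy₁, map_units_smul,
    tensor_map, map₂_units_smul, hP.tensor_comp_of_mem hQ _ _ (hQ.map_mem _ _ _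
    (hQ.comp_mem _ _ _ (hQ.map_mem _ _ _ hx₂) _ hy₂)) hz₁, map_units_smul, map_units_smul,
    tensor_map, hP.comp_comm b₁ c₁ _ _ hy₁ _ hz₁, hQ.comp_comm b₂ c₂ _ _ hy₂ _ hz₂,
    map₂_units_smul, map_units_smul]
  simp only [smul_smul, ← Int.negOnePow_add]
  congr 1
  rw [Int.negOnePow_eq_iff, ← hb, ← hc]
  -- After the exchange axioms of `P` and `Q` have been used, the exponents of the two sides differ
  -- by `2 * b₂ * c₁`.
  refine ⟨-(b₂ * c₁), ?_⟩
  ring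

theorem tensor_comp_comp (hP : P.IsOperad) (hQ : Q.IsOperad) {I J K : Type} [Fintype I] [Fintype J]
    [Fintype K] [Nonempty K] (x : (P.tensor Q).obj (Option I)) (y : (P.tensor Q).obj (Option J))
    (z : (P.tensor Q).obj K) :
    (P.tensor Q).map (Equiv.sumAssoc I J K) ((P.tensor Q).comp ((P.tensor Q).map (starRight I J)
      ((P.tensor Q).comp x y)) z) = (P.tensor Q).comp x ((P.tensor Q).comp y z) := by
  induction x using hP.tm_gr_induction hQ with
  | zero => simp
  | add x x' hx hx' => simp only [map_add, LinearMap.add_apply, hx, hx']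
  | tm a₁ a₂ x₁ hx₁ x₂ hx₂ =>
  induction y using hP.tm_gr_induction hQ with
  | zero => simp
  | add x x' hx hx' => simp only [map_add, LinearMap.add_apply, hx, hx']
  | tm b₁ b₂ y₁ hy₁ y₂ hy₂ =>
  induction z using hP.tm_gr_induction hQ with
  | zero => simp
  | add x x' hx hx' => simp only [map_add, hx, hx']
  | tm c₁ c₂ z₁ hz₁ z₂ hz₂ =>
  rw [hP.tensor_comp_of_mem hQ _ _ hx₂ hy₁, map_units_smul, tensor_map, map₂_units_smul,
    hP.tensor_comp_of_mem hQ _ _ (hQ.map_mem _ _ _ (hQ.comp_mem _ _ _ hx₂ _ hy₂)) hz₁,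
    hP.tensor_comp_of_mem hQ _ _ hy₂ hz₁, map_units_smul, map_units_smul, tensor_map,
    hP.comp_comp, hQ.comp_comp, map_units_smul,
    hP.tensor_comp_of_mem hQ _ _ hx₂ (hP.comp_mem _ _ _ hy₁ _ hz₁), smul_smul, smul_smul,
    ← Int.negOnePow_add, ← Int.negOnePow_add]
  congr 2
  ring

theorem tensor_comp_map (hP : P.IsOperad) (hQ : Q.IsOperad) {I I' J J' : Type} [Fintype I]
    [Fintype I']
    [Fintype J] [Nonempty J] [Fintype J'] [Nonempty J'] (e : I ≃ I') (f : J ≃ J')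
    (x : (P.tensor Q).obj (Option I)) (y : (P.tensor Q).obj J) :
    (P.tensor Q).comp ((P.tensor Q).map e.optionCongr x) ((P.tensor Q).map f y) =
      (P.tensor Q).map (e.sumCongr f) ((P.tensor Q).comp x y) := by
  induction x using hP.tm_gr_induction hQ with
  | zero => simp
  | add x x' hx hx' => simp only [map_add, LinearMap.add_apply, hx, hx']
  | tm m n x₁ hx₁ x₂ hx₂ =>
    induction y using hP.tm_gr_induction hQ with
    | zero => simp
    | add x x' hx hx' => simp only [map_add, hx, hx']
    | tm m' n' y₁ hy₁ y₂ hy₂ =>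
      rw [tensor_map, tensor_map, hP.tensor_comp_of_mem hQ _ _ (hQ.map_mem _ _ _ hx₂)
        (hP.map_mem _ _ _ hy₁), hP.tensor_comp_of_mem hQ _ _ hx₂ hy₁, map_units_smul, tensor_map,
        hP.comp_map, hQ.comp_map]

theorem tensor_comp_mem (hP : P.IsOperad) (hQ : Q.IsOperad) {I J : Type} [Fintype I] [Fintype J]
    [Nonempty J] (m n : ℤ) (x : (P.tensor Q).obj (Option I)) (hx : x ∈ (P.tensor Q).gr (Option I) m)
    (y : (P.tensor Q).obj J) (hy : y ∈ (P.tensor Q).gr J n) :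
    (P.tensor Q).comp x y ∈ (P.tensor Q).gr (I ⊕ J) (m + n) := by
  refine tensor_gr_induction ?_ ?_ (fun k l hkl x₁ hx₁ x₂ hx₂ => ?_) hx
  · rw [map_zero]; exact Submodule.zero_mem _
  · intro x x' hx hx'; rw [map_add]; exact Submodule.add_mem _ hx hx'
  refine tensor_gr_induction ?_ ?_ (fun k' l' hkl' y₁ hy₁ y₂ hy₂ => ?_) hy
  · rw [map_zero]; exact Submodule.zero_mem _
  · intro x x' hx hx'; rw [map_add]; exact Submodule.add_mem _ hx hx'
  rw [hP.tensor_comp_of_mem hQ _ _ hx₂ hy₁, ← hkl, ← hkl', add_add_add_comm, Units.smul_def]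
  exact zsmul_mem (tm_mem (hP.comp_mem _ _ _ hx₁ _ hy₁) (hQ.comp_mem _ _ _ hx₂ _ hy₂)) _

theorem tensor_gr_internal (hP : P.IsOperad) (hQ : Q.IsOperad) (I : Type) [Fintype I]
    [Nonempty I] : DirectSum.IsInternal ((P.tensor Q).gr I) := by
  refine isInternal_of_scaling _ _ (tensor_scaling hP hQ) fun x => ?_
  induction x using hP.tm_gr_induction hQ with
  | zero => exact Submodule.zero_mem _
  | add x y hx hy => exact Submodule.add_mem _ hx hy
  | tm m n x hx y hy => exact Submodule.mem_iSup_of_mem (m + n) (tm_mem hx hy)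

theorem tensor_map_refl (hP : P.IsOperad) (hQ : Q.IsOperad) (I : Type) [Fintype I]
    [Nonempty I] : (P.tensor Q).map (Equiv.refl I) = LinearMap.id := by
  refine LinearMap.ext fun x => ?_
  induction x using tm_induction with
  | zero => simp
  | add x y hx hy => rw [map_add, hx, hy, map_add]
  | tm x y => rw [tensor_map, hP.map_refl, hQ.map_refl]; rfl

theorem tensor_map_trans (hP : P.IsOperad) (hQ : Q.IsOperad) {I J K : Type} [Fintype I]
    [Nonempty I] [Fintype J] [Nonempty J] [Fintype K] [Nonempty K] (e : I ≃ J) (f : J ≃ K) :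
    (P.tensor Q).map (e.trans f) = (P.tensor Q).map f ∘ₗ (P.tensor Q).map e := by
  refine LinearMap.ext fun x => ?_
  induction x using tm_induction with
  | zero => simp
  | add x y hx hy => rw [map_add, hx, hy, map_add]
  | tm x y =>
    rw [tensor_map, hP.map_trans, hQ.map_trans, LinearMap.comp_apply, LinearMap.comp_apply,
      LinearMap.comp_apply, tensor_map, tensor_map]

theorem tensor_map_mem (hP : P.IsOperad) (hQ : Q.IsOperad) {I J : Type} [Fintype I]
    [Nonempty I] [Fintype J] [Nonempty J] (e : I ≃ J) (n : ℤ) (x : (P.tensor Q).obj I)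
    (hx : x ∈ (P.tensor Q).gr I n) : (P.tensor Q).map e x ∈ (P.tensor Q).gr J n := by
  refine tensor_gr_induction ?_ ?_ (fun k l hkl x hx y hy => ?_) hx
  · rw [map_zero]; exact Submodule.zero_mem _
  · intro x y hx hy; rw [map_add]; exact Submodule.add_mem _ hx hy
  · rw [tensor_map, ← hkl]; exact tm_mem (hP.map_mem e k x hx) (hQ.map_mem e l y hy)

theorem tensor_comp_one (hP : P.IsOperad) (hQ : Q.IsOperad) {I : Type} [Fintype I]
    (x : (P.tensor Q).obj (Option I)) : (P.tensor Q).comp x (P.tensor Q).one =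
      (P.tensor Q).map (Equiv.optionEquivSumPUnit I) x := by
  induction x using hP.tm_gr_induction hQ with
  | zero => simp
  | add x x' hx hx' => simp only [map_add, LinearMap.add_apply, hx, hx']
  | tm m n x₁ hx₁ x₂ hx₂ =>
    rw [tensor_one, hP.tensor_comp_of_mem hQ _ _ hx₂ hP.one_mem, tensor_map, hP.comp_one,
      hQ.comp_one, mul_zero, Int.negOnePow_zero, one_smul]

theorem tensor_one_comp (hP : P.IsOperad) (hQ : Q.IsOperad) {J : Type} [Fintype J] [Nonempty J]
    (y : (P.tensor Q).obj J) :
    (P.tensor Q).comp ((P.tensor Q).map (Equiv.ofUnique Unit (Option Empty)) (P.tensor Q).one) y =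
      (P.tensor Q).map (Equiv.emptySum Empty J).symm y := by
  induction y using hP.tm_gr_induction hQ with
  | zero => simp
  | add x x' hx hx' => simp only [map_add, hx, hx']
  | tm m n y₁ hy₁ y₂ hy₂ =>
    rw [tensor_one, tensor_map, hP.tensor_comp_of_mem hQ _ _ (hQ.map_mem _ _ _ hQ.one_mem) hy₁,
      tensor_map, hP.one_comp, hQ.one_comp, zero_mul, Int.negOnePow_zero, one_smul]

theorem tensor (hP : P.IsOperad) (hQ : Q.IsOperad) : (P.tensor Q).IsOperad where
  gr_internal := hP.tensor_gr_internal hQ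
  par_apply _ _ _ := hP.tensor_par_apply hQ
  map_refl := hP.tensor_map_refl hQ
  map_trans := hP.tensor_map_trans hQ
  map_mem := hP.tensor_map_mem hQ
  one_mem := by
    have h := tm_mem hP.one_mem hQ.one_mem
    rw [add_zero] at h
    exact h
  comp_mem := hP.tensor_comp_mem hQ
  comp_map := hP.tensor_comp_map hQ
  comp_one := hP.tensor_comp_one hQ
  one_comp := hP.tensor_one_comp hQ
  comp_comp := hP.tensor_comp_comp hQ
  comp_comm := hP.tensor_comp_comm hQ

end IsOperad

/-- The operad `P` with the degrees `n` of `P(I)` replaced by `2|I| - 2 - n`. -/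
def regrade (P : PreOperad) : PreOperad :=
  { P with gr := fun I _ _ n => P.gr I (2 * (Fintype.card I : ℤ) - 2 - n) }

theorem negOnePow_regrade (c n : ℤ) : (2 * c - 2 - n).negOnePow = n.negOnePow := by
  rw [Int.negOnePow_eq_iff]
  exact ⟨c - 1 - n, by ring⟩

theorem regrade_mem [Nonempty I] {n : ℤ} {x : P.regrade.obj I} :
    x ∈ P.regrade.gr I n ↔ x ∈ P.gr I (2 * (Fintype.card I : ℤ) - 2 - n) := Iff.rfl

/-- The substitution `n ↦ 2|I| - 2 - n` is a bijection of `ℤ` that preserves parity, hence all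
signs. It is compatible with composition because the number of inputs minus one is additive. -/
theorem IsOperad.regrade (h : P.IsOperad) : P.regrade.IsOperad := by
  refine ⟨fun I _ _ => ?_, fun I _ _ n x hx => ?_, h.map_refl, h.map_trans, fun e n x hx => ?_,
    h.one_mem, fun m n x hx y hy => ?_, h.comp_map, h.comp_one, h.one_comp, h.comp_comp,
    fun {I J K} _ _ _ _ _ m n x y hy z hz => ?_⟩
  · refine (DirectSum.isInternal_submodule_iff_iSupIndep_and_iSup_eq_top _).2 ?_
    obtain ⟨h1, h2⟩ := (DirectSum.isInternal_submodule_iff_iSupIndep_and_iSup_eq_top _).1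
      (h.gr_internal I)
    let e : ℤ ≃ ℤ := Equiv.subLeft (2 * (Fintype.card I : ℤ) - 2)
    exact ⟨h1.comp e.injective, (e.iSup_comp (g := P.gr I)).trans h2⟩
  · have := h.par_apply I _ x hx
    rw [negOnePow_regrade] at this
    exact this
  · have := h.map_mem e _ x hx
    rw [Fintype.card_congr e] at this
    exact this
  · have := h.comp_mem _ _ x hx y hy
    rw [regrade_mem]
    have e : ∀ (I J : Type) [Fintype I] [Fintype J], 2 * (Fintype.card (I ⊕ J) : ℤ) - 2 - (m + n) =
        2 * (Fintype.card (Option I) : ℤ) - 2 - m + (2 * (Fintype.card J : ℤ) - 2 - n) := by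
      intro I J _ _
      simp only [Fintype.card_sum, Fintype.card_option]
      push_cast
      ring
    rw [e]
    exact this
  · have := h.comp_comm _ _ x y hy z hz
    have e : ((2 * (Fintype.card J : ℤ) - 2 - m) * (2 * (Fintype.card K : ℤ) - 2 - n)).negOnePow =
        (m * n).negOnePow := by
      rw [Int.negOnePow_eq_iff]
      refine ⟨(Fintype.card J - 1) * (2 * Fintype.card K - 2 - n) - m * (Fintype.card K - 1), ?_⟩
      ring
    rw [e] at this
    exact this

end PreOperad

theorem Bess.isOperad : Bess.IsOperad :=
  (DetOperad.isOperad.tensor BOperad.isOperad).regrade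

/-! ### Morphisms that need not respect the degrees -/

namespace PreOperad

/-- Families of linear maps that respect the structure of operads in super vector spaces, i.e.
all the structure except the degrees. -/
structure SuperHom (P Q : PreOperad) where
  app : (I : Type) → [Fintype I] → [Nonempty I] → P.obj I →ₗ[ℚ] Q.obj I
  app_par : ∀ (I : Type) [Fintype I] [Nonempty I] (x : P.obj I),
    app I (P.par I x) = Q.par I (app I x)
  app_map : ∀ {I J : Type} [Fintype I] [Nonempty I] [Fintype J] [Nonempty J] (e : I ≃ J)
    (x : P.obj I), app J (P.map e x) = Q.map e (app I x)
  app_one : app Unit P.one = Q.one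
  app_comp : ∀ {I J : Type} [Fintype I] [Fintype J] [Nonempty J] (x : P.obj (Option I))
    (y : P.obj J), app (I ⊕ J) (P.comp x y) = Q.comp (app (Option I) x) (app J y)

/-- The sign operators of `P` are involutions. -/
def ParInvolutive (P : PreOperad) : Prop :=
  ∀ (I : Type) [Fintype I] [Nonempty I] (x : P.obj I), P.par I (P.par I x) = x

variable {P Q R S : PreOperad} {I J K : Type} [Fintype I] [Fintype J] [Fintype K]

theorem IsOperad.parInvolutive (hP : P.IsOperad) : P.ParInvolutive := by
  intro I _ _ x
  induction x using hP.gr_induction with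
  | add x y hx hy => simp only [map_add, hx, hy]
  | mem n x hx =>
    rw [hP.par_apply I n x hx, IsOperad.map_units_smul, hP.par_apply I n x hx, smul_smul,
      ← Int.negOnePow_add, Int.negOnePow_even _ (Even.add_self n), one_smul]

theorem ParInvolutive.tensor (hP : P.ParInvolutive) (hQ : Q.ParInvolutive) :
    (P.tensor Q).ParInvolutive := by
  intro I _ _ x
  induction x using tm_induction with
  | zero => simp
  | add x y hx hy => simp only [map_add, hx, hy]
  | tm x y => rw [tensor_par, tensor_par, hP, hQ]

@[elab_as_elim]
-- The decomposition into even and odd parts needs only the sign operator, so it is available for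
-- the ambient exterior algebras, where the degrees play no role.
theorem ParInvolutive.induction (hP : P.ParInvolutive) [Nonempty I] {C : P.obj I → Prop}
    (x : P.obj I) (add : ∀ x y, C x → C y → C (x + y))
    (sign : ∀ (n : ℤ) (x : P.obj I), P.par I x = n.negOnePow • x → C x) : C x := by
  have h : x = (1 / 2 : ℚ) • (x + P.par I x) + (1 / 2 : ℚ) • (x - P.par I x) := by module
  rw [h]
  refine add _ _ (sign 0 _ ?_) (sign 1 _ ?_)
  · rw [map_smul, map_add, hP, Int.negOnePow_zero, one_smul, add_comm]
  · rw [map_smul, map_sub, hP, Int.negOnePow_one, Units.neg_smul, one_smul, ← smul_neg, neg_sub]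

theorem par_tm [Nonempty I] {x : P.obj I} {y : Q.obj I} {m n : ℤ}
    (hx : P.par I x = m.negOnePow • x) (hy : Q.par I y = n.negOnePow • y) :
    (P.tensor Q).par I (tm P Q I x y) = (m + n).negOnePow • tm P Q I x y := by
  rw [tensor_par, hx, hy, IsOperad.map_units_smul, IsOperad.map₂_units_smul, smul_smul,
    ← Int.negOnePow_add, add_comm]

/-! ### Constructions with morphisms: products, inverses, corestriction, symmetries -/

namespace SuperHom

/-- Composition of morphisms. -/
def trans (φ : SuperHom P Q) (ψ : SuperHom Q R) : SuperHom P R where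
  app I _ _ := ψ.app I ∘ₗ φ.app I
  app_par I _ _ x := by simp only [LinearMap.comp_apply, φ.app_par, ψ.app_par]
  app_map e x := by simp only [LinearMap.comp_apply, φ.app_map, ψ.app_map]
  app_one := by simp only [LinearMap.comp_apply, φ.app_one, ψ.app_one]
  app_comp x y := by simp only [LinearMap.comp_apply, φ.app_comp, ψ.app_comp]

theorem trans_app [Nonempty I] (φ : SuperHom P Q) (ψ : SuperHom Q R) (x : P.obj I) :
    (φ.trans ψ).app I x = ψ.app I (φ.app I x) := rfl

/-- The identity. -/
def refl (P : PreOperad) : SuperHom P P where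
  app _ _ _ := LinearMap.id
  app_par _ _ _ _ := rfl
  app_map _ _ := rfl
  app_one := rfl
  app_comp _ _ := rfl

@[simp] theorem refl_app [Nonempty I] (x : P.obj I) : (refl P).app I x = x := rfl

/-- The tensor product of two morphisms. -/
def tensor (φ : SuperHom P R) (ψ : SuperHom Q S) : SuperHom (P.tensor Q) (R.tensor S) where
  app I _ _ := tensorLin (φ.app I) (ψ.app I)
  app_par I _ _ x := by
    induction x using tm_induction with
    | zero => simp
    | add x y hx hy => simp only [map_add, hx, hy]
    | tm x y => rw [tensor_par, tensorLin_tm, tensorLin_tm, tensor_par, φ.app_par, ψ.app_par]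
  app_map e x := by
    induction x using tm_induction with
    | zero => simp
    | add x y hx hy => simp only [map_add, hx, hy]
    | tm x y => rw [tensor_map, tensorLin_tm, tensorLin_tm, tensor_map, φ.app_map, ψ.app_map]
  app_one := by
    rw [tensor_one, tensorLin_tm, φ.app_one, ψ.app_one, tensor_one]
  app_comp x y := by
    induction x using tm_induction with
    | zero => simp
    | add x y hx hy => simp only [map_add, LinearMap.add_apply, hx, hy]
    | tm x₁ x₂ =>
      induction y using tm_induction with
      | zero => simp
      | add x y hx hy => simp only [map_add, hx, hy]
      | tm y₁ y₂ =>
        simp only [tensor_comp, map_smul, map_add, map_sub, tensorLin_tm, φ.app_comp, ψ.app_comp,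
          φ.app_par, ψ.app_par]

@[simp] theorem tensor_app_tm [Nonempty I] (φ : SuperHom P R) (ψ : SuperHom Q S) (x : P.obj I)
    (y : Q.obj I) :
    (φ.tensor ψ).app I (tm P Q I x y) = tm R S I (φ.app I x) (ψ.app I y) := rfl

/-- The inverse of a bijective morphism. -/
def symm (φ : SuperHom P Q)
    (h : ∀ (I : Type) [Fintype I] [Nonempty I], Function.Bijective (φ.app I)) : SuperHom Q P where
  app I _ _ := (LinearEquiv.ofBijective (φ.app I) (h I)).symm.toLinearMap
  app_par I _ _ x := by
    obtain ⟨x, rfl⟩ := (LinearEquiv.ofBijective (φ.app I) (h I)).surjective x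
    apply (LinearEquiv.ofBijective (φ.app I) (h I)).injective
    simp [φ.app_par]
  app_map {I J} _ _ _ _ e x := by
    obtain ⟨x, rfl⟩ := (LinearEquiv.ofBijective (φ.app I) (h I)).surjective x
    apply (LinearEquiv.ofBijective (φ.app J) (h J)).injective
    simp [φ.app_map]
  app_one := by
    apply (LinearEquiv.ofBijective (φ.app Unit) (h Unit)).injective
    simp [φ.app_one]
  app_comp {I J} _ _ _ x y := by
    obtain ⟨x, rfl⟩ := (LinearEquiv.ofBijective (φ.app (Option I)) (h (Option I))).surjective x
    obtain ⟨y, rfl⟩ := (LinearEquiv.ofBijective (φ.app J) (h J)).surjective y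
    apply (LinearEquiv.ofBijective (φ.app (I ⊕ J)) (h (I ⊕ J))).injective
    simp [φ.app_comp]

theorem symm_app [Nonempty I] (φ : SuperHom P Q)
    (h : ∀ (I : Type) [Fintype I] [Nonempty I], Function.Bijective (φ.app I)) (x : P.obj I) :
    (φ.symm h).app I (φ.app I x) = x :=
  (LinearEquiv.ofBijective (φ.app I) (h I)).symm_apply_apply x

/-- The corestriction of a morphism along an injective morphism. -/
def lift (φ : SuperHom P R) (i : SuperHom Q R)
    (hi : ∀ (I : Type) [Fintype I] [Nonempty I], Function.Injective (i.app I))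
    (h : ∀ (I : Type) [Fintype I] [Nonempty I] (x : P.obj I), φ.app I x ∈ (i.app I).range) :
    SuperHom P Q :=
  have key : ∀ (I : Type) [Fintype I] [Nonempty I] (x : P.obj I),
      i.app I ((LinearEquiv.ofInjective (i.app I) (hi I)).symm
        ((φ.app I).codRestrict _ (h I) x)) = φ.app I x := fun I _ _ x =>
    congrArg Subtype.val ((LinearEquiv.ofInjective (i.app I) (hi I)).apply_symm_apply
      ((φ.app I).codRestrict _ (h I) x))
  { app := fun I _ _ => (LinearEquiv.ofInjective (i.app I) (hi I)).symm.toLinearMap ∘ₗ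
      (φ.app I).codRestrict _ (h I)
    app_par := fun I _ _ x => hi I (by
      rw [i.app_par]
      exact (key I _).trans ((φ.app_par I x).trans (congrArg _ (key I x).symm)))
    app_map := fun {I J} _ _ _ _ e x => hi J (by
      rw [i.app_map]
      exact (key J _).trans ((φ.app_map e x).trans (congrArg _ (key I x).symm)))
    app_one := hi Unit (by
      rw [i.app_one]
      exact (key Unit _).trans φ.app_one)
    app_comp := fun {I J} _ _ _ x y => hi (I ⊕ J) (by
      rw [i.app_comp]
      exact (key _ _).trans ((φ.app_comp x y).trans
        (congrArg₂ (fun a b => R.comp a b) (key _ x).symm (key _ y).symm))) }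

theorem lift_app [Nonempty I] (φ : SuperHom P R) (i : SuperHom Q R)
    (hi : ∀ (I : Type) [Fintype I] [Nonempty I], Function.Injective (i.app I))
    (h : ∀ (I : Type) [Fintype I] [Nonempty I] (x : P.obj I), φ.app I x ∈ (i.app I).range)
    (x : P.obj I) : i.app I ((φ.lift i hi h).app I x) = φ.app I x :=
  congrArg Subtype.val ((LinearEquiv.ofInjective (i.app I) (hi I)).apply_symm_apply
      ((φ.app I).codRestrict _ (h I) x))

/-- The associator, as a linear equivalence. -/
def assocEquiv (P Q R : PreOperad) (I : Type) [Fintype I] [Nonempty I] :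
    ((P.tensor Q).tensor R).obj I ≃ₗ[ℚ] (P.tensor (Q.tensor R)).obj I :=
  TensorProduct.assoc ℚ (P.obj I) (Q.obj I) (R.obj I)

@[simp] theorem assocEquiv_tm [Nonempty I] (x : P.obj I) (y : Q.obj I) (z : R.obj I) :
    assocEquiv P Q R I (tm _ R I (tm P Q I x y) z) = tm P _ I x (tm Q R I y z) := rfl

@[elab_as_elim]
theorem tm₃_induction [Nonempty I] {C : ((P.tensor Q).tensor R).obj I → Prop}
    (x : ((P.tensor Q).tensor R).obj I) (zero : C 0) (add : ∀ x y, C x → C y → C (x + y))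
    (tm : ∀ x y z, C (tm _ R I (tm P Q I x y) z)) : C x := by
  induction x using tm_induction with
  | zero => exact zero
  | add x y hx hy => exact add _ _ hx hy
  | tm x z =>
    induction x using tm_induction with
    | zero => rw [map_zero]; exact zero
    | add x y hx hy => rw [map_add]; exact add _ _ hx hy
    | tm x y => exact tm x y z

/-- The associator of tensor products of operads. -/
def assoc (hP : P.ParInvolutive) (hQ : Q.ParInvolutive) (hR : R.ParInvolutive) :
    SuperHom ((P.tensor Q).tensor R) (P.tensor (Q.tensor R)) where
  app I _ _ := (assocEquiv P Q R I).toLinearMap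
  app_par I _ _ x := by
    induction x using tm₃_induction with
    | zero => simp
    | add x y hx hy => simp only [map_add, hx, hy]
    | tm x y z => simp only [tensor_par, LinearEquiv.coe_coe, assocEquiv_tm]
  app_map e x := by
    induction x using tm₃_induction with
    | zero => simp
    | add x y hx hy => simp only [map_add, hx, hy]
    | tm x y z => simp only [tensor_map, LinearEquiv.coe_coe, assocEquiv_tm]
  app_one := rfl
  app_comp x y := by
    induction x using tm₃_induction with
    | zero => simp
    | add x y hx hy => simp only [map_add, LinearMap.add_apply, hx, hy]
    | tm x₁ x₂ x₃ =>
    induction y using tm₃_induction with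
    | zero => simp
    | add x y hx hy => simp only [map_add, hx, hy]
    | tm y₁ y₂ y₃ =>
    induction x₂ using hQ.induction with
    | add x y hx hy => simp only [map_add, LinearMap.add_apply, hx, hy]
    | sign a₂ x₂ hx₂ =>
    induction x₃ using hR.induction with
    | add x y hx hy => simp only [map_add, LinearMap.add_apply, hx, hy]
    | sign a₃ x₃ hx₃ =>
    induction y₁ using hP.induction with
    | add x y hx hy => simp only [map_add, LinearMap.add_apply, hx, hy]
    | sign b₁ y₁ hy₁ =>
    induction y₂ using hQ.induction with
    | add x y hx hy => simp only [map_add, LinearMap.add_apply, hx, hy]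
    | sign b₂ y₂ hy₂ =>
    rw [tensor_comp_of_sign hx₃ (par_tm hy₁ hy₂), tensor_comp_of_sign hx₂ hy₁,
      IsOperad.map₂_units_smul, IsOperad.map_units_smul, IsOperad.map_units_smul]
    simp only [LinearEquiv.coe_coe, assocEquiv_tm]
    rw [tensor_comp_of_sign (par_tm hx₂ hx₃) hy₁, tensor_comp_of_sign hx₃ hy₂,
      IsOperad.map_units_smul, smul_smul, smul_smul, ← Int.negOnePow_add, ← Int.negOnePow_add]
    congr 2
    ring

/-- The operator that acts by `2 ^ n` in degree `n`, as an endomorphism. -/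
def scaling (hP : P.IsOperad) : SuperHom P P where
  app I _ _ := hP.scaling I
  app_par I _ _ x := by
    induction x using hP.gr_induction with
    | add x y hx hy => simp only [map_add, hx, hy]
    | mem n x hx =>
      rw [hP.par_apply I n x hx, hP.scaling_apply n x hx, IsOperad.map_units_smul, map_smul,
        hP.par_apply I n x hx, hP.scaling_apply n x hx, smul_comm]
  app_map e x := by
    induction x using hP.gr_induction with
    | add x y hx hy => simp only [map_add, hx, hy]
    | mem n x hx =>
      rw [hP.scaling_apply n x hx, hP.scaling_apply n _ (hP.map_mem e n x hx), map_smul]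
  app_one := by
    rw [hP.scaling_apply 0 _ hP.one_mem]
    simp
  app_comp x y := by
    induction x using hP.gr_induction with
    | add x y hx hy => simp only [map_add, LinearMap.add_apply, hx, hy]
    | mem m x hx =>
      induction y using hP.gr_induction with
      | add x y hx hy => simp only [map_add, hx, hy]
      | mem n y hy =>
        rw [hP.scaling_apply _ _ (hP.comp_mem m n x hx y hy), hP.scaling_apply m x hx,
          hP.scaling_apply n y hy, map_smul, map_smul, LinearMap.smul_apply, smul_smul,
          zpow_add₀ two_ne_zero, mul_comm]

/-- The Koszul symmetry of `P ⊗ P`, as a linear map. -/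
def swapLin (P : PreOperad) (I : Type) [Fintype I] [Nonempty I] :
    (P.tensor P).obj I →ₗ[ℚ] (P.tensor P).obj I :=
  P.koszulSwap I

theorem swapLin_tm [Nonempty I] (x y : P.obj I) :
    swapLin P I (tm P P I x y) = (1 / 2 : ℚ) • (tm P P I y x + tm P P I y (P.par I x) +
      tm P P I (P.par I y) x - tm P P I (P.par I y) (P.par I x)) := by
  change (TensorProduct.comm ℚ (P.obj I) (P.obj I)) ((1 / 2 : ℚ) • (x ⊗ₜ[ℚ] y +
    P.par I x ⊗ₜ[ℚ] y + x ⊗ₜ[ℚ] P.par I y - P.par I x ⊗ₜ[ℚ] P.par I y)) = _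
  rw [map_smul, map_sub, map_add, map_add]
  rfl

theorem swapLin_of_sign [Nonempty I] {x y : P.obj I} {m n : ℤ}
    (hx : P.par I x = m.negOnePow • x) (hy : P.par I y = n.negOnePow • y) :
    swapLin P I (tm P P I x y) = (m * n).negOnePow • tm P P I y x := by
  rw [swapLin_tm, hx, hy]
  rcases Int.even_or_odd m with ha | ha <;> rcases Int.even_or_odd n with hb | hb
  · rw [Int.negOnePow_even _ ha, Int.negOnePow_even _ hb, Int.negOnePow_even _ (ha.mul_right n)]
    simp only [one_smul]
    module
  · rw [Int.negOnePow_even _ ha, Int.negOnePow_odd _ hb, Int.negOnePow_even _ (ha.mul_right n)]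
    simp only [one_smul, Units.neg_smul, map_neg, LinearMap.neg_apply]
    module
  · rw [Int.negOnePow_odd _ ha, Int.negOnePow_even _ hb, Int.negOnePow_even _ (hb.mul_left m)]
    simp only [one_smul, Units.neg_smul, map_neg]
    module
  · rw [Int.negOnePow_odd _ ha, Int.negOnePow_odd _ hb, Int.negOnePow_odd _ (ha.mul hb)]
    simp only [one_smul, Units.neg_smul, map_neg, LinearMap.neg_apply]
    module

theorem swapLin_of_mem (hP : P.IsOperad) [Nonempty I] {x y : P.obj I} {m n : ℤ}
    (hx : x ∈ P.gr I m) (hy : y ∈ P.gr I n) :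
    swapLin P I (tm P P I x y) = (m * n).negOnePow • tm P P I y x :=
  swapLin_of_sign (hP.par_apply I m x hx) (hP.par_apply I n y hy)

/-- The Koszul symmetry of the operad `P ⊗ P`. -/
def swap (hP : P.IsOperad) : SuperHom (P.tensor P) (P.tensor P) where
  app I _ _ := swapLin P I
  app_par I _ _ x := by
    induction x using hP.tm_gr_induction hP with
    | zero => simp
    | add x y hx hy => simp only [map_add, hx, hy]
    | tm m n x hx y hy =>
      rw [par_tm (hP.par_apply I m x hx) (hP.par_apply I n y hy), IsOperad.map_units_smul,
        swapLin_of_mem hP hx hy, IsOperad.map_units_smul,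
        par_tm (hP.par_apply I n y hy) (hP.par_apply I m x hx), smul_comm, add_comm]
  app_map e x := by
    induction x using hP.tm_gr_induction hP with
    | zero => simp
    | add x y hx hy => simp only [map_add, hx, hy]
    | tm m n x hx y hy =>
      rw [tensor_map, swapLin_of_mem hP hx hy, IsOperad.map_units_smul, tensor_map,
        swapLin_of_mem hP (hP.map_mem e m x hx) (hP.map_mem e n y hy)]
  app_one := by
    rw [tensor_one, swapLin_of_mem hP hP.one_mem hP.one_mem]
    simp
  app_comp x y := by
    induction x using hP.tm_gr_induction hP with
    | zero => simp
    | add x y hx hy => simp only [map_add, LinearMap.add_apply, hx, hy]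
    | tm a₁ a₂ x₁ hx₁ x₂ hx₂ =>
    induction y using hP.tm_gr_induction hP with
    | zero => simp
    | add x y hx hy => simp only [map_add, hx, hy]
    | tm b₁ b₂ y₁ hy₁ y₂ hy₂ =>
    rw [hP.tensor_comp_of_mem hP _ _ hx₂ hy₁, IsOperad.map_units_smul,
      swapLin_of_mem hP (hP.comp_mem _ _ _ hx₁ _ hy₁) (hP.comp_mem _ _ _ hx₂ _ hy₂),
      swapLin_of_mem hP hx₁ hx₂, swapLin_of_mem hP hy₁ hy₂, IsOperad.map_units_smul,
      IsOperad.map₂_units_smul, hP.tensor_comp_of_mem hP _ _ hx₁ hy₂, smul_smul, smul_smul,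
      smul_smul, ← Int.negOnePow_add, ← Int.negOnePow_add, ← Int.negOnePow_add]
    congr 1
    rw [Int.negOnePow_eq_iff]
    refine ⟨a₂ * b₁, ?_⟩
    ring

end SuperHom

/-- A morphism of operads commutes with the sign operators. -/
def Hom.toSuperHom (hP : P.IsOperad) (hQ : Q.IsOperad) (φ : Hom P Q) : SuperHom P Q where
  app := φ.app
  app_par I _ _ x := by
    induction x using hP.gr_induction with
    | add x y hx hy => simp only [map_add, hx, hy]
    | mem n x hx =>
      rw [hP.par_apply I n x hx, hQ.par_apply I n _ (φ.app_mem I n x hx), IsOperad.map_units_smul]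
  app_map := φ.app_map
  app_one := φ.app_one
  app_comp := φ.app_comp

end PreOperad

/-! ### Generators of the Bessel operad -/

section ForestGeneration

variable {I J : Type}

theorem leaves_ne_zero (T : BinTree I) : T.leaves ≠ 0 := by
  induction T using BinTree.induction with
  | leaf i => simp
  | vee S T hS hT => simp [leaves_vee, hS]

theorem exists_map_relabel_eq (f : I → J) : ∀ L : List (BinTree J),
    (∀ j ∈ (L.map leaves).sum, ∃ i, f i = j) → ∃ L' : List (BinTree I), L'.map (relabel f) = L
  | [], _ => ⟨[], rfl⟩
  | T :: L, h => by
    rw [List.map_cons, List.sum_cons] at h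
    obtain ⟨S, rfl⟩ := exists_relabel_eq f T fun j hj => h j (Multiset.mem_add.2 (Or.inl hj))
    obtain ⟨L', rfl⟩ := exists_map_relabel_eq f L fun j hj => h j (Multiset.mem_add.2 (Or.inr hj))
    exact ⟨S :: L', rfl⟩

theorem sum_leaves_map_relabel (f : I → J) (L : List (BinTree I)) :
    ((L.map (relabel f)).map leaves).sum = (L.map leaves).sum.map f := by
  induction L with
  | nil => rfl
  | cons T L ih => simp only [List.map_cons, List.sum_cons, leaves_relabel, ih, Multiset.map_add]

theorem exists_sum_equiv [Fintype I] {m m' : Multiset I}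
    (h : m + m' = (Finset.univ : Finset I).val) :
    ∃ e : {i // i ∈ m} ⊕ {i // i ∈ m'} ≃ I,
      e ∘ Sum.inl = Subtype.val ∧ e ∘ Sum.inr = Subtype.val := by
  have hn : (m + m').Nodup := h ▸ Finset.univ.nodup
  have hd := (Multiset.nodup_add.1 hn).2.2
  refine ⟨Equiv.ofBijective (Sum.elim Subtype.val Subtype.val) ⟨?_, fun i => ?_⟩, rfl, rfl⟩
  · rintro (⟨i, hi⟩ | ⟨i, hi⟩) (⟨j, hj⟩ | ⟨j, hj⟩) hij
    · exact congrArg Sum.inl (Subtype.ext hij)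
    · obtain rfl : i = j := hij
      exact (Multiset.disjoint_left.1 hd hi hj).elim
    · obtain rfl : i = j := hij
      exact (Multiset.disjoint_left.1 hd hj hi).elim
    · exact congrArg Sum.inr (Subtype.ext hij)
  · have : i ∈ m + m' := h ▸ Finset.mem_univ i
    rcases Multiset.mem_add.1 this with hi | hi
    · exact ⟨Sum.inl ⟨i, hi⟩, rfl⟩
    · exact ⟨Sum.inr ⟨i, hi⟩, rfl⟩

/-- A part of a forest is an operation on its own set of labels; this is what allows a forest to be
written as a composite of smaller ones. -/
theorem exists_forest_on_support {m : Multiset I} [Fintype {i // i ∈ m}] (hm : m.Nodup)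
    (L : List (BinTree I)) (hL : (L.map leaves).sum = m) :
    ∃ L' : List (BinTree {i // i ∈ m}), L'.map (relabel Subtype.val) = L ∧
      (L'.map leaves).sum = (Finset.univ : Finset {i // i ∈ m}).val := by
  obtain ⟨L', rfl⟩ := exists_map_relabel_eq (Subtype.val : {i // i ∈ m} → I) L
    fun j hj => ⟨⟨j, hL ▸ hj⟩, rfl⟩
  refine ⟨L', rfl, ?_⟩
  rw [sum_leaves_map_relabel] at hL
  apply Multiset.map_injective Subtype.val_injective
  rw [hL]
  refine (Multiset.Nodup.ext hm
    ((Multiset.nodup_map_iff_of_injective Subtype.val_injective).2 Finset.univ.nodup)).2 fun i => ?_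
  simp

/-- Families of subspaces of the exterior algebras of trees that are stable under relabelling and
composition and contain the unit and the generators of `B`. -/
structure IsForestIdeal
    (K : (I : Type) → [Fintype I] → [Nonempty I] →
      Submodule ℚ (ExteriorAlgebra ℚ (BinTree I →₀ ℚ))) : Prop where
  map : ∀ {I J : Type} [Fintype I] [Nonempty I] [Fintype J] [Nonempty J] (e : I ≃ J),
    ∀ a ∈ K I, forestMap e a ∈ K J
  comp : ∀ {I J : Type} [Fintype I] [Fintype J] [Nonempty J], ∀ a ∈ K (Option I), ∀ b ∈ K J,
    forestComp I J a b ∈ K (I ⊕ J)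
  one : tree (leaf ()) ∈ K Unit
  wedge : tree (leaf 0) * tree (leaf 1) ∈ K (Fin 2)
  vee : tree ((leaf 0).vee (leaf 1)) ∈ K (Fin 2)

/-- The bijection `0 ↦ ⋆, 1 ↦ #`. -/
def finTwoEquivStars : Fin 2 ≃ Option (Option Empty) where
  toFun i := if i = 0 then some none else none
  invFun o := o.elim 1 fun _ => 0
  left_inv := by decide
  right_inv := by rintro (_ | _ | x); exacts [rfl, rfl, x.elim]

/-- The bijection `{⋆} ⊔ I ≃ I ⊔ {⋆}`. -/
def starSumEquiv (I : Type) : Option Empty ⊕ I ≃ Option I where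
  toFun := Sum.elim (fun _ => none) some
  invFun o := o.elim (.inl none) .inr
  left_inv := by rintro ((_ | x) | i); exacts [rfl, x.elim, rfl]
  right_inv := by rintro (_ | i) <;> rfl

namespace IsForestIdeal

variable {K : (I : Type) → [Fintype I] → [Nonempty I] →
  Submodule ℚ (ExteriorAlgebra ℚ (BinTree I →₀ ℚ))} [Fintype I] [Nonempty I] [Fintype J]
  [Nonempty J]

/-- Substitute `S`, then `b`, in the two leaves of `0 ∧ 1`. The composition rule applies to the last
factor, so the factors are exchanged in between; the resulting sign does not matter in a subspace.
-/
theorem mul_mem (hK : IsForestIdeal K) {S : BinTree I} {b : ExteriorAlgebra ℚ (BinTree J →₀ ℚ)}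
    (hS : tree S ∈ K I) (hb : b ∈ K J) :
    tree (relabel Sum.inl S) * forestMap Sum.inr b ∈ K (I ⊕ J) := by
  have h1 := hK.map finTwoEquivStars _ hK.wedge
  rw [map_mul, forestMap_tree, forestMap_tree] at h1
  have h2 := hK.comp _ h1 _ hS
  rw [show tree (relabel finTwoEquivStars (leaf 0)) = forestMap some (tree (leaf none)) by
    rw [forestMap_tree]; rfl] at h2
  rw [show tree (relabel finTwoEquivStars (leaf 1)) = tree (leaf none) from rfl,
    forestComp_mul_tree, subst_leaf_none, forestMap_tree] at h2
  have h3 := hK.map (starSumEquiv I) _ h2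
  rw [map_mul, forestMap_tree, AlgHom.toLinearMap_apply, forestMap_forestMap] at h3
  rw [show (starSumEquiv I) ∘ Sum.inr = some from rfl, forestMap_tree] at h3
  have h4 : forestMap some (tree S) * tree (leaf none) ∈ K (Option I) := by
    rw [forestMap_tree, tree, tree, ExteriorAlgebra.ι_mul_ι]
    exact Submodule.neg_mem _ h3
  have h5 := hK.comp _ h4 _ hb
  rw [forestComp_mul_tree, forestMap_tree] at h5
  exact h5

/-- The same substitutions in `0 ∨ 1`, where `vee_comm` takes the place of the exchange of factors.
-/
theorem vee_mem (hK : IsForestIdeal K) {S : BinTree I} {T : BinTree J}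
    (hS : tree S ∈ K I) (hT : tree T ∈ K J) :
    tree ((relabel Sum.inl S).vee (relabel Sum.inr T)) ∈ K (I ⊕ J) := by
  have hder : ∀ {I : Type} (S T : BinTree I), graftDer S (tree T) = tree (S.vee T) := by
    intro I S T
    simp [graftDer, tree]
  have h1 := hK.map finTwoEquivStars _ hK.vee
  rw [forestMap_tree, relabel_vee,
    show relabel finTwoEquivStars (leaf 0) = relabel some (leaf none) from rfl,
    show relabel finTwoEquivStars (leaf 1) = leaf none from rfl] at h1
  have h2 := hK.comp _ h1 _ hS
  rw [forestComp_tree, subst_vee_some, subst_leaf_none, AlgHom.toLinearMap_apply, forestMap_tree,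
    hder] at h2
  have h3 := hK.map (starSumEquiv I) _ h2
  rw [forestMap_tree, relabel_vee, relabel_relabel, relabel_relabel, vee_comm,
    show (starSumEquiv I) ∘ Sum.inr = some from rfl] at h3
  have h4 := hK.comp _ h3 _ hT
  rw [show relabel (starSumEquiv I ∘ Sum.inl) (leaf none) = leaf none from rfl] at h4
  rw [forestComp_tree, subst_vee_some, subst_leaf_none, AlgHom.toLinearMap_apply, forestMap_tree,
    hder] at h4
  exact h4

/-- Induction on the number of labels. A single tree is cut at its root and a longer forest after
its first tree; every tree has a leaf, so both pieces have fewer labels. -/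
theorem wedge_mem (hK : IsForestIdeal K) : ∀ (n : ℕ) (I : Type) [Fintype I] [Nonempty I],
    Fintype.card I = n → ∀ L : List (BinTree I),
      (L.map leaves).sum = (Finset.univ : Finset I).val → _root_.wedge L ∈ K I := by
  classical
  intro n
  induction n using Nat.strong_induction_on with
  | _ n ih =>
  intro I _ _ hI L hL
  have split : ∀ L₁ L₂ : List (BinTree I), L₁ ≠ [] → L₂ ≠ [] →
      (L₁.map leaves).sum + (L₂.map leaves).sum = (Finset.univ : Finset I).val →
      ∃ (I₁ I₂ : Type) (_ : Fintype I₁) (_ : Nonempty I₁) (_ : Fintype I₂) (_ : Nonempty I₂)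
        (e : I₁ ⊕ I₂ ≃ I) (L₁' : List (BinTree I₁)) (L₂' : List (BinTree I₂)),
        L₁ = L₁'.map (relabel (e ∘ Sum.inl)) ∧ L₂ = L₂'.map (relabel (e ∘ Sum.inr)) ∧
        _root_.wedge L₁' ∈ K I₁ ∧ _root_.wedge L₂' ∈ K I₂ := by
    intro L₁ L₂ h₁ h₂ h
    have hne : ∀ L : List (BinTree I), L ≠ [] → ∃ i, i ∈ (L.map leaves).sum := by
      rintro (_ | ⟨T, L⟩) hL
      · exact absurd rfl hL
      · obtain ⟨i, hi⟩ := Multiset.exists_mem_of_ne_zero (leaves_ne_zero T)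
        exact ⟨i, by rw [List.map_cons, List.sum_cons]; exact Multiset.mem_add.2 (Or.inl hi)⟩
    have hn := Multiset.nodup_add.1 (h ▸ Finset.univ.nodup :
      ((L₁.map leaves).sum + (L₂.map leaves).sum).Nodup)
    obtain ⟨e, he₁, he₂⟩ := exists_sum_equiv h
    obtain ⟨i₁, hi₁⟩ := hne L₁ h₁
    obtain ⟨i₂, hi₂⟩ := hne L₂ h₂
    obtain ⟨L₁', hL₁', hL₁⟩ := exists_forest_on_support hn.1 L₁ rfl
    obtain ⟨L₂', hL₂', hL₂⟩ := exists_forest_on_support hn.2.1 L₂ rfl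
    have : Nonempty {i // i ∈ (L₁.map leaves).sum} := ⟨⟨i₁, hi₁⟩⟩
    have : Nonempty {i // i ∈ (L₂.map leaves).sum} := ⟨⟨i₂, hi₂⟩⟩
    have hcard := Fintype.card_congr e
    rw [Fintype.card_sum, hI] at hcard
    have p₁ : 0 < Fintype.card {i // i ∈ (L₁.map leaves).sum} := Fintype.card_pos
    have p₂ : 0 < Fintype.card {i // i ∈ (L₂.map leaves).sum} := Fintype.card_pos
    refine ⟨_, _, inferInstance, inferInstance, inferInstance, inferInstance, e, L₁', L₂',
      by rw [he₁, hL₁'], by rw [he₂, hL₂'], ih _ (by omega) _ rfl _ hL₁,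
      ih _ (by omega) _ rfl _ hL₂⟩
  have tree_eq : ∀ {I : Type} (T : BinTree I), _root_.wedge [T] = tree T := fun T => by
    simp [_root_.wedge, tree]
  rcases L with _ | ⟨T, _ | ⟨T', L⟩⟩
  · exact absurd (Finset.val_eq_zero.1 hL.symm) Finset.univ_nonempty.ne_empty
  · induction T using BinTree.induction with
    | leaf i =>
      have hu : ∀ j, j = i := fun j => by
        have : j ∈ (([leaf i] : List (BinTree I)).map leaves).sum := hL ▸ Finset.mem_univ j
        simpa using this
      let e : Unit ≃ I := ⟨fun _ => i, fun _ => (), fun _ => rfl, fun j => (hu j).symm⟩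
      have := hK.map e _ hK.one
      rw [forestMap_tree] at this
      rw [tree_eq]
      exact this
    | vee S T =>
      obtain ⟨I₁, I₂, _, _, _, _, e, L₁', L₂', h₁, h₂, m₁, m₂⟩ := split [S] [T] (by simp) (by simp)
        (by simpa [leaves_vee] using hL)
      obtain ⟨S', rfl, rfl⟩ := List.map_eq_singleton_iff.1 h₁.symm
      obtain ⟨T', rfl, rfl⟩ := List.map_eq_singleton_iff.1 h₂.symm
      rw [tree_eq] at m₁ m₂
      have := hK.map e _ (hK.vee_mem m₁ m₂)
      rw [forestMap_tree, relabel_vee, relabel_relabel, relabel_relabel] at this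
      rw [tree_eq]
      exact this
  · obtain ⟨I₁, I₂, _, _, _, _, e, L₁', L₂', h₁, h₂, m₁, m₂⟩ := split [T] (T' :: L) (by simp)
      (by simp) (by simpa using hL)
    obtain ⟨S', rfl, rfl⟩ := List.map_eq_singleton_iff.1 h₁.symm
    rw [tree_eq] at m₁
    have := hK.map e _ (hK.mul_mem m₁ m₂)
    rw [map_mul, forestMap_tree, relabel_relabel, forestMap_forestMap, forestMap_wedge, ← h₂] at this
    rw [wedge_cons]
    exact this

theorem mem (hK : IsForestIdeal K) {a : ExteriorAlgebra ℚ (BinTree I →₀ ℚ)}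
    (ha : a ∈ forestSpace I) : a ∈ K I := by
  refine (Submodule.span_le.2 ?_ : forestSpace I ≤ K I) ha
  rintro _ ⟨L, hL, rfl⟩
  exact hK.wedge_mem _ I rfl L hL

end IsForestIdeal

end ForestGeneration

/-! ### `Det(I)` is a line, and the compositions of `Det` are surjective -/

namespace DetOperad

variable {I J : Type} [Fintype I] [Fintype J]

theorem wedge_perm {X : Type} {L L' : List X} (h : L.Perm L') :
    wedge L = wedge L' ∨ wedge L = -wedge L' := by
  induction h with
  | nil => exact Or.inl rfl
  | cons x _ ih =>
    rw [wedge_cons, wedge_cons]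
    rcases ih with ih | ih <;> rw [ih]
    · exact Or.inl rfl
    · exact Or.inr (mul_neg _ _)
  | swap x y L =>
    refine Or.inr ?_
    rw [wedge_cons, wedge_cons, wedge_cons, wedge_cons, ← mul_assoc, ← mul_assoc,
      ExteriorAlgebra.ι_mul_ι, neg_mul]
  | trans _ _ h h' => rcases h with h | h <;> rcases h' with h' | h' <;> simp [h, h']

theorem sum_map_singleton {I : Type} (L : List I) :
    (L.map fun i => ({i} : Multiset I)).sum = (L : Multiset I) := by
  induction L with
  | nil => rfl
  | cons i L ih => rw [List.map_cons, List.sum_cons, ih]; rfl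

/-- The orientation given by an enumeration of `I`. -/
def ofList [Nonempty I] (L : List I) (hL : (L : Multiset I) = (Finset.univ : Finset I).val) :
    DetOperad.obj I :=
  ⟨wedge L, Submodule.subset_span ⟨L, (sum_map_singleton L).trans hL, rfl⟩⟩

theorem val_ofList [Nonempty I] (L : List I)
    (hL : (L : Multiset I) = (Finset.univ : Finset I).val) : val I (ofList L hL) = wedge L := rfl

/-- Any two enumerations of `I` are permutations of each other, so their wedge products agree up to
sign. -/
theorem exists_smul_ofList [Nonempty I] (L : List I)
    (hL : (L : Multiset I) = (Finset.univ : Finset I).val) (d : DetOperad.obj I) :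
    ∃ c : ℚ, d = c • ofList L hL := by
  suffices h : ∃ c : ℚ, c • wedge L = val I d by
    obtain ⟨c, hc⟩ := h
    refine ⟨c, val_injective ?_⟩
    rw [map_smul, val_ofList, hc]
  rw [← Submodule.mem_span_singleton]
  refine (Submodule.span_le.2 ?_ : detSpace I ≤ _) (val_mem d)
  rintro _ ⟨L', hL', rfl⟩
  rw [sum_map_singleton, ← hL, Multiset.coe_eq_coe] at hL'
  rcases wedge_perm hL' with h | h <;> rw [h]
  · exact Submodule.mem_span_singleton_self _
  · exact Submodule.neg_mem _ (Submodule.mem_span_singleton_self _)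

theorem detComp_wedge {I J : Type} (L : List I) (L' : List J) :
    detComp I J (wedge (L.map some ++ [none])) (wedge L') =
      wedge (L.map Sum.inl ++ L'.map Sum.inr) := by
  apply toForests_injective
  rw [toForests_detComp, toForests_wedge, toForests_wedge, toForests_wedge, List.map_append,
    wedge_append, List.map_append, wedge_append, List.map_map, List.map_map, List.map_map,
    show leaf ∘ some = relabel some ∘ (leaf : I → _) from rfl,
    show leaf ∘ Sum.inl = relabel (Sum.inl : I → I ⊕ J) ∘ leaf from rfl,
    show leaf ∘ Sum.inr = relabel (Sum.inr : J → I ⊕ J) ∘ leaf from rfl,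
    ← List.map_map, ← List.map_map, ← List.map_map, ← forestMap_wedge, ← forestMap_wedge,
    ← forestMap_wedge,
    show wedge (([none] : List (Option I)).map leaf) = tree (leaf none) by simp [wedge, tree],
    forestComp_mul_tree, subst_leaf_none, AlgHom.toLinearMap_apply]

/-- The compositions of the operad `Det` are surjective. -/
theorem exists_comp_eq [Nonempty J] (d : DetOperad.obj (I ⊕ J)) :
    ∃ (d₁ : DetOperad.obj (Option I)) (d₂ : DetOperad.obj J), DetOperad.comp d₁ d₂ = d := by
  obtain ⟨L, hL⟩ : ∃ L : List I, (L : Multiset I) = (Finset.univ : Finset I).val :=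
    Quot.exists_rep _
  obtain ⟨L', hL'⟩ : ∃ L : List J, (L : Multiset J) = (Finset.univ : Finset J).val :=
    Quot.exists_rep _
  have h₁ : ((L.map some ++ [none] : List (Option I)) : Multiset (Option I)) =
      (Finset.univ : Finset (Option I)).val := by
    rw [univ_val_option, ← hL, ← Multiset.coe_add, ← Multiset.map_coe, add_comm]
    rfl
  have h₂ : ((L.map Sum.inl ++ L'.map Sum.inr : List (I ⊕ J)) : Multiset (I ⊕ J)) =
      (Finset.univ : Finset (I ⊕ J)).val := by
    rw [univ_val_sum, ← hL, ← hL', ← Multiset.coe_add, ← Multiset.map_coe, ← Multiset.map_coe]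
  obtain ⟨c, rfl⟩ := exists_smul_ofList _ h₂ d
  refine ⟨c • ofList _ h₁, ofList _ hL', val_injective ?_⟩
  rw [val_comp, map_smul, map_smul, LinearMap.smul_apply, val_ofList, val_ofList, detComp_wedge,
    map_smul, val_ofList]

end DetOperad

/-! ### Subspaces of `Bess` that are closed under the operad structure -/

namespace Bess

open PreOperad

/-- The pure tensors of the Bessel operad. -/
def tmul (I : Type) [Fintype I] [Nonempty I] :
    DetOperad.obj I →ₗ[ℚ] BOperad.obj I →ₗ[ℚ] Bess.obj I :=
  tm DetOperad BOperad I

/-- The subspaces `K(I)` of `Bess(I)` that are stable under the structure of operads and contain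
the generators. -/
structure IsClosed (K : (I : Type) → [Fintype I] → [Nonempty I] → Submodule ℚ (Bess.obj I)) :
    Prop where
  par : ∀ (I : Type) [Fintype I] [Nonempty I], ∀ x ∈ K I, Bess.par I x ∈ K I
  map : ∀ {I J : Type} [Fintype I] [Nonempty I] [Fintype J] [Nonempty J] (e : I ≃ J),
    ∀ x ∈ K I, Bess.map e x ∈ K J
  comp : ∀ {I J : Type} [Fintype I] [Fintype J] [Nonempty J], ∀ x ∈ K (Option I), ∀ y ∈ K J,
    Bess.comp x y ∈ K (I ⊕ J)
  one : Bess.one ∈ K Unit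
  E : E ∈ K (Fin 2)
  Ω : Ω ∈ K (Fin 2)

namespace IsClosed

variable {K : (I : Type) → [Fintype I] → [Nonempty I] → Submodule ℚ (Bess.obj I)}
  {I J : Type} [Fintype I] [Fintype J]

/-- On `Det(I)` the sign operator is a scalar `±1`, so the sign operator of `B` alone can be
recovered from that of the tensor product. -/
theorem tmul_par_mem (hK : IsClosed K) [Nonempty I] {f : BOperad.obj I}
    (hf : ∀ d, tmul I d f ∈ K I) (d : DetOperad.obj I) : tmul I d (BOperad.par I f) ∈ K I := by
  have h : Bess.par I (tmul I d f) = tmul I (DetOperad.par I d) (BOperad.par I f) := rfl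
  have h1 := hK.par I _ (hf d)
  rw [h, DetOperad.par_eq, Units.smul_def, map_zsmul, LinearMap.smul_apply] at h1
  rcases Int.units_eq_one_or (((Fintype.card I : ℤ) - 1).negOnePow) with h2 | h2
  · rw [h2] at h1; simpa using h1
  · rw [h2] at h1; simpa using h1

/-- Surjectivity of the compositions of `Det` provides `d₁` and `d₂`. The Koszul sign depends on the
parity of `f` and on `|J| - 1`, and can be undone inside `K`. -/
theorem tmul_comp_mem (hK : IsClosed K) [Nonempty J] {f : BOperad.obj (Option I)}
    {g : BOperad.obj J} (hf : ∀ d, tmul (Option I) d f ∈ K (Option I)) (hg : ∀ d, tmul J d g ∈ K J)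
    (d : DetOperad.obj (I ⊕ J)) : tmul (I ⊕ J) d (BOperad.comp f g) ∈ K (I ⊕ J) := by
  obtain ⟨d₁, d₂, rfl⟩ := DetOperad.exists_comp_eq d
  have hc : ∀ f : BOperad.obj (Option I), Bess.comp (tmul _ d₁ f) (tmul _ d₂ g) = (1 / 2 : ℚ) •
      (tmul _ (DetOperad.comp d₁ d₂) (BOperad.comp f g) +
        tmul _ (DetOperad.comp d₁ d₂) (BOperad.comp (BOperad.par _ f) g) +
        tmul _ (DetOperad.comp d₁ (DetOperad.par _ d₂)) (BOperad.comp f g) -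
        tmul _ (DetOperad.comp d₁ (DetOperad.par _ d₂)) (BOperad.comp (BOperad.par _ f) g)) :=
    fun f => rfl
  rcases Int.units_eq_one_or (((Fintype.card J : ℤ) - 1).negOnePow) with h2 | h2
  · have h := hK.comp _ (hf d₁) _ (hg d₂)
    rw [hc, DetOperad.par_eq, h2, one_smul] at h
    convert h using 1
    module
  -- Here `d₂` is odd, so the Koszul sign is the sign operator applied to `f`; starting from
  -- `BOperad.par _ f` cancels it.
  · have h := hK.comp _ (hK.tmul_par_mem hf d₁) _ (hg d₂)
    rw [hc, DetOperad.par_eq, h2, Units.neg_smul, one_smul, map_neg, map_neg, LinearMap.neg_apply,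
      LinearMap.neg_apply, BOperad.isOperad.parInvolutive] at h
    convert h using 1
    module

theorem tmul_map_mem (hK : IsClosed K) [Nonempty I] [Nonempty J] (e : I ≃ J) {f : BOperad.obj I}
    (hf : ∀ d, tmul I d f ∈ K I) (d : DetOperad.obj J) : tmul J d (BOperad.map e f) ∈ K J := by
  have h := hK.map e _ (hf (DetOperad.map e.symm d))
  have h2 : Bess.map e (tmul I (DetOperad.map e.symm d) f) =
      tmul J (DetOperad.map e (DetOperad.map e.symm d)) (BOperad.map e f) := rfl
  have h3 : DetOperad.map e (DetOperad.map e.symm d) = d := by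
    rw [← LinearMap.comp_apply, ← DetOperad.isOperad.map_trans, Equiv.symm_trans_self,
      DetOperad.isOperad.map_refl, LinearMap.id_apply]
  rwa [h2, h3] at h

/-- The forests `f` such that `d ⊗ f` belongs to `K(I)` for all orientations `d`. -/
def forests (K : (I : Type) → [Fintype I] → [Nonempty I] → Submodule ℚ (Bess.obj I))
    (I : Type) [Fintype I] [Nonempty I] : Submodule ℚ (BOperad.obj I) :=
  ⨅ d : DetOperad.obj I, (K I).comap (tmul I d)

theorem mem_forests [Nonempty I] {f : BOperad.obj I} :
    f ∈ forests K I ↔ ∀ d, tmul I d f ∈ K I := by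
  simp [forests, Submodule.mem_iInf]

theorem mem_of_smul [Nonempty I] (L : List I)
    (hL : (L : Multiset I) = (Finset.univ : Finset I).val) {f : BOperad.obj I}
    (h : tmul I (DetOperad.ofList L hL) f ∈ K I) : f ∈ forests K I := by
  rw [mem_forests]
  intro d
  obtain ⟨c, rfl⟩ := DetOperad.exists_smul_ofList L hL d
  rw [map_smul, LinearMap.smul_apply]
  exact Submodule.smul_mem _ _ h

/-- Quantifying over all orientations `d` removes the factor `Det`, so that the generation of `B` by
`e` and `ω` yields the generation of `Bess`. -/
theorem isForestIdeal (hK : IsClosed K) :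
    IsForestIdeal fun I _ _ => (forests K I).map (BOperad.val I) where
  map e := by
    rintro _ ⟨f, hf, rfl⟩
    exact ⟨BOperad.map e f, mem_forests.2 (hK.tmul_map_mem e (mem_forests.1 hf)), rfl⟩
  comp := by
    rintro I J _ _ _ _ ⟨f, hf, rfl⟩ _ ⟨g, hg, rfl⟩
    exact ⟨BOperad.comp f g, mem_forests.2 (hK.tmul_comp_mem (mem_forests.1 hf) (mem_forests.1 hg)),
      rfl⟩
  one := ⟨BOperad.one, mem_of_smul [()] rfl hK.one, BOperad.val_one⟩
  wedge := ⟨e, mem_of_smul [1, 0] (by decide) hK.E, by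
    change wedge [leaf 0, leaf 1] = _
    simp [wedge, tree]⟩
  vee := ⟨ω, mem_of_smul [0, 1] (by decide) hK.Ω, by
    change wedge [(leaf 0).vee (leaf 1)] = _
    simp [wedge, tree]⟩

theorem mem (hK : IsClosed K) [Nonempty I] (x : Bess.obj I) : x ∈ K I := by
  refine tm_induction (P := DetOperad) (Q := BOperad) (C := fun x => x ∈ K I) x
    (Submodule.zero_mem _) (fun x y => Submodule.add_mem _) fun d f => ?_
  obtain ⟨g, hg, h⟩ := hK.isForestIdeal.mem (BOperad.val_mem f)
  rw [← BOperad.val_injective h]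
  exact mem_forests.1 hg d

end IsClosed

/-- Two morphisms that agree on the generators are equal. -/
theorem superHom_ext {Q : PreOperad} (φ ψ : SuperHom Bess Q) (hE : φ.app (Fin 2) E = ψ.app _ E)
    (hΩ : φ.app (Fin 2) Ω = ψ.app _ Ω) {I : Type} [Fintype I] [Nonempty I] (x : Bess.obj I) :
    φ.app I x = ψ.app I x := by
  have hK : IsClosed fun I _ _ => LinearMap.eqLocus (φ.app I) (ψ.app I) := {
    par := fun I _ _ x (hx : φ.app I x = ψ.app I x) => by
      change φ.app I (Bess.par I x) = ψ.app I _
      rw [φ.app_par, ψ.app_par, hx]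
    map := fun {I J} _ _ _ _ e x (hx : φ.app I x = ψ.app I x) => by
      change φ.app J (Bess.map e x) = ψ.app J _
      rw [φ.app_map, ψ.app_map, hx]
    comp := fun {I J} _ _ _ x (hx : φ.app _ x = ψ.app _ x) y (hy : φ.app J y = ψ.app J y) => by
      change φ.app (I ⊕ J) (Bess.comp x y) = ψ.app (I ⊕ J) _
      rw [φ.app_comp, ψ.app_comp, hx, hy]
    one := φ.app_one.trans ψ.app_one.symm
    E := hE
    Ω := hΩ }
  exact hK.mem x

end Bess

/-! ### Three copies of the exterior algebras -/

/-- The sum of the spaces of trees, of labels, and of trees. -/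
abbrev TripleSpace (I : Type) : Type := (BinTree I →₀ ℚ) × (I →₀ ℚ) × (BinTree I →₀ ℚ)

namespace TripleSpace

variable {I J K : Type}

/-- Relabelling of the three summands. -/
def map (f : I → J) : TripleSpace I →ₗ[ℚ] TripleSpace J :=
  (Finsupp.lmapDomain ℚ ℚ (relabel f)).prodMap
    ((Finsupp.lmapDomain ℚ ℚ f).prodMap (Finsupp.lmapDomain ℚ ℚ (relabel f)))

/-- The grafting of trees in the first and in the third summand. -/
def graft (I : Type) : TripleSpace I →ₗ[ℚ] TripleSpace I →ₗ[ℚ] TripleSpace I :=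
  LinearMap.mk₂ ℚ (fun v w => (BinTree.graft I v.1 w.1, 0, BinTree.graft I v.2.2 w.2.2))
    (by intros; simp) (by intros; simp) (by intros; simp) (by intros; simp)

theorem graft_apply (v w : TripleSpace I) :
    graft I v w = (BinTree.graft I v.1 w.1, 0, BinTree.graft I v.2.2 w.2.2) := rfl

theorem graft_comm (v w : TripleSpace I) : graft I v w = graft I w v := by
  rw [graft_apply, graft_apply, BinTree.graft_comm, BinTree.graft_comm v.2.2]

theorem map_graft (f : I → J) (v w : TripleSpace I) :
    map f (graft I v w) = graft J (map f v) (map f w) := by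
  have h : ∀ s t : BinTree I →₀ ℚ, Finsupp.lmapDomain ℚ ℚ (relabel f) (BinTree.graft I s t) =
      BinTree.graft J (Finsupp.lmapDomain ℚ ℚ (relabel f) s)
        (Finsupp.lmapDomain ℚ ℚ (relabel f) t) := fun s t => mapDomain_graft f s t
  simp only [map, graft_apply, LinearMap.prodMap_apply, h, map_zero]

end TripleSpace

/-! ### Operators of multiplication and grafting, and evaluation of wedge products -/

namespace PreOperad

variable {P Q : PreOperad} {I J : Type} [Fintype I] [Fintype J]

theorem tm_ext [Nonempty I] {M : Type} [AddCommGroup M] [Module ℚ M]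
    {f g : (P.tensor Q).obj I →ₗ[ℚ] M} (h : ∀ x y, f (tm P Q I x y) = g (tm P Q I x y)) : f = g :=
  TensorProduct.ext' h

/-- The sign operators are compatible with the compositions. -/
def CompPar (P : PreOperad) : Prop :=
  ∀ (I J : Type) [Fintype I] [Fintype J] [Nonempty J] (x : P.obj (Option I)) (y : P.obj J),
    P.par (I ⊕ J) (P.comp x y) = P.comp (P.par _ x) (P.par _ y)

theorem CompPar.tensor (hP : P.CompPar) (hQ : Q.CompPar) : (P.tensor Q).CompPar := by
  intro I J _ _ _ x y
  induction x using tm_induction with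
  | zero => simp
  | add x y hx hy => simp only [map_add, LinearMap.add_apply, hx, hy]
  | tm x₁ x₂ =>
    induction y using tm_induction with
    | zero => simp
    | add x y hx hy => simp only [map_add, hx, hy]
    | tm y₁ y₂ =>
      simp only [tensor_par, tensor_comp, map_smul, map_add, map_sub, hP _ _ _ _, hQ _ _ _ _]

/-- Odd operators `m(v)` and even operators `D(v)` on the components of `P`, for `v` in the
triple space, that behave like the multiplication by `v` and like the grafting of `v`. -/
structure WedgeAction (P : PreOperad) where
  parInvolutive : P.ParInvolutive
  compPar : P.CompPar
  m : (I : Type) → [Fintype I] → [Nonempty I] → TripleSpace I →ₗ[ℚ] P.obj I →ₗ[ℚ] P.obj I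
  D : (I : Type) → [Fintype I] → [Nonempty I] → TripleSpace I →ₗ[ℚ] P.obj I →ₗ[ℚ] P.obj I
  base : (I : Type) → [Fintype I] → [Nonempty I] → P.obj I
  star : (I : Type) → [Fintype I] → P.obj (Option I)
  par_star : ∀ (I : Type) [Fintype I], P.par (Option I) (star I) = star I
  par_m : ∀ (I : Type) [Fintype I] [Nonempty I] (v : TripleSpace I) (x : P.obj I),
    P.par I (m I v x) = -m I v (P.par I x)
  m_m : ∀ (I : Type) [Fintype I] [Nonempty I] (v : TripleSpace I) (x : P.obj I),
    m I v (m I v x) = 0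
  par_D : ∀ (I : Type) [Fintype I] [Nonempty I] (v : TripleSpace I) (x : P.obj I),
    P.par I (D I v x) = D I v (P.par I x)
  D_base : ∀ (I : Type) [Fintype I] [Nonempty I] (v : TripleSpace I), D I v (base I) = 0
  D_m : ∀ (I : Type) [Fintype I] [Nonempty I] (v w : TripleSpace I) (x : P.obj I),
    D I v (m I w x) = m I (TripleSpace.graft I v w) x + m I w (D I v x)
  map_base : ∀ {I J : Type} [Fintype I] [Nonempty I] [Fintype J] [Nonempty J] (e : I ≃ J),
    P.map e (base I) = base J
  map_m : ∀ {I J : Type} [Fintype I] [Nonempty I] [Fintype J] [Nonempty J] (e : I ≃ J)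
    (v : TripleSpace I) (x : P.obj I), P.map e (m I v x) = m J (TripleSpace.map e v) (P.map e x)
  comp_m : ∀ {I J : Type} [Fintype I] [Fintype J] [Nonempty J] (v : TripleSpace I)
    (x : P.obj (Option I)) (y : P.obj J), P.comp (m _ (TripleSpace.map some v) x) y =
      m _ (TripleSpace.map Sum.inl v) (P.comp x y)
  comp_D : ∀ {I J : Type} [Fintype I] [Fintype J] [Nonempty J] (v : TripleSpace I)
    (x : P.obj (Option I)) (y : P.obj J), P.comp (D _ (TripleSpace.map some v) x) y =
      D _ (TripleSpace.map Sum.inl v) (P.comp x y)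
  star_base : ∀ {I J : Type} [Fintype I] [Fintype J] [Nonempty J],
    P.comp (star I) (base J) = base (I ⊕ J)
  star_m : ∀ {I J : Type} [Fintype I] [Fintype J] [Nonempty J] (v : TripleSpace J) (y : P.obj J),
    P.comp (star I) (m J v y) = m _ (TripleSpace.map Sum.inr v) (P.comp (star I) y)

namespace WedgeAction

variable (A : WedgeAction P) (B : WedgeAction Q)

/-- The operators `m(v) ⊗ 1 - par ⊗ m(v)`. -/
def tensorM (I : Type) [Fintype I] [Nonempty I] :
    TripleSpace I →ₗ[ℚ] (P.tensor Q).obj I →ₗ[ℚ] (P.tensor Q).obj I where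
  -- In the exterior algebras used below, `par` is minus the grading involution; so `-par ⊗ m(v)`
  -- carries the usual sign for moving `v` past the left factor.
  toFun v := tensorLin (A.m I v) LinearMap.id - tensorLin (P.par I) (B.m I v)
  map_add' v w := tm_ext fun x y => by
    simp only [map_add, LinearMap.sub_apply, LinearMap.add_apply, tensorLin_tm, LinearMap.id_apply]
    abel
  map_smul' c v := tm_ext fun x y => by
    simp only [map_smul, LinearMap.sub_apply, LinearMap.smul_apply, tensorLin_tm,
      LinearMap.id_apply, RingHom.id_apply, smul_sub]

theorem tensorM_tm [Nonempty I] (v : TripleSpace I) (x : P.obj I) (y : Q.obj I) :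
    A.tensorM B I v (tm P Q I x y) =
      tm P Q I (A.m I v x) y - tm P Q I (P.par I x) (B.m I v y) := rfl

/-- The operators `D(v) ⊗ 1 + 1 ⊗ D(v)`. -/
def tensorD (I : Type) [Fintype I] [Nonempty I] :
    TripleSpace I →ₗ[ℚ] (P.tensor Q).obj I →ₗ[ℚ] (P.tensor Q).obj I where
  toFun v := tensorLin (A.D I v) LinearMap.id + tensorLin LinearMap.id (B.D I v)
  map_add' v w := tm_ext fun x y => by
    simp only [map_add, LinearMap.add_apply, tensorLin_tm, LinearMap.id_apply]
    abel
  map_smul' c v := tm_ext fun x y => by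
    simp only [map_smul, LinearMap.add_apply, LinearMap.smul_apply, tensorLin_tm,
      LinearMap.id_apply, RingHom.id_apply, smul_add]

theorem tensorD_tm [Nonempty I] (v : TripleSpace I) (x : P.obj I) (y : Q.obj I) :
    A.tensorD B I v (tm P Q I x y) = tm P Q I (A.D I v x) y + tm P Q I x (B.D I v y) := rfl

theorem par_tensorM [Nonempty I] (v : TripleSpace I) (x : (P.tensor Q).obj I) :
    (P.tensor Q).par I (A.tensorM B I v x) = -A.tensorM B I v ((P.tensor Q).par I x) := by
  induction x using tm_induction with
  | zero => simp
  | add x y hx hy => simp only [map_add, hx, hy]; abel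
  | tm x y =>
    simp only [tensorM_tm, map_sub, tensor_par, A.par_m, B.par_m, map_neg, LinearMap.neg_apply]
    abel

theorem tensorM_tensorM [Nonempty I] (v : TripleSpace I) (x : (P.tensor Q).obj I) :
    A.tensorM B I v (A.tensorM B I v x) = 0 := by
  induction x using tm_induction with
  | zero => simp
  | add x y hx hy => simp only [map_add, hx, hy, add_zero]
  | tm x y =>
    simp only [tensorM_tm, map_sub, A.m_m, B.m_m, A.par_m, map_neg, LinearMap.neg_apply, map_zero,
      LinearMap.zero_apply]
    abel

theorem par_tensorD [Nonempty I] (v : TripleSpace I) (x : (P.tensor Q).obj I) :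
    (P.tensor Q).par I (A.tensorD B I v x) = A.tensorD B I v ((P.tensor Q).par I x) := by
  induction x using tm_induction with
  | zero => simp
  | add x y hx hy => simp only [map_add, hx, hy]
  | tm x y => simp only [tensorD_tm, map_add, tensor_par, A.par_D, B.par_D]

theorem tensorD_tensorM [Nonempty I] (v w : TripleSpace I) (x : (P.tensor Q).obj I) :
    A.tensorD B I v (A.tensorM B I w x) =
      A.tensorM B I (TripleSpace.graft I v w) x + A.tensorM B I w (A.tensorD B I v x) := by
  induction x using tm_induction with
  | zero => simp
  | add x y hx hy => simp only [map_add, hx, hy]; abel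
  | tm x y =>
    simp only [tensorM_tm, tensorD_tm, map_sub, map_add, A.D_m, B.D_m, A.par_D,
      LinearMap.add_apply]
    abel

theorem map_tensorM [Nonempty I] [Nonempty J] (e : I ≃ J) (hP : ∀ x : P.obj I, P.map e (P.par I x) =
    P.par J (P.map e x)) (v : TripleSpace I) (x : (P.tensor Q).obj I) :
    (P.tensor Q).map e (A.tensorM B I v x) =
      A.tensorM B J (TripleSpace.map e v) ((P.tensor Q).map e x) := by
  induction x using tm_induction with
  | zero => simp
  | add x y hx hy => simp only [map_add, hx, hy]
  | tm x y => simp only [tensorM_tm, map_sub, tensor_map, A.map_m, B.map_m, hP]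

/-- Multiplying the second factor by `v` changes its parity, hence the Koszul sign of the
composition; the operator `par` in `tensorM` compensates this, since `par` is compatible with
compositions. -/
theorem comp_tensorM [Nonempty J] (v : TripleSpace I) (x : (P.tensor Q).obj (Option I))
    (y : (P.tensor Q).obj J) :
    (P.tensor Q).comp (A.tensorM B _ (TripleSpace.map some v) x) y =
      A.tensorM B _ (TripleSpace.map Sum.inl v) ((P.tensor Q).comp x y) := by
  induction x using tm_induction with
  | zero => simp
  | add x y hx hy => simp only [map_add, LinearMap.add_apply, hx, hy]
  | tm x₁ x₂ =>
    induction y using tm_induction with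
    | zero => simp
    | add x y hx hy => simp only [map_add, hx, hy]
    | tm y₁ y₂ =>
      simp only [tensorM_tm, map_sub, LinearMap.sub_apply, tensor_comp, map_smul, map_add,
        A.comp_m, B.comp_m, B.par_m, map_neg, LinearMap.neg_apply, A.compPar _ _ _ _,
        A.parInvolutive _ _]
      module

theorem comp_tensorD [Nonempty J] (v : TripleSpace I) (x : (P.tensor Q).obj (Option I))
    (y : (P.tensor Q).obj J) :
    (P.tensor Q).comp (A.tensorD B _ (TripleSpace.map some v) x) y =
      A.tensorD B _ (TripleSpace.map Sum.inl v) ((P.tensor Q).comp x y) := by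
  induction x using tm_induction with
  | zero => simp
  | add x y hx hy => simp only [map_add, LinearMap.add_apply, hx, hy]
  | tm x₁ x₂ =>
    induction y using tm_induction with
    | zero => simp
    | add x y hx hy => simp only [map_add, hx, hy]
    | tm y₁ y₂ =>
      simp only [tensorD_tm, map_sub, LinearMap.add_apply, tensor_comp, map_smul, map_add,
        A.comp_D, B.comp_D, B.par_D]
      module

/-- The element `star` is even, so no Koszul sign appears. -/
theorem comp_tensor_star [Nonempty J] (y₁ : P.obj J) (y₂ : Q.obj J) :
    (P.tensor Q).comp (tm P Q _ (A.star I) (B.star I)) (tm P Q J y₁ y₂) =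
      tm P Q _ (P.comp (A.star I) y₁) (Q.comp (B.star I) y₂) := by
  rw [tensor_comp, B.par_star]
  module

theorem comp_star_tensorM [Nonempty J] (v : TripleSpace J) (y : (P.tensor Q).obj J) :
    (P.tensor Q).comp (tm P Q _ (A.star I) (B.star I)) (A.tensorM B _ v y) =
      A.tensorM B _ (TripleSpace.map Sum.inr v)
        ((P.tensor Q).comp (tm P Q _ (A.star I) (B.star I)) y) := by
  induction y using tm_induction with
  | zero => simp
  | add x y hx hy => simp only [map_add, hx, hy]
  | tm y₁ y₂ =>
    simp only [tensorM_tm, map_sub, comp_tensor_star, A.star_m, B.star_m, A.compPar _ _ _ _,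
      A.par_star]

/-- The tensor product of two actions. -/
def tensor (hP : ∀ {I J : Type} [Fintype I] [Nonempty I] [Fintype J] [Nonempty J] (e : I ≃ J)
    (x : P.obj I), P.map e (P.par I x) = P.par J (P.map e x)) : WedgeAction (P.tensor Q) where
  parInvolutive := A.parInvolutive.tensor B.parInvolutive
  compPar := A.compPar.tensor B.compPar
  m I _ _ := A.tensorM B I
  D I _ _ := A.tensorD B I
  base I _ _ := tm P Q I (A.base I) (B.base I)
  star I _ := tm P Q _ (A.star I) (B.star I)
  par_star I _ := by rw [tensor_par, A.par_star, B.par_star]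
  par_m I _ _ := A.par_tensorM B
  m_m I _ _ := A.tensorM_tensorM B
  par_D I _ _ := A.par_tensorD B
  D_base I _ _ v := by
    rw [tensorD_tm, A.D_base, B.D_base, map_zero, map_zero, LinearMap.zero_apply, add_zero]
  D_m I _ _ := A.tensorD_tensorM B
  map_base e := by rw [tensor_map, A.map_base, B.map_base]
  map_m e := A.map_tensorM B e (hP e)
  comp_m := A.comp_tensorM B
  comp_D := A.comp_tensorD B
  star_base := by
    intros
    rw [comp_tensor_star, A.star_base, B.star_base]
  star_m := A.comp_star_tensorM B

/-- The evaluation `v₁ ∧ ⋯ ∧ vₖ ↦ m(v₁) ⋯ m(vₖ) base`. -/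
def eval (I : Type) [Fintype I] [Nonempty I] : ExteriorAlgebra ℚ (TripleSpace I) →ₗ[ℚ] P.obj I :=
  CliffordAlgebra.foldr 0 (A.m I) (fun v x => by rw [A.m_m]; simp) (A.base I)

@[simp] theorem eval_one [Nonempty I] : A.eval I 1 = A.base I := CliffordAlgebra.foldr_one _ _ _ _

theorem eval_ι_mul [Nonempty I] (v : TripleSpace I) (a : ExteriorAlgebra ℚ (TripleSpace I)) :
    A.eval I (ExteriorAlgebra.ι ℚ v * a) = A.m I v (A.eval I a) := by
  refine (CliffordAlgebra.foldr_mul _ _ _ _ _ _).trans ?_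
  exact CliffordAlgebra.foldr_ι _ _ _ _ _

theorem eval_ι [Nonempty I] (v : TripleSpace I) :
    A.eval I (ExteriorAlgebra.ι ℚ v) = A.m I v (A.base I) := by
  have := A.eval_ι_mul v 1
  rwa [mul_one, eval_one] at this

theorem eval_inv [Nonempty I] (hA : P.par I (A.base I) = -A.base I)
    (a : ExteriorAlgebra ℚ (TripleSpace I)) : A.eval I (inv _ a) = -P.par I (A.eval I a) := by
  induction a using ExteriorAlgebra.ι_mul_induction with
  | one => rw [map_one, eval_one, hA, neg_neg]
  | smul c a h => simp only [map_smul, h, smul_neg]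
  | add a b ha hb => simp only [map_add, ha, hb]; abel
  | mul v a h =>
    rw [map_mul, ExteriorAlgebra.inv_ι, neg_mul, map_neg, eval_ι_mul, eval_ι_mul, h, A.par_m,
      map_neg]

theorem eval_map [Nonempty I] [Nonempty J] (e : I ≃ J) (a : ExteriorAlgebra ℚ (TripleSpace I)) :
    A.eval J (ExteriorAlgebra.map (TripleSpace.map e) a) = P.map e (A.eval I a) := by
  induction a using ExteriorAlgebra.ι_mul_induction with
  | one => rw [map_one, eval_one, eval_one, A.map_base]
  | smul c a h => simp only [map_smul, h]
  | add a b ha hb => simp only [map_add, ha, hb]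
  | mul v a h =>
    rw [map_mul, ExteriorAlgebra.map_apply_ι, eval_ι_mul, eval_ι_mul, h, A.map_m]

/-- The operator `D(v)` kills `base` and has the Leibniz rule of the derivation with respect to the
operators `m(w)`; these two facts determine it on evaluations. -/
theorem eval_derivation [Nonempty I] (v : TripleSpace I) (a : ExteriorAlgebra ℚ (TripleSpace I)) :
    A.eval I (derivation (TripleSpace.graft I v) a) = A.D I v (A.eval I a) := by
  induction a using ExteriorAlgebra.ι_mul_induction with
  | one => rw [ExteriorAlgebra.derivation_one, map_zero, eval_one, A.D_base]
  | smul c a h => simp only [map_smul, h]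
  | add a b ha hb => simp only [map_add, ha, hb]
  | mul w a h =>
    rw [derivation_ι_mul, map_add, eval_ι_mul, eval_ι_mul, eval_ι_mul, h, A.D_m]

theorem comp_eval_mul [Nonempty J] {b : ExteriorAlgebra ℚ (TripleSpace (Option I))}
    {b' : ExteriorAlgebra ℚ (TripleSpace (I ⊕ J))} {y : P.obj J}
    (h : P.comp (A.eval _ b) y = A.eval _ b') (a : ExteriorAlgebra ℚ (TripleSpace I)) :
    P.comp (A.eval _ (ExteriorAlgebra.map (TripleSpace.map some) a * b)) y =
      A.eval _ (ExteriorAlgebra.map (TripleSpace.map Sum.inl) a * b') := by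
  induction a using ExteriorAlgebra.ι_mul_induction with
  | one => simpa using h
  | smul c a h => simp only [map_smul, LinearMap.smul_apply, smul_mul_assoc, h]
  | add a b ha hb => simp only [map_add, LinearMap.add_apply, add_mul, ha, hb]
  | mul v a h =>
    rw [map_mul (ExteriorAlgebra.map _), map_mul (ExteriorAlgebra.map _),
      ExteriorAlgebra.map_apply_ι, ExteriorAlgebra.map_apply_ι, mul_assoc,
      mul_assoc, eval_ι_mul, eval_ι_mul, A.comp_m, h]

/-- A bracket with `a` is a sum of multiplications and graftings by the vectors of `a`. None of
these involves `⋆`, so each passes through the composition. -/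
theorem comp_eval_bracket [Nonempty J] {b : ExteriorAlgebra ℚ (TripleSpace (Option I))}
    {b' : ExteriorAlgebra ℚ (TripleSpace (I ⊕ J))} {y : P.obj J}
    (h : P.comp (A.eval _ b) y = A.eval _ b') (a : ExteriorAlgebra ℚ (TripleSpace I)) :
    P.comp (A.eval _ (bracket (TripleSpace.graft _)
        (ExteriorAlgebra.map (TripleSpace.map some) a) b)) y =
      A.eval _ (bracket (TripleSpace.graft _)
        (ExteriorAlgebra.map (TripleSpace.map Sum.inl) a) b') := by
  induction a using ExteriorAlgebra.ι_mul_induction with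
  | one => simp
  | smul c a h => simp only [map_smul, LinearMap.smul_apply, h]
  | add a b ha hb => simp only [map_add, LinearMap.add_apply, ha, hb]
  | mul v a ih =>
    have hD : P.comp (A.eval _ (derivation (TripleSpace.graft _ (TripleSpace.map some v)) b)) y =
        A.eval _ (derivation (TripleSpace.graft _ (TripleSpace.map Sum.inl v)) b') := by
      rw [eval_derivation, eval_derivation, A.comp_D, h]
    rw [map_mul (ExteriorAlgebra.map _), map_mul (ExteriorAlgebra.map _),
      ExteriorAlgebra.map_apply_ι, ExteriorAlgebra.map_apply_ι,
      ExteriorAlgebra.bracket_ι_mul, ExteriorAlgebra.bracket_ι_mul, map_add, map_add, map_add,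
      LinearMap.add_apply, eval_ι_mul, eval_ι_mul, A.comp_m, ih, ← ExteriorAlgebra.map_inv,
      ← ExteriorAlgebra.map_inv, A.comp_eval_mul hD]

theorem comp_star_eval [Nonempty J] (a : ExteriorAlgebra ℚ (TripleSpace J)) :
    P.comp (A.star I) (A.eval J a) =
      A.eval _ (ExteriorAlgebra.map (TripleSpace.map Sum.inr) a) := by
  induction a using ExteriorAlgebra.ι_mul_induction with
  | one => rw [map_one (ExteriorAlgebra.map _), eval_one, eval_one, A.star_base]
  | smul c a h => simp only [map_smul, h]
  | add a b ha hb => simp only [map_add, ha, hb]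
  | mul v a h =>
    rw [map_mul (ExteriorAlgebra.map _), ExteriorAlgebra.map_apply_ι, eval_ι_mul, eval_ι_mul, A.star_m,
      h]

end WedgeAction

end PreOperad

/-! ### The composition on full exterior algebras -/

section Ambient

variable {I J : Type}

theorem forestComp_ι_mul (t : BinTree I →₀ ℚ) (x : ExteriorAlgebra ℚ (BinTree (Option I) →₀ ℚ))
    (y : ExteriorAlgebra ℚ (BinTree J →₀ ℚ)) :
    forestComp I J (ExteriorAlgebra.ι ℚ (Finsupp.lmapDomain ℚ ℚ (relabel some) t) * x) y =
      ExteriorAlgebra.ι ℚ (Finsupp.lmapDomain ℚ ℚ (relabel Sum.inl) t) * forestComp I J x y := by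
  have h := forestComp_mul (ExteriorAlgebra.ι ℚ t) x y
  rwa [forestMap, forestMap, ExteriorAlgebra.map_apply_ι, ExteriorAlgebra.map_apply_ι] at h

theorem forestComp_derivation (t : BinTree I →₀ ℚ)
    (x : ExteriorAlgebra ℚ (BinTree (Option I) →₀ ℚ)) (y : ExteriorAlgebra ℚ (BinTree J →₀ ℚ)) :
    forestComp I J (derivation (graft _ (Finsupp.lmapDomain ℚ ℚ (relabel some) t)) x) y =
      derivation (graft _ (Finsupp.lmapDomain ℚ ℚ (relabel Sum.inl) t)) (forestComp I J x y) := by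
  induction t using Finsupp.induction_linear with
  | zero => simp [ExteriorAlgebra.derivation_zero]
  | add s t hs ht =>
    simp only [map_add, ExteriorAlgebra.derivation_add_apply, LinearMap.add_apply, hs, ht]
  | single S c =>
    have hc : Finsupp.single S c = c • Finsupp.single S (1 : ℚ) := by simp
    have := forestComp_graftDer S x y
    simp only [graftDer] at this
    rw [hc]
    simp only [map_smul, ExteriorAlgebra.derivation_smul_apply, LinearMap.smul_apply,
      Finsupp.lmapDomain_apply, Finsupp.mapDomain_single, this]

theorem forestComp_leaf_none (y : ExteriorAlgebra ℚ (BinTree J →₀ ℚ)) :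
    forestComp I J (tree (leaf none)) y = forestMap Sum.inr y := by
  rw [forestComp_tree, subst_leaf_none]; rfl

theorem detComp_ι_mul (t : I →₀ ℚ) (x : ExteriorAlgebra ℚ (Option I →₀ ℚ))
    (y : ExteriorAlgebra ℚ (J →₀ ℚ)) :
    detComp I J (ExteriorAlgebra.ι ℚ (Finsupp.lmapDomain ℚ ℚ some t) * x) y =
      ExteriorAlgebra.ι ℚ (Finsupp.lmapDomain ℚ ℚ Sum.inl t) * detComp I J x y := by
  have h : ∀ {I : Type} (t : I →₀ ℚ), DetOperad.toForests I (ExteriorAlgebra.ι ℚ t) =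
      ExteriorAlgebra.ι ℚ (Finsupp.lmapDomain ℚ ℚ leaf t) :=
    fun t => ExteriorAlgebra.map_apply_ι _ _
  have hl : ∀ {I J : Type} (f : I → J) (t : I →₀ ℚ), Finsupp.lmapDomain ℚ ℚ leaf
      (Finsupp.lmapDomain ℚ ℚ f t) = Finsupp.lmapDomain ℚ ℚ (relabel f)
        (Finsupp.lmapDomain ℚ ℚ leaf t) := by
    intro I J f t
    simp only [Finsupp.lmapDomain_apply, ← Finsupp.mapDomain_comp]
    rfl
  apply DetOperad.toForests_injective
  rw [DetOperad.toForests_detComp, map_mul (DetOperad.toForests _),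
    map_mul (DetOperad.toForests _), h, h, hl, hl, forestComp_ι_mul,
    DetOperad.toForests_detComp]

theorem detComp_none (y : ExteriorAlgebra ℚ (J →₀ ℚ)) :
    detComp I J (ExteriorAlgebra.ι ℚ (Finsupp.single none 1)) y =
      ExteriorAlgebra.map (Finsupp.lmapDomain ℚ ℚ Sum.inr) y := by
  simp [detComp, ExteriorAlgebra.insertion_ι]

theorem detComp_inv (x : ExteriorAlgebra ℚ (Option I →₀ ℚ)) (y : ExteriorAlgebra ℚ (J →₀ ℚ)) :
    detComp I J (inv _ x) (inv _ y) = -inv _ (detComp I J x y) := by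
  apply DetOperad.toForests_injective
  have h : ∀ {I : Type} (a : ExteriorAlgebra ℚ (I →₀ ℚ)), DetOperad.toForests I (inv _ a) =
      inv _ (DetOperad.toForests I a) := fun a => ExteriorAlgebra.map_inv _ a
  rw [DetOperad.toForests_detComp, map_neg, h, h, h, forestComp_inv, DetOperad.toForests_detComp]

/-- The composition of forests on the full exterior algebras of the spaces of trees. The degrees
play no role. -/
def ForestAlgebra : PreOperad where
  obj I _ _ := ExteriorAlgebra ℚ (BinTree I →₀ ℚ)
  gr _ _ _ _ := ⊤
  -- The minus sign is there because the degree in `B` is the number of trees minus one.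
  par I _ _ := -(inv (BinTree I →₀ ℚ)).toLinearMap
  map e := (forestMap e).toLinearMap
  one := tree (leaf ())
  comp {I J} _ _ _ := forestComp I J

/-- The composition of orientations on the full exterior algebras of the spaces of labels. The
degrees play no role. -/
def LabelAlgebra : PreOperad where
  obj I _ _ := ExteriorAlgebra ℚ (I →₀ ℚ)
  gr _ _ _ _ := ⊤
  par I _ _ := -(inv (I →₀ ℚ)).toLinearMap
  map e := (ExteriorAlgebra.map (Finsupp.lmapDomain ℚ ℚ e)).toLinearMap
  one := ExteriorAlgebra.ι ℚ (Finsupp.single () 1)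
  comp {I J} _ _ _ := detComp I J

theorem ForestAlgebra.parInvolutive : ForestAlgebra.ParInvolutive :=
  fun I _ _ (x : ExteriorAlgebra ℚ (BinTree I →₀ ℚ)) => by
  change -inv _ (-inv _ x) = x
  simp

theorem LabelAlgebra.parInvolutive : LabelAlgebra.ParInvolutive :=
  fun I _ _ (x : ExteriorAlgebra ℚ (I →₀ ℚ)) => by
  change -inv _ (-inv _ x) = x
  simp

theorem ForestAlgebra.compPar : ForestAlgebra.CompPar :=
  fun I J _ _ _ (x : ExteriorAlgebra ℚ (BinTree (Option I) →₀ ℚ))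
    (y : ExteriorAlgebra ℚ (BinTree J →₀ ℚ)) => by
  change -inv _ (forestComp I J x y) = forestComp I J (-inv _ x) (-inv _ y)
  rw [map_neg, map_neg, LinearMap.neg_apply, neg_neg, forestComp_inv]

theorem LabelAlgebra.compPar : LabelAlgebra.CompPar :=
  fun I J _ _ _ (x : ExteriorAlgebra ℚ (Option I →₀ ℚ))
    (y : ExteriorAlgebra ℚ (J →₀ ℚ)) => by
  change -inv _ (detComp I J x y) = detComp I J (-inv _ x) (-inv _ y)
  rw [map_neg, map_neg, LinearMap.neg_apply, neg_neg, detComp_inv]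

theorem ForestAlgebra.map_par [Fintype I] [Nonempty I] [Fintype J] [Nonempty J] (e : I ≃ J)
    (x : ExteriorAlgebra ℚ (BinTree I →₀ ℚ)) :
    ForestAlgebra.map e (ForestAlgebra.par I x) = ForestAlgebra.par J (ForestAlgebra.map e x) := by
  change forestMap e (-inv _ x) = -inv _ (forestMap e x)
  rw [map_neg, forestMap_inv]

theorem LabelAlgebra.map_par [Fintype I] [Nonempty I] [Fintype J] [Nonempty J] (e : I ≃ J)
    (x : ExteriorAlgebra ℚ (I →₀ ℚ)) :
    LabelAlgebra.map e (LabelAlgebra.par I x) = LabelAlgebra.par J (LabelAlgebra.map e x) := by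
  change ExteriorAlgebra.map _ (-inv _ x) = -inv _ (ExteriorAlgebra.map _ x)
  rw [map_neg, ExteriorAlgebra.map_inv]

/-- The inclusion of `B`. -/
def BOperad.incl : PreOperad.SuperHom BOperad ForestAlgebra where
  app I _ _ := BOperad.val I
  app_par _ _ _ _ := rfl
  app_map _ _ := rfl
  app_one := BOperad.val_one
  app_comp _ _ := rfl

/-- The inclusion of `Det`. -/
def DetOperad.incl : PreOperad.SuperHom DetOperad LabelAlgebra where
  app I _ _ := DetOperad.val I
  app_par I _ _ x := by
    change DetOperad.val I (DetOperad.par I x) = -inv _ (DetOperad.val I x)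
    rw [DetOperad.par_eq, ExteriorAlgebra.inv_eq_scale,
      DetOperad.scale_detSpace _ (DetOperad.val_mem x), Units.smul_def, map_zsmul,
      Int.negOnePow_sub, Int.negOnePow_one]
    rcases Nat.even_or_odd (Fintype.card I) with h | h
    · rw [h.neg_one_pow, Int.negOnePow_even _ (by exact_mod_cast h)]
      simp
    · rw [h.neg_one_pow, Int.negOnePow_odd _ (by exact_mod_cast h)]
      simp
  app_map _ _ := rfl
  app_one := by
    change wedge [()] = ExteriorAlgebra.ι ℚ (Finsupp.single () 1)
    simp [wedge]
  app_comp _ _ := rfl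

/-- The action on forests, through one of the projections of the triple space. -/
def forestAction (π : (I : Type) → TripleSpace I →ₗ[ℚ] (BinTree I →₀ ℚ))
    (hmap : ∀ {I J : Type} (f : I → J) (v : TripleSpace I),
      π J (TripleSpace.map f v) = Finsupp.lmapDomain ℚ ℚ (relabel f) (π I v))
    (hgraft : ∀ {I : Type} (v w : TripleSpace I),
      π I (TripleSpace.graft I v w) = graft I (π I v) (π I w)) :
    PreOperad.WedgeAction ForestAlgebra where
  parInvolutive := ForestAlgebra.parInvolutive
  compPar := ForestAlgebra.compPar
  m I _ _ := LinearMap.mul ℚ (ExteriorAlgebra ℚ (BinTree I →₀ ℚ)) ∘ₗ ExteriorAlgebra.ι ℚ ∘ₗ π I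
  D I _ _ := ExteriorAlgebra.derivationₗ ∘ₗ graft I ∘ₗ π I
  base I _ _ := (1 : ExteriorAlgebra ℚ (BinTree I →₀ ℚ))
  star I _ := tree (leaf none)
  par_star I _ := by
    change -inv _ (tree (leaf none)) = tree (leaf none)
    simp [tree]
  par_m I _ _ v (x : ExteriorAlgebra ℚ (BinTree I →₀ ℚ)) := by
    change -inv _ (ExteriorAlgebra.ι ℚ (π I v) * x) = -(ExteriorAlgebra.ι ℚ (π I v) * -inv _ x)
    simp
  m_m I _ _ v (x : ExteriorAlgebra ℚ (BinTree I →₀ ℚ)) := by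
    change ExteriorAlgebra.ι ℚ (π I v) * (ExteriorAlgebra.ι ℚ (π I v) * x) = 0
    rw [← mul_assoc, ExteriorAlgebra.ι_sq_zero, zero_mul]
  par_D I _ _ v (x : ExteriorAlgebra ℚ (BinTree I →₀ ℚ)) := by
    change -inv _ (derivation (graft I (π I v)) x) = derivation (graft I (π I v)) (-inv _ x)
    rw [map_neg, derivation_inv]
  D_base I _ _ v := ExteriorAlgebra.derivation_one _
  D_m I _ _ v w (x : ExteriorAlgebra ℚ (BinTree I →₀ ℚ)) := by
    change derivation (graft I (π I v)) (ExteriorAlgebra.ι ℚ (π I w) * x) =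
      ExteriorAlgebra.ι ℚ (π I _) * x + ExteriorAlgebra.ι ℚ (π I w) * derivation _ x
    rw [derivation_ι_mul, hgraft]
    rfl
  map_base e := map_one (forestMap e)
  map_m {I J} _ _ _ _ e v (x : ExteriorAlgebra ℚ (BinTree I →₀ ℚ)) := by
    change forestMap e (ExteriorAlgebra.ι ℚ (π I v) * x) =
      ExteriorAlgebra.ι ℚ (π J (TripleSpace.map e v)) * forestMap e x
    rw [map_mul, hmap, forestMap, ExteriorAlgebra.map_apply_ι]
  comp_m {I J} _ _ _ v (x : ExteriorAlgebra ℚ (BinTree (Option I) →₀ ℚ))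
      (y : ExteriorAlgebra ℚ (BinTree J →₀ ℚ)) := by
    change forestComp I J (ExteriorAlgebra.ι ℚ (π _ (TripleSpace.map some v)) * x) y =
      ExteriorAlgebra.ι ℚ (π _ (TripleSpace.map Sum.inl v)) * forestComp I J x y
    rw [hmap, hmap, forestComp_ι_mul]
  comp_D {I J} _ _ _ v (x : ExteriorAlgebra ℚ (BinTree (Option I) →₀ ℚ))
      (y : ExteriorAlgebra ℚ (BinTree J →₀ ℚ)) := by
    change forestComp I J (derivation (graft _ (π _ (TripleSpace.map some v))) x) y =
      derivation (graft _ (π _ (TripleSpace.map Sum.inl v))) (forestComp I J x y)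
    rw [hmap, hmap, forestComp_derivation]
  star_base := by
    intro I J _ _ _
    exact (forestComp_leaf_none _).trans (map_one _)
  star_m {I J} _ _ _ v (y : ExteriorAlgebra ℚ (BinTree J →₀ ℚ)) := by
    change forestComp I J (tree (leaf none)) (ExteriorAlgebra.ι ℚ (π J v) * y) =
      ExteriorAlgebra.ι ℚ (π _ (TripleSpace.map Sum.inr v)) *
        forestComp I J (tree (leaf none)) y
    rw [forestComp_leaf_none, forestComp_leaf_none, map_mul, hmap, forestMap,
      ExteriorAlgebra.map_apply_ι]

/-- The action on orientations, through the middle projection of the triple space. -/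
def labelAction : PreOperad.WedgeAction LabelAlgebra where
  parInvolutive := LabelAlgebra.parInvolutive
  compPar := LabelAlgebra.compPar
  m I _ _ := LinearMap.mul ℚ (ExteriorAlgebra ℚ (I →₀ ℚ)) ∘ₗ ExteriorAlgebra.ι ℚ ∘ₗ
    LinearMap.fst ℚ _ _ ∘ₗ LinearMap.snd ℚ _ _
  -- Matches the middle component of `TripleSpace.graft`: nothing is grafted on labels.
  D I _ _ := 0
  base I _ _ := (1 : ExteriorAlgebra ℚ (I →₀ ℚ))
  star I _ := ExteriorAlgebra.ι ℚ (Finsupp.single none 1)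
  par_star I _ := by
    change -inv _ (ExteriorAlgebra.ι ℚ _) = ExteriorAlgebra.ι ℚ _
    simp
  par_m I _ _ v (x : ExteriorAlgebra ℚ (I →₀ ℚ)) := by
    change -inv _ (ExteriorAlgebra.ι ℚ v.2.1 * x) = -(ExteriorAlgebra.ι ℚ v.2.1 * -inv _ x)
    simp
  m_m I _ _ v (x : ExteriorAlgebra ℚ (I →₀ ℚ)) := by
    change ExteriorAlgebra.ι ℚ v.2.1 * (ExteriorAlgebra.ι ℚ v.2.1 * x) = 0
    rw [← mul_assoc, ExteriorAlgebra.ι_sq_zero, zero_mul]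
  par_D I _ _ v (x : ExteriorAlgebra ℚ (I →₀ ℚ)) := map_zero _
  D_base I _ _ v := rfl
  D_m I _ _ v w (x : ExteriorAlgebra ℚ (I →₀ ℚ)) := by
    change 0 = ExteriorAlgebra.ι ℚ 0 * x + ExteriorAlgebra.ι ℚ w.2.1 * 0
    simp
  map_base e := map_one (ExteriorAlgebra.map _)
  map_m {I J} _ _ _ _ e v (x : ExteriorAlgebra ℚ (I →₀ ℚ)) := by
    change ExteriorAlgebra.map _ (ExteriorAlgebra.ι ℚ v.2.1 * x) =
      ExteriorAlgebra.ι ℚ (Finsupp.lmapDomain ℚ ℚ e v.2.1) * ExteriorAlgebra.map _ x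
    rw [map_mul, ExteriorAlgebra.map_apply_ι]
  comp_m {I J} _ _ _ v (x : ExteriorAlgebra ℚ (Option I →₀ ℚ))
      (y : ExteriorAlgebra ℚ (J →₀ ℚ)) := detComp_ι_mul v.2.1 x y
  comp_D {I J} _ _ _ v (x : ExteriorAlgebra ℚ (Option I →₀ ℚ))
      (y : ExteriorAlgebra ℚ (J →₀ ℚ)) := by
    change detComp I J 0 y = 0
    rw [map_zero, LinearMap.zero_apply]
  star_base := by
    intro I J _ _ _
    exact (detComp_none _).trans (map_one _)
  star_m {I J} _ _ _ v (y : ExteriorAlgebra ℚ (J →₀ ℚ)) := by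
    change detComp I J (ExteriorAlgebra.ι ℚ (Finsupp.single none 1))
      (ExteriorAlgebra.ι ℚ v.2.1 * y) = ExteriorAlgebra.ι ℚ (Finsupp.lmapDomain ℚ ℚ Sum.inr v.2.1) *
        detComp I J (ExteriorAlgebra.ι ℚ (Finsupp.single none 1)) y
    rw [detComp_none, detComp_none, map_mul, ExteriorAlgebra.map_apply_ι]

/-- The action on the tensor product of the three exterior algebras. -/
def tripleAction :
    PreOperad.WedgeAction (ForestAlgebra.tensor (LabelAlgebra.tensor ForestAlgebra)) :=
  (forestAction (fun _ => LinearMap.fst ℚ _ _) (fun _ _ => rfl) (fun _ _ => rfl)).tensor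
    (labelAction.tensor (forestAction (fun _ => LinearMap.snd ℚ _ _ ∘ₗ LinearMap.snd ℚ _ _)
      (fun _ _ => rfl) (fun _ _ => rfl)) LabelAlgebra.map_par) ForestAlgebra.map_par

end Ambient

/-! ### The coaction on forests -/

section Coaction

variable {I J : Type}

/-- The product of the three copies of a label. -/
def tripleLeaf (i : I) : ExteriorAlgebra ℚ (TripleSpace I) :=
  ExteriorAlgebra.ι ℚ (Finsupp.single (leaf i) 1, 0, 0) *
    (ExteriorAlgebra.ι ℚ (0, Finsupp.single i 1, 0) *
      ExteriorAlgebra.ι ℚ (0, 0, Finsupp.single (leaf i) 1))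

theorem inv_tripleLeaf (i : I) : inv _ (tripleLeaf i) = -tripleLeaf i := by
  simp [tripleLeaf]

theorem map_tripleLeaf (f : I → J) (i : I) :
    ExteriorAlgebra.map (TripleSpace.map f) (tripleLeaf i) = tripleLeaf (f i) := by
  simp [tripleLeaf, TripleSpace.map]

/-- The coaction of a planar tree: the leaves are copied, the inner vertices act by the bracket. -/
def PlanarTree.triple : PlanarTree I → ExteriorAlgebra ℚ (TripleSpace I)
  | .leaf i => tripleLeaf i
  | .node S T => bracket (TripleSpace.graft I) S.triple T.triple

theorem PlanarTree.inv_triple (T : PlanarTree I) : inv _ T.triple = -T.triple := by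
  induction T with
  | leaf i => exact inv_tripleLeaf i
  | node S T hS hT => simp [PlanarTree.triple, ExteriorAlgebra.inv_bracket, hS, hT]

/-- A leaf goes to a product of three vectors and a bracket of odd elements is odd, so all images
are odd, and on odd elements the bracket is symmetric. No further identity is needed, as `∨` is only
commutative. -/
theorem PlanarTree.triple_flip {S T : PlanarTree I} (h : PlanarTree.Flip S T) :
    S.triple = T.triple := by
  induction h with
  | swap S T =>
    exact ExteriorAlgebra.bracket_comm_of_odd _ TripleSpace.graft_comm S.inv_triple T.inv_triple
  | left T _ ih => simp [PlanarTree.triple, ih]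
  | right S _ ih => simp [PlanarTree.triple, ih]

namespace BinTree

/-- The coaction of a tree. -/
def triple : BinTree I → ExteriorAlgebra ℚ (TripleSpace I) :=
  Quot.lift PlanarTree.triple fun _ _ h => PlanarTree.triple_flip h

theorem triple_leaf (i : I) : (leaf i).triple = tripleLeaf i := rfl

theorem triple_vee (S T : BinTree I) :
    (S.vee T).triple = bracket (TripleSpace.graft I) S.triple T.triple := by
  induction S using Quot.ind
  induction T using Quot.ind
  rfl

theorem inv_triple (T : BinTree I) : inv _ T.triple = -T.triple := by
  induction T using Quot.ind
  exact PlanarTree.inv_triple _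

theorem triple_relabel (f : I → J) (T : BinTree I) :
    (relabel f T).triple = ExteriorAlgebra.map (TripleSpace.map f) T.triple := by
  induction T using BinTree.induction with
  | leaf i => rw [relabel_leaf, triple_leaf, triple_leaf, map_tripleLeaf]
  | vee S T hS hT =>
    rw [relabel_vee, triple_vee, triple_vee, hS, hT,
      ExteriorAlgebra.map_bracket _ _ _ (TripleSpace.map_graft f)]

end BinTree

theorem inv_linearCombination_triple (t : BinTree I →₀ ℚ) :
    inv _ (Finsupp.linearCombination ℚ BinTree.triple t) =
      -Finsupp.linearCombination ℚ BinTree.triple t := by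
  induction t using Finsupp.induction_linear with
  | zero => simp
  | add s t hs ht => simp only [map_add, hs, ht]; abel
  | single T c => simp [inv_triple]

/-- The multiplicative extension of the coaction to forests. -/
def tripleHom (I : Type) :
    ExteriorAlgebra ℚ (BinTree I →₀ ℚ) →ₐ[ℚ] ExteriorAlgebra ℚ (TripleSpace I) :=
  ExteriorAlgebra.lift ℚ ⟨Finsupp.linearCombination ℚ BinTree.triple, fun t =>
    ExteriorAlgebra.mul_self_of_odd (inv_linearCombination_triple t)⟩

theorem tripleHom_ι (t : BinTree I →₀ ℚ) :
    tripleHom I (ExteriorAlgebra.ι ℚ t) = Finsupp.linearCombination ℚ BinTree.triple t :=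
  ExteriorAlgebra.lift_ι_apply _ _ _ _

theorem tripleHom_tree (T : BinTree I) : tripleHom I (tree T) = T.triple := by
  rw [tree, tripleHom_ι, Finsupp.linearCombination_single, one_smul]

theorem tripleHom_inv (a : ExteriorAlgebra ℚ (BinTree I →₀ ℚ)) :
    tripleHom I (inv _ a) = inv _ (tripleHom I a) := by
  induction a using ExteriorAlgebra.ι_mul_induction with
  | one => simp
  | smul c a h => simp [h]
  | add a b ha hb => simp [ha, hb]
  | mul x a h => simp [tripleHom_ι, inv_linearCombination_triple, h]

theorem tripleHom_forestMap (f : I → J) (a : ExteriorAlgebra ℚ (BinTree I →₀ ℚ)) :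
    tripleHom J (forestMap f a) = ExteriorAlgebra.map (TripleSpace.map f) (tripleHom I a) := by
  have h : ∀ t : BinTree I →₀ ℚ, Finsupp.linearCombination ℚ BinTree.triple
      (Finsupp.lmapDomain ℚ ℚ (relabel f) t) = ExteriorAlgebra.map (TripleSpace.map f)
        (Finsupp.linearCombination ℚ BinTree.triple t) := by
    intro t
    induction t using Finsupp.induction_linear with
    | zero => simp
    | add s t hs ht => simp only [map_add, hs, ht]
    | single T c => simp [triple_relabel]
  induction a using ExteriorAlgebra.ι_mul_induction with
  | one => simp
  | smul c a h => simp [h]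
  | add a b ha hb => simp [ha, hb]
  | mul x a ih =>
    rw [map_mul, map_mul, map_mul, map_mul, ih, tripleHom_ι, ← h, forestMap,
      ExteriorAlgebra.map_apply_ι, tripleHom_ι]

/-- Because `S.triple` is odd, the bracket with it is an even derivation, as is `graftDer S`. Both
sides thus satisfy the same Leibniz rule, and they agree on trees by the definition of the coaction.
-/
theorem tripleHom_graftDer (S : BinTree I) (a : ExteriorAlgebra ℚ (BinTree I →₀ ℚ)) :
    tripleHom I (graftDer S a) = bracket (TripleSpace.graft I) S.triple (tripleHom I a) := by
  have h : ∀ t : BinTree I →₀ ℚ, Finsupp.linearCombination ℚ BinTree.triple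
      (graft I (Finsupp.single S 1) t) = bracket (TripleSpace.graft I) S.triple
        (Finsupp.linearCombination ℚ BinTree.triple t) := by
    intro t
    induction t using Finsupp.induction_linear with
    | zero => simp
    | add s t hs ht => simp only [map_add, hs, ht]
    | single T c =>
      have hc : Finsupp.single T c = c • Finsupp.single T (1 : ℚ) := by simp
      rw [hc]
      simp only [map_smul, graft_single, Finsupp.linearCombination_single, one_smul, triple_vee]
  induction a using ExteriorAlgebra.ι_mul_induction with
  | one => simp [graftDer, ExteriorAlgebra.bracket_apply_one]
  | smul c a h => simp [h]
  | add a b ha hb => simp [ha, hb]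
  | mul x a ih =>
    rw [graftDer] at ih ⊢
    rw [derivation_ι_mul, map_add, map_mul, map_mul, map_mul, ih, tripleHom_ι, tripleHom_ι, h,
      ExteriorAlgebra.bracket_mul_of_odd _ S.inv_triple]

/-- The tensor product of the three exterior algebras. -/
abbrev TripleAlgebra : PreOperad := ForestAlgebra.tensor (LabelAlgebra.tensor ForestAlgebra)

/-- The pure tensors. -/
def pureTriple [Fintype I] [Nonempty I] (x : ExteriorAlgebra ℚ (BinTree I →₀ ℚ))
    (y : ExteriorAlgebra ℚ (I →₀ ℚ)) (z : ExteriorAlgebra ℚ (BinTree I →₀ ℚ)) :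
    TripleAlgebra.obj I :=
  PreOperad.tm _ _ I x (PreOperad.tm LabelAlgebra ForestAlgebra I y z)

section PureTriple

variable [Fintype I] [Nonempty I] (x : ExteriorAlgebra ℚ (BinTree I →₀ ℚ))
    (y : ExteriorAlgebra ℚ (I →₀ ℚ)) (z : ExteriorAlgebra ℚ (BinTree I →₀ ℚ))

theorem pureTriple_neg_left : pureTriple (-x) y z = -pureTriple x y z :=
  LinearMap.map_neg₂ (PreOperad.tm ForestAlgebra (LabelAlgebra.tensor ForestAlgebra) I) _ _

theorem pureTriple_zero_left : pureTriple 0 y z = 0 :=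
  LinearMap.map_zero₂ (PreOperad.tm ForestAlgebra (LabelAlgebra.tensor ForestAlgebra) I) _

theorem pureTriple_neg_mid : pureTriple x (-y) z = -pureTriple x y z :=
  (congrArg (PreOperad.tm ForestAlgebra (LabelAlgebra.tensor ForestAlgebra) I x)
    (LinearMap.map_neg₂ (PreOperad.tm LabelAlgebra ForestAlgebra I) y z)).trans
    (map_neg (PreOperad.tm ForestAlgebra (LabelAlgebra.tensor ForestAlgebra) I x) _)

theorem pureTriple_zero_mid : pureTriple x 0 z = 0 :=
  (congrArg (PreOperad.tm ForestAlgebra (LabelAlgebra.tensor ForestAlgebra) I x)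
    (LinearMap.map_zero₂ (PreOperad.tm LabelAlgebra ForestAlgebra I) z)).trans
    (map_zero (PreOperad.tm ForestAlgebra (LabelAlgebra.tensor ForestAlgebra) I x))

theorem pureTriple_zero_right : pureTriple x y 0 = 0 :=
  (congrArg (PreOperad.tm ForestAlgebra (LabelAlgebra.tensor ForestAlgebra) I x)
    (map_zero (PreOperad.tm LabelAlgebra ForestAlgebra I y))).trans
    (map_zero (PreOperad.tm ForestAlgebra (LabelAlgebra.tensor ForestAlgebra) I x))

theorem tripleAction_base : tripleAction.base I = pureTriple 1 1 1 := rfl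

theorem par_tripleAction_base :
    TripleAlgebra.par I (tripleAction.base I) = -tripleAction.base I := by
  have h : TripleAlgebra.par I (tripleAction.base I) =
      pureTriple (-inv _ 1) (-inv _ 1) (-inv (BinTree I →₀ ℚ) 1) := rfl
  rw [h, tripleAction_base, map_one, map_one, pureTriple_neg_left, pureTriple_neg_mid, neg_neg]
  exact (congrArg (PreOperad.tm ForestAlgebra (LabelAlgebra.tensor ForestAlgebra) I
    (1 : ExteriorAlgebra ℚ (BinTree I →₀ ℚ))) (map_neg (PreOperad.tm LabelAlgebra ForestAlgebra I
      (1 : ExteriorAlgebra ℚ (I →₀ ℚ))) _)).trans (map_neg (PreOperad.tm ForestAlgebra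
        (LabelAlgebra.tensor ForestAlgebra) I (1 : ExteriorAlgebra ℚ (BinTree I →₀ ℚ))) _)

/-- With its three specializations below, this fixes the signs needed to compute the coaction on
leaves and on the generators. -/
theorem tripleAction_pureTriple (v : TripleSpace I) :
    tripleAction.m I v (pureTriple x y z) = pureTriple (ExteriorAlgebra.ι ℚ v.1 * x) y z -
      (pureTriple (-inv _ x) (ExteriorAlgebra.ι ℚ v.2.1 * y) z -
        pureTriple (-inv _ x) (-inv _ y) (ExteriorAlgebra.ι ℚ v.2.2 * z)) :=
  congrArg (fun t => pureTriple (ExteriorAlgebra.ι ℚ v.1 * x) y z - t)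
    (map_sub (PreOperad.tm ForestAlgebra (LabelAlgebra.tensor ForestAlgebra) I
      (-inv (BinTree I →₀ ℚ) x)) _ _)

theorem tripleAction_left (v : BinTree I →₀ ℚ) :
    tripleAction.m I (v, 0, 0) (pureTriple x y z) =
      pureTriple (ExteriorAlgebra.ι ℚ v * x) y z := by
  rw [tripleAction_pureTriple, map_zero, map_zero, zero_mul, zero_mul, pureTriple_zero_mid,
    pureTriple_zero_right, sub_zero, sub_zero]

theorem tripleAction_mid (v : I →₀ ℚ) :
    tripleAction.m I (0, v, 0) (pureTriple x y z) =
      pureTriple (inv _ x) (ExteriorAlgebra.ι ℚ v * y) z := by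
  rw [tripleAction_pureTriple, map_zero, zero_mul, zero_mul, pureTriple_zero_left,
    pureTriple_zero_right, pureTriple_neg_left, sub_zero, zero_sub, neg_neg]

theorem tripleAction_right (v : BinTree I →₀ ℚ) :
    tripleAction.m I (0, 0, v) (pureTriple x y z) =
      pureTriple (inv _ x) (inv _ y) (ExteriorAlgebra.ι ℚ v * z) := by
  rw [tripleAction_pureTriple, map_zero, map_zero, zero_mul, zero_mul, pureTriple_zero_left,
    pureTriple_zero_mid, pureTriple_neg_left, pureTriple_neg_mid, zero_sub, zero_sub, neg_neg,
    neg_neg]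

end PureTriple

/-- The vectors act from right to left on `1 ⊗ 1 ⊗ 1`: each meets only units in the factors to its
left, so there is no sign. -/
theorem eval_tripleLeaf [Fintype I] [Nonempty I] (i : I) :
    tripleAction.eval I (tripleLeaf i) = pureTriple (tree (leaf i))
      (ExteriorAlgebra.ι ℚ (Finsupp.single i 1)) (tree (leaf i)) := by
  rw [tripleLeaf, tripleAction.eval_ι_mul, tripleAction.eval_ι_mul, tripleAction.eval_ι,
    tripleAction_base, tripleAction_right, tripleAction_mid, tripleAction_left]
  simp [tree]

/-- The core of the construction. The leaf `⋆` evaluates to the tensor product of the three unmarked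
stars, through which composition is a relabelling. At a vertex `S ∨ T`, the bracket with `S.triple`
leaves the composition on one side and corresponds to `D_S` on the other. -/
theorem comp_eval_triple [Fintype I] [Fintype J] [Nonempty J] {T : BinTree (Option I)}
    {k : Multiset I} (hT : OneStar T k) (y : ExteriorAlgebra ℚ (BinTree J →₀ ℚ)) :
    TripleAlgebra.comp (tripleAction.eval _ T.triple) (tripleAction.eval _ (tripleHom J y)) =
      tripleAction.eval _ (tripleHom _ (subst I J T y)) := by
  induction hT with
  | star =>
    have h : tripleAction.eval (Option I) (leaf (none : Option I)).triple = tripleAction.star I := by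
      rw [triple_leaf, eval_tripleLeaf]
      rfl
    rw [h, tripleAction.comp_star_eval, subst_leaf_none, AlgHom.toLinearMap_apply,
      tripleHom_forestMap]
  | vee S _ ih =>
    rw [triple_vee, triple_relabel, tripleAction.comp_eval_bracket ih, subst_vee_some,
      tripleHom_graftDer, triple_relabel]

theorem comp_eval_tripleHom [Fintype I] [Fintype J] [Nonempty J]
    {x : ExteriorAlgebra ℚ (BinTree (Option I) →₀ ℚ)} (hx : x ∈ forestSpace (Option I))
    (y : ExteriorAlgebra ℚ (BinTree J →₀ ℚ)) :
    TripleAlgebra.comp (tripleAction.eval _ (tripleHom _ x)) (tripleAction.eval _ (tripleHom J y)) =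
      tripleAction.eval _ (tripleHom _ (forestComp I J x y)) := by
  rw [forestSpace, univ_val_option] at hx
  refine forest_star_induction ?_ ?_ ?_ (fun L T l hT hL => ?_) hx
  · simp
  · intro c a h
    simp only [map_smul, LinearMap.smul_apply, h]
  · intro a b ha hb
    simp only [map_add, LinearMap.add_apply, ha, hb]
  · rw [map_mul, tripleHom_tree, tripleHom_forestMap,
      tripleAction.comp_eval_mul (comp_eval_triple hT y), forestComp_mul_tree,
      map_mul (tripleHom _),
      tripleHom_forestMap]

/-- The coaction of the operad `B`. -/
def BOperad.coaction : PreOperad.SuperHom BOperad TripleAlgebra where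
  app I _ _ := tripleAction.eval I ∘ₗ (tripleHom I).toLinearMap ∘ₗ BOperad.val I
  app_par I _ _ x := by
    change tripleAction.eval I (tripleHom I (-inv _ (BOperad.val I x))) =
      TripleAlgebra.par I (tripleAction.eval I (tripleHom I (BOperad.val I x)))
    rw [map_neg, map_neg, tripleHom_inv, tripleAction.eval_inv par_tripleAction_base, neg_neg]
  app_map {I J} _ _ _ _ e x := by
    change tripleAction.eval J (tripleHom J (forestMap e (BOperad.val I x))) = _
    rw [tripleHom_forestMap, tripleAction.eval_map]
    rfl
  app_one := by
    change tripleAction.eval Unit (tripleHom Unit (BOperad.val Unit BOperad.one)) = _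
    rw [BOperad.val_one, tripleHom_tree, triple_leaf, eval_tripleLeaf]
    rfl
  app_comp x y := (comp_eval_tripleHom (BOperad.val_mem x) _).symm

end Coaction

/-! ### The coproduct of the Bessel operad -/

namespace PreOperad

variable {P Q R : PreOperad}

/-- A morphism, after regrading its source. -/
def SuperHom.ofRegrade (φ : SuperHom P Q) : SuperHom P.regrade Q where
  app := φ.app
  app_par := φ.app_par
  app_map := φ.app_map
  app_one := φ.app_one
  app_comp := φ.app_comp

end PreOperad

namespace Bess

open PreOperad

/-- The tensor product of the exterior algebras that contains the Bessel operad. -/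
abbrev Ambient : PreOperad := LabelAlgebra.tensor ForestAlgebra

theorem ambient_parInvolutive : Ambient.ParInvolutive :=
  LabelAlgebra.parInvolutive.tensor ForestAlgebra.parInvolutive

/-- The inclusion of the Bessel operad in the tensor product of exterior algebras. -/
def incl : SuperHom Bess Ambient := (DetOperad.incl.tensor BOperad.incl).ofRegrade

/-- The associativity isomorphism. -/
def reassoc : SuperHom (Ambient.tensor Ambient) (LabelAlgebra.tensor TripleAlgebra) :=
  SuperHom.assoc LabelAlgebra.parInvolutive ForestAlgebra.parInvolutive ambient_parInvolutive

theorem reassoc_bijective (I : Type) [Fintype I] [Nonempty I] :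
    Function.Bijective (reassoc.app I) :=
  (SuperHom.assocEquiv LabelAlgebra ForestAlgebra Ambient I).bijective

/-- The coproduct, with values in a tensor product of exterior algebras. -/
def ambientCoproduct : SuperHom Bess (Ambient.tensor Ambient) :=
  (DetOperad.incl.tensor BOperad.coaction).ofRegrade.trans (reassoc.symm reassoc_bijective)

theorem incl_injective (I : Type) [Fintype I] [Nonempty I] : Function.Injective (incl.app I) :=
  TensorProduct.map_injective_of_flat_flat _ _ DetOperad.val_injective BOperad.val_injective

theorem incl_tensor_injective (I : Type) [Fintype I] [Nonempty I] :
    Function.Injective ((incl.tensor incl).app I) :=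
  TensorProduct.map_injective_of_flat_flat _ _ (incl_injective I) (incl_injective I)

/-- Values of the coproduct are recognized by their image under the associator, so its inverse never
has to be computed. -/
theorem ambientCoproduct_tmul {I : Type} [Fintype I] [Nonempty I] (d : DetOperad.obj I)
    (f : BOperad.obj I) {x : (Ambient.tensor Ambient).obj I}
    (h : reassoc.app I x = tm LabelAlgebra TripleAlgebra I (DetOperad.val I d)
      (BOperad.coaction.app I f)) :
    ambientCoproduct.app I (tmul I d f) = x := by
  have h1 : ambientCoproduct.app I (tmul I d f) = (reassoc.symm reassoc_bijective).app I
      (tm LabelAlgebra TripleAlgebra I (DetOperad.val I d) (BOperad.coaction.app I f)) := rfl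
  rw [h1, ← h, SuperHom.symm_app]

/-- Sorting the six vectors of the two leaves by type costs one sign: the second tree moves past two
vectors and the second label past one. This sign turns `0 ∧ 1` into `1 ∧ 0`, the orientation in `E`.
-/
theorem coaction_e : BOperad.coaction.app (Fin 2) e = pureTriple (BOperad.val _ e)
    (wedge [1, 0]) (BOperad.val _ e) := by
  have h : BOperad.val (Fin 2) e = tree (leaf 0) * tree (leaf 1) := by
    change wedge [leaf 0, leaf 1] = _
    simp [wedge, tree]
  change tripleAction.eval _ (tripleHom _ (BOperad.val _ e)) = _
  rw [h, map_mul, tripleHom_tree, tripleHom_tree, triple_leaf, tripleLeaf, mul_assoc, mul_assoc,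
    tripleAction.eval_ι_mul, tripleAction.eval_ι_mul, tripleAction.eval_ι_mul, triple_leaf,
    eval_tripleLeaf, tripleAction_right, tripleAction_mid, tripleAction_left]
  simp only [ExteriorAlgebra.inv_inv, ExteriorAlgebra.inv_ι, mul_neg]
  rw [← ExteriorAlgebra.ι_mul_ι]
  simp [wedge, tree]

/-- Only two trees of the same copy can be grafted on each other, so two of the nine terms of the
biderivation survive: the third copies or the first copies are joined. They become the two terms of
the coproduct of `Ω`. -/
theorem bracket_tripleLeaf {I : Type} (i j : I) :
    bracket (TripleSpace.graft I) (tripleLeaf i) (tripleLeaf j) =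
      ExteriorAlgebra.ι ℚ (Finsupp.single (leaf i) 1, 0, 0) *
        (ExteriorAlgebra.ι ℚ (0, Finsupp.single i 1, 0) *
          (ExteriorAlgebra.ι ℚ (Finsupp.single (leaf j) 1, 0, 0) *
            (ExteriorAlgebra.ι ℚ (0, Finsupp.single j 1, 0) *
              ExteriorAlgebra.ι ℚ (0, 0, Finsupp.single ((leaf i).vee (leaf j)) 1)))) +
      ExteriorAlgebra.ι ℚ (0, Finsupp.single i 1, 0) *
        (ExteriorAlgebra.ι ℚ (0, 0, Finsupp.single (leaf i) 1) *
          (ExteriorAlgebra.ι ℚ (Finsupp.single ((leaf i).vee (leaf j)) 1, 0, 0) *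
            (ExteriorAlgebra.ι ℚ (0, Finsupp.single j 1, 0) *
              ExteriorAlgebra.ι ℚ (0, 0, Finsupp.single (leaf j) 1)))) := by
  have h0 : ExteriorAlgebra.ι ℚ ((0, 0, 0) : TripleSpace I) = 0 := map_zero _
  simp [tripleLeaf, ExteriorAlgebra.bracket_ι_mul, ExteriorAlgebra.bracket_ι, derivation_ι_mul,
    TripleSpace.graft_apply, mul_assoc, h0]

theorem coaction_ω : BOperad.coaction.app (Fin 2) ω =
    pureTriple (BOperad.val _ e) (wedge [1, 0]) (BOperad.val _ ω) +
      pureTriple (BOperad.val _ ω) (wedge [1, 0]) (BOperad.val _ e) := by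
  have h : BOperad.val (Fin 2) e = tree (leaf 0) * tree (leaf 1) := by
    change wedge [leaf 0, leaf 1] = _
    simp [wedge, tree]
  have h' : BOperad.val (Fin 2) ω = tree ((leaf 0).vee (leaf 1)) := by
    change wedge [(leaf 0).vee (leaf 1)] = _
    simp [wedge, tree]
  change tripleAction.eval _ (tripleHom _ (BOperad.val _ ω)) = _
  rw [h', h, tripleHom_tree, triple_vee, triple_leaf, triple_leaf, bracket_tripleLeaf, map_add]
  simp only [tripleAction.eval_ι_mul, tripleAction.eval_ι, tripleAction_base, tripleAction_right,
    tripleAction_mid, tripleAction_left, map_one, mul_one, ExteriorAlgebra.inv_ι, mul_neg]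
  rw [pureTriple_neg_left, ← pureTriple_neg_mid, ← ExteriorAlgebra.ι_mul_ι]
  simp [wedge, tree]

theorem ambientCoproduct_E :
    ambientCoproduct.app (Fin 2) E = (incl.tensor incl).app _ (tm Bess Bess _ E E) := by
  refine ambientCoproduct_tmul _ _ ?_
  rw [coaction_e]
  rfl

theorem orient_swap : orient 0 1 (by decide) = -orient 1 0 (by decide) := by
  apply DetOperad.val_injective
  rw [map_neg]
  change wedge [0, 1] = -wedge [1, 0]
  simp [wedge, ExteriorAlgebra.ι_mul_ι (Finsupp.single (0 : Fin 2) (1 : ℚ))]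

/-- Reversing both orientations changes nothing. The coproduct keeps the orientation `0 ∧ 1` of `Ω`
in the first factor and the coaction contributes `1 ∧ 0` to the second, which is the right-hand
form. -/
theorem tm_E_Ω : tm Bess Bess _ E Ω =
    tm Bess Bess _ (tmul _ (orient 0 1 (by decide)) e) (tmul _ (orient 1 0 (by decide)) ω) := by
  have h1 : tmul _ (orient 0 1 (by decide)) e = -E := by
    rw [orient_swap]
    exact LinearMap.map_neg₂ _ _ _
  have h2 : Ω = -tmul _ (orient 1 0 (by decide)) ω := by
    refine Eq.trans ?_ (LinearMap.map_neg₂ (tmul _) (orient 1 0 (by decide)) ω)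
    rw [← orient_swap]
    rfl
  rw [h1, h2, map_neg, map_neg, LinearMap.neg_apply]

theorem ambientCoproduct_Ω :
    ambientCoproduct.app (Fin 2) Ω =
      (incl.tensor incl).app _ (tm Bess Bess _ E Ω + tm Bess Bess _ Ω E) := by
  refine ambientCoproduct_tmul _ _ ?_
  rw [coaction_ω, map_add, map_add, map_add, tm_E_Ω]
  rfl

/-- The range of a morphism is closed under the operad structure. This is how the coproduct and the
counit, built in larger operads, are brought back to `Bess ⊗ Bess` and to `Com`. -/
theorem mem_range_of_generators {Q R : PreOperad} (φ : SuperHom Bess R) (ψ : SuperHom Q R)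
    (hE : φ.app (Fin 2) E ∈ LinearMap.range (ψ.app (Fin 2)))
    (hΩ : φ.app (Fin 2) Ω ∈ LinearMap.range (ψ.app (Fin 2)))
    (I : Type) [Fintype I] [Nonempty I] (x : Bess.obj I) :
    φ.app I x ∈ LinearMap.range (ψ.app I) := by
  have hK : IsClosed fun I _ _ => (LinearMap.range (ψ.app I)).comap (φ.app I) := {
    par := by
      rintro I _ _ x ⟨y, hy⟩
      exact ⟨_, (ψ.app_par I y).trans ((congrArg _ hy).trans (φ.app_par I x).symm)⟩
    map := by
      rintro I J _ _ _ _ e x ⟨y, hy⟩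
      exact ⟨_, (ψ.app_map e y).trans ((congrArg _ hy).trans (φ.app_map e x).symm)⟩
    comp := by
      rintro I J _ _ _ x ⟨y, hy⟩ x' ⟨y', hy'⟩
      exact ⟨_, (ψ.app_comp y y').trans ((congrArg₂ (fun a b => R.comp a b) hy hy').trans
        (φ.app_comp x x').symm)⟩
    one := ⟨_, ψ.app_one.trans φ.app_one.symm⟩
    E := hE
    Ω := hΩ }
  exact hK.mem x

/-- The coproduct. -/
def superCoproduct : SuperHom Bess (Bess.tensor Bess) :=
  ambientCoproduct.lift (incl.tensor incl) incl_tensor_injective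
    (mem_range_of_generators _ _ ⟨_, ambientCoproduct_E.symm⟩ ⟨_, ambientCoproduct_Ω.symm⟩)

theorem superCoproduct_E : superCoproduct.app (Fin 2) E = tm Bess Bess _ E E := by
  apply incl_tensor_injective
  rw [superCoproduct, SuperHom.lift_app, ambientCoproduct_E]

theorem superCoproduct_Ω :
    superCoproduct.app (Fin 2) Ω = tm Bess Bess _ E Ω + tm Bess Bess _ Ω E := by
  apply incl_tensor_injective
  rw [superCoproduct, SuperHom.lift_app, ambientCoproduct_Ω]

/-! ### Degrees, uniqueness, coassociativity and cocommutativity of the coproduct -/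

theorem orient_mem (i j : Fin 2) (h) : orient i j h ∈ DetOperad.gr (Fin 2) 1 := by
  rw [DetOperad.gr_eq, if_pos (by simp)]
  trivial

theorem E_mem : E ∈ Bess.gr (Fin 2) 0 := by
  have he : e ∈ BOperad.gr (Fin 2) 1 :=
    BOperad.mem_gr_of_wedge [leaf 0, leaf 1] (by simp) rfl rfl
  change _ ∈ (DetOperad.tensor BOperad).gr (Fin 2) (2 * (Fintype.card (Fin 2) : ℤ) - 2 - 0)
  rw [show 2 * (Fintype.card (Fin 2) : ℤ) - 2 - 0 = 1 + 1 by simp]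
  exact tm_mem (orient_mem 1 0 (by decide)) he

theorem Ω_mem : Ω ∈ Bess.gr (Fin 2) 1 := by
  have he : ω ∈ BOperad.gr (Fin 2) 0 :=
    BOperad.mem_gr_of_wedge [(leaf 0).vee (leaf 1)] (by simp) rfl rfl
  change _ ∈ (DetOperad.tensor BOperad).gr (Fin 2) (2 * (Fintype.card (Fin 2) : ℤ) - 2 - 1)
  rw [show 2 * (Fintype.card (Fin 2) : ℤ) - 2 - 1 = 1 + 0 by simp]
  exact tm_mem (orient_mem 0 1 (by decide)) he

theorem scaling_E : isOperad.scaling _ E = E := by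
  rw [isOperad.scaling_apply 0 E E_mem, zpow_zero, one_smul]

theorem scaling_Ω : isOperad.scaling _ Ω = (2 : ℚ) • Ω := by
  rw [isOperad.scaling_apply 1 Ω Ω_mem, zpow_one]

/-- The scaling operators form an endomorphism of `Bess`, so both sides are morphisms and the
generators suffice. Preservation of degrees follows without any inspection of the coaction on
general forests. -/
theorem superCoproduct_scaling {I : Type} [Fintype I] [Nonempty I] (x : Bess.obj I) :
    tensorLin (isOperad.scaling I) (isOperad.scaling I) (superCoproduct.app I x) =
      superCoproduct.app I (isOperad.scaling I x) := by
  refine superHom_ext (superCoproduct.trans ((SuperHom.scaling isOperad).tensor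
    (SuperHom.scaling isOperad))) ((SuperHom.scaling isOperad).trans superCoproduct) ?_ ?_ x
  · change tensorLin (isOperad.scaling _) (isOperad.scaling _) (superCoproduct.app _ E) =
      superCoproduct.app _ (isOperad.scaling _ E)
    rw [scaling_E, superCoproduct_E, tensorLin_tm, scaling_E]
  · change tensorLin (isOperad.scaling _) (isOperad.scaling _) (superCoproduct.app _ Ω) =
      superCoproduct.app _ (isOperad.scaling _ Ω)
    rw [scaling_Ω, map_smul, superCoproduct_Ω, map_add, tensorLin_tm, tensorLin_tm, scaling_E,
      scaling_Ω, map_smul, map_smul, LinearMap.smul_apply, smul_add]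

theorem superCoproduct_mem {I : Type} [Fintype I] [Nonempty I] (n : ℤ) (x : Bess.obj I)
    (hx : x ∈ Bess.gr I n) : superCoproduct.app I x ∈ (Bess.tensor Bess).gr I n := by
  refine mem_of_scaling ((isOperad.tensor isOperad).gr_internal I)
    (isOperad.tensor_scaling isOperad) ?_
  rw [superCoproduct_scaling, isOperad.scaling_apply n x hx, map_smul]

/-- The coproduct, as a morphism of operads. -/
def coproduct : Hom Bess (Bess.tensor Bess) where
  app := superCoproduct.app
  app_mem _ _ _ := superCoproduct_mem
  app_map := superCoproduct.app_map
  app_one := superCoproduct.app_one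
  app_comp := superCoproduct.app_comp

theorem coproduct_onGenerators : OnGenerators coproduct := by
  intro I _ _ ij
  have hE : coproduct.coprod I (Egen ij) = (Bess.tensor Bess).map ij (superCoproduct.app _ E) :=
    superCoproduct.app_map ij E
  have hΩ : coproduct.coprod I (Ωgen ij) = (Bess.tensor Bess).map ij (superCoproduct.app _ Ω) :=
    superCoproduct.app_map ij Ω
  constructor
  · rw [hE, superCoproduct_E]
    rfl
  · rw [hΩ, superCoproduct_Ω, map_add]
    rfl

theorem coproduct_unique (Δ : Hom Bess (Bess.tensor Bess)) (hΔ : OnGenerators Δ) :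
    Δ = coproduct := by
  have hE := (hΔ (Fin 2) (Equiv.refl _)).1
  have hΩ := (hΔ (Fin 2) (Equiv.refl _)).2
  rw [Egen, isOperad.map_refl, LinearMap.id_apply] at hE
  rw [Egen, Ωgen, isOperad.map_refl, LinearMap.id_apply, LinearMap.id_apply] at hΩ
  ext I _ _ x
  exact superHom_ext (Δ.toSuperHom isOperad (isOperad.tensor isOperad)) superCoproduct
    (hE.trans superCoproduct_E.symm) (hΩ.trans superCoproduct_Ω.symm) x

/-- The associator is a morphism of operads, so both iterated coproducts are morphisms. On `E` both
give `E ⊗ E ⊗ E`, and on `Ω` the sum over the three positions of `Ω` among factors `E`. -/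
theorem coproduct_coassociative : coproduct.Coassociative := by
  intro I _ _
  refine LinearMap.ext fun x => ?_
  have h := isOperad.parInvolutive
  refine superHom_ext ((superCoproduct.trans (superCoproduct.tensor (SuperHom.refl Bess))).trans
    (SuperHom.assoc h h h)) (superCoproduct.trans ((SuperHom.refl Bess).tensor superCoproduct))
    ?_ ?_ x
  · simp only [SuperHom.trans_app, superCoproduct_E, SuperHom.tensor_app_tm, SuperHom.refl_app]
    rfl
  · simp only [SuperHom.trans_app, superCoproduct_Ω, superCoproduct_E, map_add,
      SuperHom.tensor_app_tm, SuperHom.refl_app, LinearMap.add_apply]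
    rw [← add_assoc]
    rfl

/-- The Koszul symmetry is a morphism of operads. It fixes the values on the generators without
signs, because `E` has degree `0`. -/
theorem coproduct_cocommutative : coproduct.Cocommutative := by
  intro I _ _
  refine LinearMap.ext fun x => ?_
  refine superHom_ext (superCoproduct.trans (SuperHom.swap isOperad)) superCoproduct ?_ ?_ x
  · rw [SuperHom.trans_app, superCoproduct_E]
    exact (SuperHom.swapLin_of_mem isOperad E_mem E_mem).trans (by simp)
  · rw [SuperHom.trans_app, superCoproduct_Ω, map_add]
    refine (congrArg₂ (· + ·) (SuperHom.swapLin_of_mem isOperad E_mem Ω_mem)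
      (SuperHom.swapLin_of_mem isOperad Ω_mem E_mem)).trans ?_
    simp [add_comm]

end Bess

/-! ### The counit of the Bessel operad -/

section LeafPart

variable {I J : Type}

namespace BinTree

/-- The label of a tree without inner vertices; zero for the other trees. -/
def leafLabel : BinTree I → (I →₀ ℚ) :=
  Quot.lift (fun
    | .leaf i => Finsupp.single i 1
    | .node _ _ => 0) (by rintro _ _ (_ | _ | _) <;> rfl)

@[simp] theorem leafLabel_leaf (i : I) : (leaf i).leafLabel = Finsupp.single i 1 := rfl

@[simp] theorem leafLabel_vee (S T : BinTree I) : (S.vee T).leafLabel = 0 := by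
  induction S using Quot.ind
  induction T using Quot.ind
  rfl

theorem leafLabel_relabel (f : I → J) (T : BinTree I) :
    (relabel f T).leafLabel = Finsupp.lmapDomain ℚ ℚ f T.leafLabel := by
  induction T using BinTree.induction with
  | leaf i => simp
  | vee S T _ _ => simp

/-- The linear extension of `leafLabel`. -/
def leafPart (I : Type) : (BinTree I →₀ ℚ) →ₗ[ℚ] (I →₀ ℚ) :=
  Finsupp.linearCombination ℚ leafLabel

theorem leafPart_single (T : BinTree I) : leafPart I (Finsupp.single T 1) = T.leafLabel := by
  simp [leafPart]

theorem leafPart_map (f : I → J) : leafPart J ∘ₗ Finsupp.lmapDomain ℚ ℚ (relabel f) =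
    Finsupp.lmapDomain ℚ ℚ f ∘ₗ leafPart I := by
  ext T : 2
  simp [leafPart_single, leafLabel_relabel]

theorem leafPart_graft (s t : BinTree I →₀ ℚ) : leafPart I (graft I s t) = 0 := by
  have h : (graft I).compr₂ (leafPart I) = 0 := by
    ext S T : 4
    simp [leafPart_single]
  exact congrArg (fun g => g s t) h

/-- A grafted tree has an inner vertex, so the induced derivation on labels is zero. -/
theorem map_leafPart_derivation (s : BinTree I →₀ ℚ)
    (x : ExteriorAlgebra ℚ (BinTree I →₀ ℚ)) :
    ExteriorAlgebra.map (leafPart I) (derivation (graft I s) x) = 0 := by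
  rw [map_derivation (d' := 0) _ (fun t => leafPart_graft s t), ExteriorAlgebra.derivation_zero,
    LinearMap.zero_apply]

end BinTree

theorem map_leafPart_forestMap (f : I → J) (x : ExteriorAlgebra ℚ (BinTree I →₀ ℚ)) :
    ExteriorAlgebra.map (leafPart J) (forestMap f x) =
      ExteriorAlgebra.map (Finsupp.lmapDomain ℚ ℚ f) (ExteriorAlgebra.map (leafPart I) x) := by
  simp only [forestMap, ← AlgHom.comp_apply, ExteriorAlgebra.map_comp_map, leafPart_map]

/-- Composition never removes inner vertices: a forest that is discarded on either side yields only
discarded terms, and on forests without inner vertices the composition is that of orientations. -/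
theorem map_leafPart_forestComp (x : ExteriorAlgebra ℚ (BinTree (Option I) →₀ ℚ))
    (y : ExteriorAlgebra ℚ (BinTree J →₀ ℚ)) :
    ExteriorAlgebra.map (leafPart _) (forestComp I J x y) =
      detComp I J (ExteriorAlgebra.map (leafPart _) x) (ExteriorAlgebra.map (leafPart _) y) := by
  refine ExteriorAlgebra.map_insertion _ _ _ _ _ _ y _ (fun t => ?_) (fun t => ?_) x
  · induction t using Finsupp.induction_linear with
    | zero => simp
    | add s t hs ht => simp only [map_add, hs, ht]
    | single T c =>
      have hc : Finsupp.single T c = c • Finsupp.single T (1 : ℚ) := by simp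
      rw [hc]
      simp only [map_smul, leafPart_single, Finsupp.linearCombination_single, one_smul]
      congr 1
      induction T using BinTree.induction with
      | leaf o => rcases o with _ | i <;> simp [leafPart_single]
      | vee S T _ _ => simp [leafPart_graft]
  · induction t using Finsupp.induction_linear with
    | zero => simp
    | add s t hs ht => simp only [map_add, LinearMap.add_apply, hs, ht]
    | single T c =>
      have hc : Finsupp.single T c = c • Finsupp.single T (1 : ℚ) := by simp
      rw [hc]
      simp only [map_smul, LinearMap.smul_apply, leafPart_single,
        Finsupp.linearCombination_single, one_smul]
      congr 1
      induction T using BinTree.induction with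
      | leaf o =>
        rcases o with _ | i
        · simp [subst_leaf_none, map_leafPart_forestMap]
        · simp
      | vee S T _ _ => simp [subst_vee, map_leafPart_derivation]

/-- The morphism that keeps the trees without inner vertices. -/
def leafHom : PreOperad.SuperHom ForestAlgebra LabelAlgebra where
  app I _ _ := (ExteriorAlgebra.map (leafPart I)).toLinearMap
  app_par I _ _ (x : ExteriorAlgebra ℚ (BinTree I →₀ ℚ)) := by
    change ExteriorAlgebra.map _ (-inv _ x) = -inv _ (ExteriorAlgebra.map _ x)
    rw [map_neg, ExteriorAlgebra.map_inv]
  app_map e x := map_leafPart_forestMap e x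
  app_one := by
    change ExteriorAlgebra.map _ (tree (leaf ())) = _
    rw [tree, ExteriorAlgebra.map_apply_ι, leafPart_single]
    rfl
  app_comp x y := map_leafPart_forestComp x y

end LeafPart

/-! ### Non-vanishing of wedge products of distinct basis vectors -/

section Wedge

variable {X : Type}

theorem contractLeft_wedge {x : X} {L : List X} (h : x ∉ L) :
    CliffordAlgebra.contractLeft (Q := (0 : QuadraticForm ℚ (X →₀ ℚ))) (Finsupp.lapply x)
      (wedge L) = 0 := by
  classical
  induction L with
  | nil => exact CliffordAlgebra.contractLeft_one (Q := (0 : QuadraticForm ℚ (X →₀ ℚ))) _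
  | cons y L ih =>
    rw [List.mem_cons, not_or] at h
    rw [wedge_cons]
    refine (CliffordAlgebra.contractLeft_ι_mul (Q := (0 : QuadraticForm ℚ (X →₀ ℚ))) _ _ _).trans ?_
    rw [ih h.2]
    simp [Ne.symm h.1]

/-- Contraction with the coordinate of the first vector returns the product of the others, in which
that vector does not occur. -/
theorem wedge_ne_zero {L : List X} (h : L.Nodup) : wedge L ≠ 0 := by
  induction L with
  | nil => exact one_ne_zero
  | cons x L ih =>
    rw [List.nodup_cons] at h
    intro h0
    apply ih h.2
    have h1 := CliffordAlgebra.contractLeft_ι_mul (Q := (0 : QuadraticForm ℚ (X →₀ ℚ)))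
      (Finsupp.lapply x) (Finsupp.single x 1) (wedge L)
    rw [contractLeft_wedge h.1] at h1
    rw [wedge_cons] at h0
    replace h1 := (congrArg _ h0).symm.trans h1
    simpa using h1.symm

end Wedge

theorem Nat.choose_two_add (a b : ℕ) :
    (a + b).choose 2 = a.choose 2 + b.choose 2 + a * b := by
  induction a with
  | zero => simp
  | succ a ih =>
    rw [Nat.add_right_comm, Nat.choose_succ_succ' (a + b) 1, Nat.choose_succ_succ' a 1, ih,
      Nat.choose_one_right, Nat.choose_one_right]
    ring

/-! ### The operad `Com` and its embedding in a tensor square of exterior algebras -/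

open PreOperad

/-- The operad of commutative algebras. -/
def Com : PreOperad where
  obj _ _ _ := ℚ
  gr _ _ _ n := if n = 0 then ⊤ else ⊥
  par _ _ _ := LinearMap.id
  map _ := LinearMap.id
  one := (1 : ℚ)
  comp := LinearMap.mul ℚ ℚ

namespace Com

/-- An operation of `Com`, as a scalar. -/
def val (I : Type) [Fintype I] [Nonempty I] : Com.obj I →ₗ[ℚ] ℚ := LinearMap.id

theorem val_injective {I : Type} [Fintype I] [Nonempty I] : Function.Injective (val I) :=
  fun _ _ h => h

@[simp] theorem val_par {I : Type} [Fintype I] [Nonempty I] (x : Com.obj I) :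
    val I (Com.par I x) = val I x := rfl

@[simp] theorem val_map {I J : Type} [Fintype I] [Nonempty I] [Fintype J] [Nonempty J] (e : I ≃ J)
    (x : Com.obj I) : val J (Com.map e x) = val I x := rfl

@[simp] theorem val_one : val Unit Com.one = 1 := rfl

@[simp] theorem val_comp {I J : Type} [Fintype I] [Fintype J] [Nonempty J] (x : Com.obj (Option I))
    (y : Com.obj J) : val (I ⊕ J) (Com.comp x y) = val _ x * val J y := rfl

end Com

/-- A wedge product of labels, as an operation. -/
def labelWedge {I : Type} [Fintype I] [Nonempty I] (L : List I) : LabelAlgebra.obj I := wedge L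

/-- The element `(-1)^(n (n - 1) / 2) (x₁ ∧ ⋯ ∧ xₙ) ⊗ (x₁ ∧ ⋯ ∧ xₙ)`. -/
def wedgeSquare {I : Type} [Fintype I] [Nonempty I] (L : List I) :
    (LabelAlgebra.tensor LabelAlgebra).obj I :=
  (L.length.choose 2 : ℤ).negOnePow •
    tm LabelAlgebra LabelAlgebra I (labelWedge L) (labelWedge L)

section WedgeSquare

variable {I J : Type} [Fintype I] [Fintype J] [Nonempty J]

theorem labelWedge_perm {L L' : List J} (h : L.Perm L') :
    labelWedge L = labelWedge L' ∨ labelWedge L = -labelWedge L' := DetOperad.wedge_perm h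

theorem par_labelWedge (L : List J) :
    LabelAlgebra.par J (labelWedge L) = ((L.length : ℤ) + 1).negOnePow • labelWedge L := by
  change -inv _ (wedge L) = _
  rw [inv_wedge, Int.negOnePow_succ, Units.smul_def, Units.smul_def, Units.val_neg, neg_smul]
  rfl

theorem map_labelWedge [Nonempty I] (e : I ≃ J) (L : List I) :
    LabelAlgebra.map e (labelWedge L) = labelWedge (L.map e) := map_wedge e L

theorem comp_labelWedge (L : List I) (L' : List J) :
    LabelAlgebra.comp (labelWedge (L.map some ++ [none])) (labelWedge L') =
      labelWedge (L.map Sum.inl ++ L'.map Sum.inr) := DetOperad.detComp_wedge L L'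

/-- The sign of the permutation occurs twice; so `wedgeSquare` does not depend on the enumeration
and can serve as the value of a commutative operation. -/
theorem wedgeSquare_perm {L L' : List J} (h : L.Perm L') : wedgeSquare L = wedgeSquare L' := by
  rw [wedgeSquare, wedgeSquare, h.length_eq]
  rcases labelWedge_perm h with h | h <;> rw [h]
  rw [map_neg, map_neg, LinearMap.neg_apply, neg_neg]

theorem wedgeSquare_par (L : List J) :
    (LabelAlgebra.tensor LabelAlgebra).par J (wedgeSquare L) = wedgeSquare L := by
  rw [wedgeSquare, IsOperad.map_units_smul, tensor_par, par_labelWedge,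
    IsOperad.map_units_smul, IsOperad.map₂_units_smul, smul_smul ((L.length : ℤ) + 1).negOnePow,
    Int.units_mul_self, one_smul]

theorem wedgeSquare_map [Nonempty I] (e : I ≃ J) (L : List I) :
    (LabelAlgebra.tensor LabelAlgebra).map e (wedgeSquare L) = wedgeSquare (L.map e) := by
  rw [wedgeSquare, IsOperad.map_units_smul, tensor_map, map_labelWedge, wedgeSquare,
    List.length_map]

/-- With `a` and `b` the lengths of `L` and `L'`, the Koszul sign has exponent `a * b + a` modulo
`2`. Added to the exponents of the two factors, it gives that of a product of length `a + b`; this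
is the purpose of `(-1)^(n (n - 1) / 2)`. -/
theorem wedgeSquare_comp (L : List I) (L' : List J) :
    (LabelAlgebra.tensor LabelAlgebra).comp (wedgeSquare (L.map some ++ [none]))
      (wedgeSquare L') = wedgeSquare (L.map Sum.inl ++ L'.map Sum.inr) := by
  rw [wedgeSquare, wedgeSquare, IsOperad.map_units_smul, IsOperad.map₂_units_smul,
    tensor_comp_of_sign (par_labelWedge _) (par_labelWedge _), comp_labelWedge, wedgeSquare,
    smul_smul, smul_smul, ← Int.negOnePow_add, ← Int.negOnePow_add]
  congr 1
  simp only [List.length_append, List.length_map, List.length_singleton, Nat.choose_two_add]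
  rw [Int.negOnePow_eq_iff]
  refine ⟨(L.length : ℤ) + L'.length + 1, ?_⟩
  push_cast
  simp only [Nat.choose_succ_self, Nat.cast_zero]
  ring

/-- A linear form `f` with `f w ≠ 0` gives a form `f ⊗ f` with the value `(f w)^2` on `w ⊗ w`. -/
theorem wedgeSquare_ne_zero {L : List J} (h : L.Nodup) : wedgeSquare L ≠ 0 := by
  obtain ⟨f, hf⟩ := Module.Projective.exists_dual_ne_zero ℚ (wedge_ne_zero h)
  intro h0
  rw [wedgeSquare, smul_eq_zero_iff_eq] at h0
  have h1 : TensorProduct.lift ((LinearMap.mul ℚ ℚ).compl₁₂ f f) (wedge L ⊗ₜ[ℚ] wedge L) = 0 :=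
    (congrArg _ h0).trans (map_zero _)
  rw [TensorProduct.lift.tmul] at h1
  exact hf (mul_self_eq_zero.1 h1)

end WedgeSquare

/-- The elements `wedgeSquare`, for any enumeration of the labels, form a commutative operad. -/
def comHom : SuperHom Com (LabelAlgebra.tensor LabelAlgebra) where
  app I _ _ := (Com.val I).smulRight (wedgeSquare (Finset.univ : Finset I).toList)
  app_par I _ _ x := by
    rw [LinearMap.smulRight_apply, LinearMap.smulRight_apply, map_smul, wedgeSquare_par,
      Com.val_par]
  app_map {I J} _ _ _ _ e x := by
    rw [LinearMap.smulRight_apply, LinearMap.smulRight_apply, map_smul, wedgeSquare_map,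
      Com.val_map]
    congr 1
    refine wedgeSquare_perm ?_
    rw [← Multiset.coe_eq_coe, ← Multiset.map_coe, Finset.coe_toList, Finset.coe_toList,
      univ_val_equiv]
  app_one := by
    have h : labelWedge [()] = LabelAlgebra.one :=
      (wedge_cons () []).trans (mul_one (ExteriorAlgebra.ι ℚ (Finsupp.single () 1)))
    rw [LinearMap.smulRight_apply, Com.val_one, one_smul, Finset.univ_unique,
      Finset.toList_singleton, wedgeSquare, tensor_one]
    change (0 : ℤ).negOnePow • tm _ _ _ (labelWedge [()]) (labelWedge [()]) = _
    rw [Int.negOnePow_zero, one_smul, h]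
  app_comp {I J} _ _ _ x y := by
    have h : wedgeSquare (Finset.univ : Finset (Option I)).toList =
        wedgeSquare ((Finset.univ : Finset I).toList.map some ++ [none]) := by
      refine wedgeSquare_perm ?_
      rw [← Multiset.coe_eq_coe, ← Multiset.coe_add, ← Multiset.map_coe, Finset.coe_toList,
        Finset.coe_toList, univ_val_option, add_comm]
      rfl
    rw [LinearMap.smulRight_apply, LinearMap.smulRight_apply, LinearMap.smulRight_apply,
      map_smul, map_smul, LinearMap.smul_apply, smul_smul, Com.val_comp, h, wedgeSquare_comp,
      mul_comm]
    congr 1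
    refine wedgeSquare_perm ?_
    rw [← Multiset.coe_eq_coe, ← Multiset.coe_add, ← Multiset.map_coe, ← Multiset.map_coe,
      Finset.coe_toList, Finset.coe_toList, Finset.coe_toList, univ_val_sum]

theorem comHom_injective (I : Type) [Fintype I] [Nonempty I] :
    Function.Injective (comHom.app I) := fun _ _ h =>
  Com.val_injective (smul_left_injective ℚ (wedgeSquare_ne_zero (Finset.nodup_toList _)) h)

theorem comHom_fin_two (c : Com.obj (Fin 2)) : comHom.app (Fin 2) c =
    -(Com.val _ c • tm LabelAlgebra LabelAlgebra _ (labelWedge [(0 : Fin 2), 1])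
      (labelWedge [0, 1])) := by
  have h : wedgeSquare (Finset.univ : Finset (Fin 2)).toList = wedgeSquare [0, 1] := by
    refine wedgeSquare_perm ?_
    rw [← Multiset.coe_eq_coe, Finset.coe_toList]
    rfl
  rw [comHom, LinearMap.smulRight_apply, h, wedgeSquare]
  change _ • (1 : ℤ).negOnePow • _ = _
  rw [Int.negOnePow_one, Units.smul_def, Units.val_neg, neg_smul, Units.val_one, one_smul,
    smul_neg]

/-! ### The counit and its vanishing in nonzero degrees -/

namespace Bess

/-- The counit, with values in a tensor product of exterior algebras. -/
def ambientCounit : SuperHom Bess (LabelAlgebra.tensor LabelAlgebra) :=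
  (DetOperad.incl.tensor (BOperad.incl.trans leafHom)).ofRegrade

/-- The orientation `1 ∧ 0` in `E` is minus `0 ∧ 1`, and this is exactly the sign of `wedgeSquare`
for two labels. -/
theorem ambientCounit_E :
    ambientCounit.app (Fin 2) E = comHom.app (Fin 2) (1 : ℚ) := by
  have h : ambientCounit.app (Fin 2) E = tm LabelAlgebra LabelAlgebra _
      (DetOperad.incl.app _ (orient 1 0 (by decide)))
      (leafHom.app _ (wedge [leaf 0, leaf 1])) := rfl
  have h' : DetOperad.incl.app _ (orient 1 0 (by decide)) = -labelWedge [(0 : Fin 2), 1] := by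
    rw [← neg_eq_iff_eq_neg, ← map_neg, ← orient_swap]
    rfl
  have h'' : leafHom.app (Fin 2) (wedge [leaf 0, leaf 1]) = labelWedge [(0 : Fin 2), 1] := by
    change ExteriorAlgebra.map (leafPart (Fin 2)) (wedge [leaf 0, leaf 1]) = wedge [(0 : Fin 2), 1]
    simp [wedge, leafPart_single]
  rw [h, h', h'', map_neg, LinearMap.neg_apply]
  refine Eq.trans ?_ (comHom_fin_two _).symm
  exact congrArg _ (one_smul ℚ _).symm

theorem ambientCounit_Ω : ambientCounit.app (Fin 2) Ω = 0 := by
  have h : ambientCounit.app (Fin 2) Ω = tm LabelAlgebra LabelAlgebra _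
      (DetOperad.val _ (orient 0 1 (by decide)))
      (ExteriorAlgebra.map (leafPart _) (wedge [(leaf 0).vee (leaf 1)])) := rfl
  have h' : ExteriorAlgebra.map (leafPart (Fin 2)) (wedge [(leaf 0).vee (leaf 1)]) = 0 := by
    simp [wedge, leafPart_single]
  rw [h, h']
  exact map_zero _

/-- The counit. -/
def counit : SuperHom Bess Com :=
  ambientCounit.lift comHom comHom_injective (mem_range_of_generators _ _
    ⟨_, ambientCounit_E.symm⟩ ⟨0, (map_zero _).trans ambientCounit_Ω.symm⟩)

theorem counit_E : counit.app (Fin 2) E = (1 : ℚ) := by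
  apply comHom_injective
  rw [counit, SuperHom.lift_app, ambientCounit_E]

theorem counit_Ω : counit.app (Fin 2) Ω = 0 := by
  apply comHom_injective
  rw [counit, SuperHom.lift_app, ambientCounit_Ω, map_zero]

theorem counit_scaling {I : Type} [Fintype I] [Nonempty I] (x : Bess.obj I) :
    counit.app I (isOperad.scaling I x) = counit.app I x := by
  refine superHom_ext ((SuperHom.scaling isOperad).trans counit) counit ?_ ?_ x
  · exact congrArg (counit.app _) scaling_E
  · refine (congrArg (counit.app _) scaling_Ω).trans ?_
    rw [map_smul, counit_Ω, smul_zero]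

/-- The counit is invariant under the scaling operator, so `(2 ^ n - 1)` times its value is zero,
and `2 ^ n ≠ 1`. -/
theorem counit_of_mem {I : Type} [Fintype I] [Nonempty I] {n : ℤ} (hn : n ≠ 0) {x : Bess.obj I}
    (hx : x ∈ Bess.gr I n) : counit.app I x = 0 := by
  have h := counit_scaling x
  rw [isOperad.scaling_apply n x hx, map_smul] at h
  have h2 : ((2 : ℚ) ^ n - 1) • counit.app I x = 0 := by rw [sub_smul, h, one_smul, sub_self]
  refine (smul_eq_zero.1 h2).resolve_left fun h3 => hn ?_
  rw [sub_eq_zero] at h3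
  exact (zpow_eq_one_iff_right₀ (by norm_num) (by norm_num)).1 h3

end Bess

/-! ### `Com` as a unit for the tensor product of operads -/

namespace PreOperad

variable {P : PreOperad}

/-- The left unit isomorphism, as a linear map. -/
def leftUnit (P : PreOperad) (I : Type) [Fintype I] [Nonempty I] :
    (Com.tensor P).obj I →ₗ[ℚ] P.obj I :=
  (TensorProduct.lid ℚ (P.obj I)).toLinearMap

@[simp] theorem leftUnit_tm {I : Type} [Fintype I] [Nonempty I] (c : Com.obj I) (x : P.obj I) :
    leftUnit P I (tm Com P I c x) = Com.val I c • x := rfl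

theorem leftUnit_injective {I : Type} [Fintype I] [Nonempty I] :
    Function.Injective (leftUnit P I) := (TensorProduct.lid ℚ (P.obj I)).injective

/-- The left unit isomorphism. -/
def SuperHom.leftUnitor (P : PreOperad) : SuperHom (Com.tensor P) P where
  app I _ _ := leftUnit P I
  app_par I _ _ x := by
    induction x using tm_induction with
    | zero => simp
    | add x y hx hy => simp only [map_add, hx, hy]
    | tm c x => simp [tensor_par]
  app_map {I J} _ _ _ _ e x := by
    induction x using tm_induction with
    | zero => simp
    | add x y hx hy => simp only [map_add, hx, hy]
    | tm c x => simp [tensor_map]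
  app_one := by simp [tensor_one]
  app_comp {I J} _ _ _ x y := by
    induction x using tm_induction with
    | zero => simp
    | add x x' hx hx' => simp only [map_add, LinearMap.add_apply, hx, hx']
    | tm c x =>
      induction y using tm_induction with
      | zero => simp
      | add y y' hy hy' => simp only [map_add, hy, hy']
      | tm d y =>
        have hd : Com.par _ d = d := rfl
        rw [tensor_comp, hd]
        simp [mul_smul, smul_comm (Com.val _ c)]
        module

/-- The right unit isomorphism, as a linear map. -/
def rightUnit (P : PreOperad) (I : Type) [Fintype I] [Nonempty I] :
    (P.tensor Com).obj I →ₗ[ℚ] P.obj I :=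
  (TensorProduct.rid ℚ (P.obj I)).toLinearMap

@[simp] theorem rightUnit_tm {I : Type} [Fintype I] [Nonempty I] (c : Com.obj I) (x : P.obj I) :
    rightUnit P I (tm P Com I x c) = Com.val I c • x := rfl

theorem rightUnit_injective {I : Type} [Fintype I] [Nonempty I] :
    Function.Injective (rightUnit P I) := (TensorProduct.rid ℚ (P.obj I)).injective

/-- The right unit isomorphism. -/
def SuperHom.rightUnitor (P : PreOperad) : SuperHom (P.tensor Com) P where
  app I _ _ := rightUnit P I
  app_par I _ _ x := by
    induction x using tm_induction with
    | zero => simp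
    | add x y hx hy => simp only [map_add, hx, hy]
    | tm x c => simp [tensor_par]
  app_map {I J} _ _ _ _ e x := by
    induction x using tm_induction with
    | zero => simp
    | add x y hx hy => simp only [map_add, hx, hy]
    | tm x c => simp [tensor_map]
  app_one := by simp [tensor_one]
  app_comp {I J} _ _ _ x y := by
    induction x using tm_induction with
    | zero => simp
    | add x x' hx hx' => simp only [map_add, LinearMap.add_apply, hx, hx']
    | tm x c =>
      induction y using tm_induction with
      | zero => simp
      | add y y' hy hy' => simp only [map_add, hy, hy']
      | tm y d =>
        have hc : Com.par _ c = c := rfl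
        rw [tensor_comp, hc]
        simp [mul_smul, smul_comm (Com.val _ c)]
        module

end PreOperad

/-! ### The counit axioms and the coalgebras `Bess(I)` -/

namespace Bess

/-- Followed by the unit isomorphism, the left side is an endomorphism of the operad `Bess`; it
fixes `E` and `Ω`, hence it is the identity. -/
theorem rTensor_counit_coproduct (I : Type) [Fintype I] [Nonempty I] (x : Bess.obj I) :
    tensorLin (counit.app I) LinearMap.id (superCoproduct.app I x) =
      tm Com Bess I (1 : ℚ) x := by
  apply leftUnit_injective
  refine (superHom_ext ((superCoproduct.trans (counit.tensor (SuperHom.refl Bess))).trans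
    (SuperHom.leftUnitor Bess)) (SuperHom.refl Bess) ?_ ?_ x).trans (one_smul ℚ x).symm
  · simp only [SuperHom.trans_app, superCoproduct_E, SuperHom.tensor_app_tm, SuperHom.refl_app,
      counit_E]
    exact one_smul ℚ E
  · simp only [SuperHom.trans_app, superCoproduct_Ω, map_add, SuperHom.tensor_app_tm,
      SuperHom.refl_app, counit_E, counit_Ω, map_zero, LinearMap.zero_apply, add_zero]
    exact one_smul ℚ Ω

theorem lTensor_counit_coproduct (I : Type) [Fintype I] [Nonempty I] (x : Bess.obj I) :
    tensorLin LinearMap.id (counit.app I) (superCoproduct.app I x) =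
      tm Bess Com I x (1 : ℚ) := by
  apply rightUnit_injective
  refine (superHom_ext ((superCoproduct.trans ((SuperHom.refl Bess).tensor counit)).trans
    (SuperHom.rightUnitor Bess)) (SuperHom.refl Bess) ?_ ?_ x).trans (one_smul ℚ x).symm
  · simp only [SuperHom.trans_app, superCoproduct_E, SuperHom.tensor_app_tm, SuperHom.refl_app,
      counit_E]
    exact one_smul ℚ E
  · simp only [SuperHom.trans_app, superCoproduct_Ω, map_add, SuperHom.tensor_app_tm,
      SuperHom.refl_app, counit_E, counit_Ω, map_zero, zero_add]
    exact one_smul ℚ Ω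

/-- The coalgebra structure on `Bess(I)`. -/
abbrev coalgebra (I : Type) [Fintype I] [Nonempty I] : Coalgebra ℚ (Bess.obj I) where
  comul := coproduct.coprod I
  counit := counit.app I
  coassoc := coproduct_coassociative I
  rTensor_counit_comp_comul := LinearMap.ext fun x => rTensor_counit_coproduct I x
  lTensor_counit_comp_comul := LinearMap.ext fun x => lTensor_counit_coproduct I x

end Bess

theorem mainTheorem1 :
    Bess.IsOperad ∧ (Bess.tensor Bess).IsOperad ∧
    ∃ Δ : PreOperad.Hom Bess (Bess.tensor Bess),
      Bess.OnGenerators Δ ∧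
      (∀ Δ' : PreOperad.Hom Bess (Bess.tensor Bess), Bess.OnGenerators Δ' → Δ' = Δ) ∧
      Δ.Coassociative ∧ Δ.Cocommutative ∧
      ∀ (I : Type) [Fintype I] [Nonempty I],
        ∃ C : Coalgebra ℚ (Bess.obj I),
          C.comul = Δ.coprod I ∧ ∀ n : ℤ, n ≠ 0 → ∀ x ∈ Bess.gr I n, C.counit x = 0 := by
  exact ⟨Bess.isOperad, Bess.isOperad.tensor Bess.isOperad, Bess.coproduct,
    Bess.coproduct_onGenerators, Bess.coproduct_unique, Bess.coproduct_coassociative, Bess.coproduct_cocommutative,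
    fun I _ _ => ⟨Bess.coalgebra I, rfl, fun _ hn _ hx => Bess.counit_of_mem hn hx⟩⟩

end
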